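/- Consider the following scheduling problem. There are $m$ machines and $n$ jobs, and positive integers $w<W$. Every job is either heavy, with weight $W$, or light, with weight $w$. Each job $j$ comes with a nonempty set of machines to which it can be assigned; for a heavy job this set has at most two elements, for a light job it can have any number of elements. In addition every machine $v$ carries an arbitrary nonnegative integral dedicated load $dl(v)$. An assignment $\sigma$ maps every job to a machine to which it can be assigned; its makespan is $\max_v \big(dl(v)+\sum_{j:\sigma(j)=v} w_j\big)$, where $w_j$ is the weight of $j$, and $\mathrm{OPT}$ denotes the minimum makespan of an assignment. There is an algorithm that, given any such instance, returns an assignment with makespan at most $\frac32\,\mathrm{OPT}$, and whose running time is bounded by a polynomial in the bit length of the instance (all numbers being written in binary). Here running time is the number of steps of a random access machine whose operations are addition, truncated subtraction, halving, comparison and access to memory, each at unit cost. -/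

import Mathlib

/-! ## Makespan minimization: two job sizes, heavy jobs with at most two choices -/

/-- An instance of graph balancing with light hyper edges and two job sizes.
There are `m` machines and `n` jobs. A heavy job has weight `W` and may go to at most two machines;
a light job has weight `w < W` and may go to any positive number of machines. In addition every
machine `v` carries an arbitrary dedicated load `dl v`. -/
structure BalancingInstance where
  /-- number of machines -/
  m : ℕ
  /-- number of jobs -/
  n : ℕ
  /-- weight of the light jobs -/
  w : ℕ
  /-- weight of the heavy jobs -/
  W : ℕ
  /-- dedicated loads -/
  dl : Fin m → ℕ
  /-- which jobs are heavy -/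
  heavy : Fin n → Bool
  /-- the machines a job can be assigned to -/
  allowed : Fin n → Finset (Fin m)
  w_pos : 0 < w
  w_lt_W : w < W
  allowed_nonempty : ∀ j, (allowed j).Nonempty
  allowed_heavy : ∀ j, heavy j = true → (allowed j).card ≤ 2

namespace BalancingInstance

variable (I : BalancingInstance)

/-- The weight of a job. -/
def weight (j : Fin I.n) : ℕ := if I.heavy j = true then I.W else I.w

/-- `σ` is an assignment: every job goes to a machine to which it can be assigned. -/
def IsAssignment (σ : Fin I.n → Fin I.m) : Prop := ∀ j, σ j ∈ I.allowed j

/-- The load of machine `v` under `σ`, including its dedicated load. -/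
def load (σ : Fin I.n → Fin I.m) (v : Fin I.m) : ℕ :=
  I.dl v + ∑ j with σ j = v, I.weight j

/-- The makespan of `σ`: the maximum load of a machine (`0` if there are no machines). -/
def makespan (σ : Fin I.n → Fin I.m) : ℕ := Finset.univ.sup (I.load σ)

/-- The optimal makespan: the minimum over all assignments (the set is never empty, since every
job can go somewhere). -/
noncomputable def opt : ℕ := sInf {T | ∃ σ, I.IsAssignment σ ∧ I.makespan σ = T}

/-- The instance as a list of natural numbers: the numbers `m`, `n`, `w`, `W`, then the dedicated
loads, then for every job one bit telling whether it is heavy followed by `m` bits describing the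
set of machines to which it can be assigned. -/
def encode : List ℕ :=
  [I.m, I.n, I.w, I.W] ++ List.ofFn I.dl ++
    (List.ofFn fun j => (I.heavy j).toNat ::
      List.ofFn fun v => if v ∈ I.allowed j then 1 else 0).flatten

end BalancingInstance

/-! ## Random access machines with a step count

Programs with finitely many variables and finitely many arrays holding natural numbers. The
operations are addition, truncated subtraction, halving and comparison, each at unit cost. There is
no multiplication, so a number gets at most a constant number of bits longer per step, and
polynomial time in this model is polynomial time on Turing machines. -/

namespace RAM

/-- The memory: variable `x` holds `var x`, and cell `i` of array `a` holds `arr a i`. -/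
@[ext]
structure State where
  /-- the variables -/
  var : ℕ → ℕ
  /-- the arrays -/
  arr : ℕ → ℕ → ℕ

/-- Write `c` to variable `x`. -/
def State.setVar (s : State) (x c : ℕ) : State :=
  ⟨Function.update s.var x c, s.arr⟩

/-- Write `c` to cell `i` of array `a`. -/
def State.setCell (s : State) (a i c : ℕ) : State :=
  ⟨s.var, Function.update s.arr a (Function.update (s.arr a) i c)⟩

/-- Arithmetic expressions. -/
inductive Exp where
  /-- a constant -/
  | const (c : ℕ) : Exp
  /-- the content of variable `x` -/
  | var (x : ℕ) : Exp
  /-- the content of the cell of array `a` with the given index -/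
  | get (a : ℕ) (i : Exp) : Exp
  /-- addition -/
  | add (e f : Exp) : Exp
  /-- truncated subtraction -/
  | sub (e f : Exp) : Exp
  /-- division by two, rounded down -/
  | half (e : Exp) : Exp

namespace Exp

/-- The value of an expression. -/
def eval (s : State) : Exp → ℕ
  | const c => c
  | var x => s.var x
  | get a i => s.arr a (i.eval s)
  | add e f => e.eval s + f.eval s
  | sub e f => e.eval s - f.eval s
  | half e => e.eval s / 2

/-- The time needed to evaluate an expression: the number of its nodes. -/
def cost : Exp → ℕ
  | const _ => 1
  | var _ => 1
  | get _ i => i.cost + 1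
  | add e f => e.cost + f.cost + 1
  | sub e f => e.cost + f.cost + 1
  | half e => e.cost + 1

end Exp

/-- Programs. -/
inductive Prog where
  /-- do nothing -/
  | skip : Prog
  /-- `x := e` -/
  | set (x : ℕ) (e : Exp) : Prog
  /-- `a[i] := e` -/
  | put (a : ℕ) (i e : Exp) : Prog
  /-- first `p`, then `q` -/
  | seq (p q : Prog) : Prog
  /-- if `e < f` then `p` else `q` -/
  | ite (e f : Exp) (p q : Prog) : Prog
  /-- while `e < f` do `p` -/
  | loop (e f : Exp) (p : Prog) : Prog

/-- `Runs p s s' k`: started in memory `s`, program `p` halts after exactly `k` steps in memory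
`s'`. -/
inductive Runs : Prog → State → State → ℕ → Prop
  | skip (s : State) : Runs .skip s s 1
  | set (x : ℕ) (e : Exp) (s : State) :
      Runs (.set x e) s (s.setVar x (e.eval s)) (e.cost + 1)
  | put (a : ℕ) (i e : Exp) (s : State) :
      Runs (.put a i e) s (s.setCell a (i.eval s) (e.eval s)) (i.cost + e.cost + 1)
  | seq {p q : Prog} {s s' s'' : State} {k l : ℕ} :
      Runs p s s' k → Runs q s' s'' l → Runs (.seq p q) s s'' (k + l)
  | ite_true {e f : Exp} {p q : Prog} {s s' : State} {k : ℕ} :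
      e.eval s < f.eval s → Runs p s s' k →
        Runs (.ite e f p q) s s' (e.cost + f.cost + 1 + k)
  | ite_false {e f : Exp} {p q : Prog} {s s' : State} {k : ℕ} :
      ¬ e.eval s < f.eval s → Runs q s s' k →
        Runs (.ite e f p q) s s' (e.cost + f.cost + 1 + k)
  | loop_true {e f : Exp} {p : Prog} {s s' s'' : State} {k l : ℕ} :
      e.eval s < f.eval s → Runs p s s' k → Runs (.loop e f p) s' s'' l →
        Runs (.loop e f p) s s'' (e.cost + f.cost + 1 + k + l)
  | loop_false {e f : Exp} {p : Prog} {s : State} :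
      ¬ e.eval s < f.eval s → Runs (.loop e f p) s s (e.cost + f.cost + 1)

/-- The initial memory: array `0` holds the input, everything else is `0`. -/
def init (input : List ℕ) : State where
  var := fun _ => 0
  arr := fun a i => if a = 0 then input.getD i 0 else 0

/-- The size of an input in bits, counting one separator per number. -/
def bitSize (input : List ℕ) : ℕ := (input.map fun x => x.size + 1).sum

end RAM

/-! It suffices to have, for each guess `T`, a polynomial procedure that finds an assignment of
makespan at most `T + T / 2` or shows that no assignment has makespan at most `T`. The optimum is
the load of some machine, hence of the form `dl v + a * W + b * w` with `a` and `b` at most the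
number of jobs. All these candidates are tried; the smallest successful one is at most the optimum.

The engine is a push-relabel search. Machines have heights; an overloaded machine gives jobs to
lower machines, and rises when it cannot. If the search is stuck, some machine has height at least
`M`, so some height below `M` is not taken (`Blocked.exists_gap`), and jobs on machines above this
gap can only be assigned to machines above it (`Inv.exists_closed`). If `2 W ≤ T`, all jobs are
searched at once: every machine above the gap has load more than `T`'s worth even after allowing for
one job, or is at least loaded as in a solution, and the total contradicts a solution for `T`.

If `T < 2 W`, a solution puts at most one heavy job on each machine, and the same search with
threshold `1` finds such an assignment `σ` of the heavy jobs. Regard a heavy job as an arrow from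
its machine to the other machine allowed for it. Following arrows leads to a machine without a heavy
job (a root) or into a cycle. A component whose root has room for `W` is a group: a solution leaves
at most one of its machines without a heavy job (`eq_of_hc_eq_zero`). Outside the groups, a machine
with a heavy job has one in every solution (`hc_pos_of_not_grouped`), so `W` is added to its base
load. The light jobs are then searched with the aim that base and light load stay within `T + T /
2`, and that in each group at most one machine is hot, that is, cannot bear `W` in addition.
Shifting heavy jobs along the path from the hot machine to the root relieves the hot machine
(`Forest.flip`).

The light search succeeds because of a count above the gap (`group_sum`). Group by group, the search
has at least as many light jobs there as a solution, and strictly more in the group of the stuck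
machine. The only machine of a group that can fall short is the one without a heavy job in the
solution; the `pair` part of the invariant provides one or two machines whose surplus makes up for
it.

A potential bounds the number of search steps by `M * M * (N + 1)`. The program uses only loops
bounded by the numbers of machines and jobs (`Cmd`), so its running time is polynomial (`Cmd.runs`).
-/

open Finset

/-! ## Push-relabel local search on a grouped assignment problem -/

/-- A grouped assignment problem on machines `0, …, M - 1` and jobs `0, …, N - 1`. Machines carry
base loads `D`, machines `v` with `grp v < M` form groups, in each of which one machine is excused
from carrying the extra load `X`. -/
structure Net where
  M : ℕ
  N : ℕ
  X : ℕ
  thr : ℕ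
  D : ℕ → ℕ
  wt : ℕ → ℕ
  grp : ℕ → ℕ
  al : ℕ → ℕ → Prop

/-- The weight of the jobs among the first `N` which `σ` puts on `v`. -/
def jobLoad (N : ℕ) (wt σ : ℕ → ℕ) (v : ℕ) : ℕ := ∑ j ∈ range N, if σ j = v then wt j else 0

theorem sum_jobLoad (N : ℕ) (wt σ : ℕ → ℕ) (R : Finset ℕ) :
    ∑ v ∈ R, jobLoad N wt σ v = ∑ j ∈ range N, if σ j ∈ R then wt j else 0 := by
  unfold jobLoad
  rw [sum_comm]
  refine sum_congr rfl fun j _ => ?_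
  rw [sum_ite_eq]

/-- Counting by jobs instead of machines: a job that contributes on the left stays inside `R` under
`τ` and contributes on the right. -/
theorem sum_jobLoad_le_of_closed {N : ℕ} {wt σ τ : ℕ → ℕ} {R : Finset ℕ}
    (hR : ∀ j < N, wt j ≠ 0 → σ j ∈ R → τ j ∈ R) :
    ∑ v ∈ R, jobLoad N wt σ v ≤ ∑ v ∈ R, jobLoad N wt τ v := by
  rw [sum_jobLoad, sum_jobLoad]
  refine sum_le_sum fun j hj => ?_
  by_cases h0 : wt j = 0
  · simp [h0]
  by_cases h : σ j ∈ R
  · rw [if_pos h, if_pos (hR j (mem_range.1 hj) h0 h)]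
  · rw [if_neg h]; exact Nat.zero_le _

theorem jobLoad_update_of_ne {N : ℕ} {wt σ : ℕ → ℕ} {j v x : ℕ} (hx : x ≠ σ j) :
    jobLoad N wt σ x ≤ jobLoad N wt (Function.update σ j v) x := by
  unfold jobLoad
  refine sum_le_sum fun i _ => ?_
  by_cases hi : i = j
  · subst hi
    simp [hx.symm]
  · rw [Function.update_of_ne hi]

theorem jobLoad_le_update_add {N ω : ℕ} {wt σ : ℕ → ℕ} {j v x : ℕ} (hω : ∀ i < N, wt i ≤ ω) :
    jobLoad N wt σ x ≤ jobLoad N wt (Function.update σ j v) x + ω := by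
  unfold jobLoad
  by_cases hj : j < N
  · rw [← add_sum_erase _ _ (mem_range.2 hj), ← add_sum_erase (range N) _ (mem_range.2 hj)]
    have h1 : ∑ i ∈ (range N).erase j, (if σ i = x then wt i else 0) =
        ∑ i ∈ (range N).erase j, if Function.update σ j v i = x then wt i else 0 := by
      refine sum_congr rfl fun i hi => ?_
      rw [Function.update_of_ne (ne_of_mem_erase hi)]
    rw [← h1]
    have h2 : (if σ j = x then wt j else 0) ≤ ω := by
      split_ifs
      · exact hω j hj
      · exact Nat.zero_le _
    omega
  · refine le_trans (le_of_eq (sum_congr rfl fun i hi => ?_)) (Nat.le_add_right _ _)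
    have : i ≠ j := by rintro rfl; exact hj (mem_range.1 hi)
    rw [Function.update_of_ne this]

namespace Net

variable (P : Net)

/-- The load of `v`. -/
def A (σ : ℕ → ℕ) (v : ℕ) : ℕ := P.D v + jobLoad P.N P.wt σ v

/-- `v` is overloaded unless it is excused from carrying the extra load. -/
def Hot (σ : ℕ → ℕ) (v : ℕ) : Prop := P.thr < P.A σ v + P.X

/-- `v` has to give a job away: it is overloaded, or lowest among the hot machines of a group with
at least two of them. -/
def Elig (σ h : ℕ → ℕ) (v : ℕ) : Prop :=
  P.thr < P.A σ v ∨ (P.grp v < P.M ∧ P.Hot σ v ∧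
    (∃ u < P.M, u ≠ v ∧ P.grp u = P.grp v ∧ P.Hot σ u) ∧
    ∀ u < P.M, P.grp u = P.grp v → P.Hot σ u → h v ≤ h u)

/-- Every job is on a machine to which it may be assigned. -/
def Valid (σ : ℕ → ℕ) : Prop := ∀ j < P.N, σ j < P.M ∧ P.al j (σ j)

/-- The invariant of the local search, with heights `h` and weights at most `ω`. -/
structure Inv (ω : ℕ) (σ h : ℕ → ℕ) : Prop where
  valid : P.Valid σ
  le : ∀ v < P.M, h v ≤ P.M
  -- No job can fall by more than one level, so none can jump over a gap in the heights.
  lip : ∀ j < P.N, ∀ v < P.M, P.al j v → h (σ j) ≤ h v + 1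
  warm : ∀ v < P.M, 0 < h v → P.thr < P.A σ v + (if P.grp v < P.M then P.X else 0) + ω
  -- Required at every level `k`, because the gap is not known in advance. The alternatives remember
  -- why the group rose: an overload, or two hot machines. The `ω` allows for one job given away
  -- since.
  pair : ∀ k, ∀ v < P.M, P.grp v < P.M → k < h v →
    ∃ y < P.M, P.grp y = P.grp v ∧ k < h y ∧ (P.thr < P.A σ y + ω ∨ (P.thr < P.A σ y + P.X ∧
      ∃ z < P.M, z ≠ y ∧ P.grp z = P.grp v ∧ k < h z ∧ P.thr < P.A σ z + P.X + ω))

/-- The search has failed: a machine that has to give a job away is at maximal height. -/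
def Blocked (σ h : ℕ → ℕ) : Prop := ∃ v < P.M, P.Elig σ h v ∧ P.M ≤ h v

/-- Job `j` can be pushed down to `v`. -/
def CanPush (σ h : ℕ → ℕ) (j v : ℕ) : Prop :=
  j < P.N ∧ v < P.M ∧ P.Elig σ h (σ j) ∧ P.al j v ∧ h v < h (σ j)

open Classical in
/-- One step of the local search. -/
def Step (σ h σ' h' : ℕ → ℕ) : Prop :=
  (P.Blocked σ h ∧ σ' = σ ∧ h' = h) ∨
  (¬ P.Blocked σ h ∧ ∃ j v, P.CanPush σ h j v ∧ σ' = Function.update σ j v ∧ h' = h) ∨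
  (¬ P.Blocked σ h ∧ (∀ j v, ¬ P.CanPush σ h j v) ∧ σ' = σ ∧
    h' = fun v => if v < P.M ∧ P.Elig σ h v then h v + 1 else h v)

/-- The search has ended. -/
def Halted (σ h : ℕ → ℕ) : Prop := (∀ v < P.M, ¬ P.Elig σ h v) ∨ P.Blocked σ h

/-- The potential of the local search. -/
def pot (σ h : ℕ → ℕ) : ℤ :=
  (P.N + 1) * (∑ v ∈ range P.M, (h v : ℤ)) - ∑ j ∈ range P.N, (h (σ j) : ℤ)

variable {P}

theorem Inv.init {ω : ℕ} {σ : ℕ → ℕ} (hσ : P.Valid σ) {h : ℕ → ℕ} (hh : ∀ v < P.M, h v = 0) :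
    P.Inv ω σ h where
  valid := hσ
  le v hv := by simp [hh v hv]
  lip j hj v hv _ := by simp [hh _ (hσ j hj).1]
  warm v hv h0 := by simp [hh v hv] at h0
  pair k v hv _ h0 := by simp [hh v hv] at h0

theorem A_update_of_ne {σ : ℕ → ℕ} {j v x : ℕ} (hx : x ≠ σ j) :
    P.A σ x ≤ P.A (Function.update σ j v) x :=
  Nat.add_le_add_left (jobLoad_update_of_ne hx) _

theorem A_le_update_add {ω : ℕ} {σ : ℕ → ℕ} {j v x : ℕ} (hω : ∀ i < P.N, P.wt i ≤ ω) :
    P.A σ x ≤ P.A (Function.update σ j v) x + ω := by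
  have := jobLoad_le_update_add (σ := σ) (j := j) (v := v) (x := x) hω
  unfold A; omega

theorem Elig.warm {σ h : ℕ → ℕ} {v : ℕ} (hv : P.Elig σ h v) :
    P.thr < P.A σ v + (if P.grp v < P.M then P.X else 0) := by
  rcases hv with hv | ⟨h1, h2, -⟩
  · omega
  · rw [if_pos h1]; exact h2

/-- Only the giving machine loses load, at most `ω`, and it was eligible just before. If it lies
above level `k` in the group, it supplies a new witness for `pair`: alone if it was overloaded,
otherwise as `z` next to another hot machine, which is at least as high because the giver is lowest.
-/
theorem Inv.push {ω : ℕ} (hω : ∀ i < P.N, P.wt i ≤ ω) {σ h : ℕ → ℕ} (hI : P.Inv ω σ h) {j v : ℕ}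
    (hp : P.CanPush σ h j v) : P.Inv ω (Function.update σ j v) h := by
  obtain ⟨hj, hv, he, ha, hlt⟩ := hp
  have hu := (hI.valid j hj).1
  have mono : ∀ x, x ≠ σ j → P.A σ x ≤ P.A (Function.update σ j v) x :=
    fun x hx => A_update_of_ne hx
  have drop : P.A σ (σ j) ≤ P.A (Function.update σ j v) (σ j) + ω := A_le_update_add hω
  refine ⟨fun i hi => ?_, hI.le, fun i hi x hx hax => ?_, fun x hx h0 => ?_,
    fun k x hx hg hk => ?_⟩
  · by_cases hij : i = j
    · subst hij; simp [hv, ha]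
    · rw [Function.update_of_ne hij]; exact hI.valid i hi
  · by_cases hij : i = j
    · subst hij
      have := hI.lip i hi x hx hax
      simp only [Function.update_self]; omega
    · rw [Function.update_of_ne hij]; exact hI.lip i hi x hx hax
  · by_cases hxu : x = σ j
    · subst hxu
      have := he.warm
      omega
    · have := hI.warm x hx h0
      have := mono x hxu
      omega
  · by_cases hc : P.grp (σ j) = P.grp x ∧ k < h (σ j)
    · obtain ⟨hc1, hc2⟩ := hc
      rcases he with he | ⟨-, he1, ⟨u, hu1, hu2, hu3, hu4⟩, he3⟩
      · exact ⟨σ j, hu, hc1, hc2, Or.inl (by omega)⟩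
      · have h5 := he3 u hu1 hu3 hu4
        have h6 := mono u hu2
        unfold Hot at he1 hu4
        exact ⟨u, hu1, hu3.trans hc1, by omega, Or.inr ⟨by omega, σ j, hu, hu2.symm, hc1, hc2,
          by omega⟩⟩
    · obtain ⟨y, hy, hyg, hyk, hy'⟩ := hI.pair k x hx hg hk
      have hyu : y ≠ σ j := by rintro rfl; exact hc ⟨hyg, hyk⟩
      have h6 := mono y hyu
      refine ⟨y, hy, hyg, hyk, ?_⟩
      rcases hy' with hy' | ⟨hy', z, hz, hzy, hzg, hzk, hz'⟩
      · left; omega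
      · have hzu : z ≠ σ j := by rintro rfl; exact hc ⟨hzg, hzk⟩
        have h7 := mono z hzu
        exact Or.inr ⟨by omega, z, hz, hzy, hzg, hzk, by omega⟩

-- A raised machine has no job that could go lower, so `lip` survives. At a newly reached level the
-- raised machine itself is the witness for `pair`. All eligible machines rise together, so a hot
-- partner tied with it in height rises as well.
open Classical in
theorem Inv.raise {ω : ℕ} {σ h : ℕ → ℕ} (hI : P.Inv ω σ h) (hb : ¬ P.Blocked σ h)
    (hp : ∀ j v, ¬ P.CanPush σ h j v) :
    P.Inv ω σ (fun v => if v < P.M ∧ P.Elig σ h v then h v + 1 else h v) := by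
  have hmono : ∀ v, h v ≤ if v < P.M ∧ P.Elig σ h v then h v + 1 else h v := by
    intro v; split_ifs <;> omega
  refine ⟨hI.valid, fun v hv => ?_, fun j hj v hv ha => ?_, fun v hv h0 => ?_,
    fun k v hv hg hk => ?_⟩
  · split_ifs with h1
    · by_contra hcon
      exact hb ⟨v, hv, h1.2, by omega⟩
    · exact hI.le v hv
  · have h2 := hmono v
    by_cases h1 : σ j < P.M ∧ P.Elig σ h (σ j)
    · rw [if_pos h1]
      have : ¬ h v < h (σ j) := fun hlt => hp j v ⟨hj, hv, h1.2, ha, hlt⟩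
      omega
    · rw [if_neg h1]
      have := hI.lip j hj v hv ha
      omega
  · split_ifs at h0 with h1
    · have := h1.2.warm
      omega
    · exact hI.warm v hv h0
  · by_cases hk' : k < h v
    · obtain ⟨y, hy, hyg, hyk, hy'⟩ := hI.pair k v hv hg hk'
      refine ⟨y, hy, hyg, hyk.trans_le (hmono y), ?_⟩
      rcases hy' with hy' | ⟨hy', z, hz, hzy, hzg, hzk, hz'⟩
      · exact Or.inl hy'
      · exact Or.inr ⟨hy', z, hz, hzy, hzg, hzk.trans_le (hmono z), hz'⟩
    · have he : v < P.M ∧ P.Elig σ h v := by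
        by_contra hcon
        rw [if_neg hcon] at hk
        exact hk' hk
      rcases he.2 with hs | ⟨-, h1, ⟨u, hu1, hu2, hu3, hu4⟩, h3⟩
      · exact ⟨v, hv, rfl, hk, Or.inl (by omega)⟩
      · refine ⟨v, hv, rfl, hk, Or.inr ⟨h1, u, hu1, hu2, hu3, ?_, ?_⟩⟩
        · have h5 := h3 u hu1 hu3 hu4
          by_cases h6 : k < h u
          · exact h6.trans_le (hmono u)
          · rw [if_pos he] at hk
            have hue : P.Elig σ h u := by
              refine Or.inr ⟨by omega, hu4, ⟨v, hv, hu2.symm, hu3.symm, h1⟩, fun x hx hxg hxh => ?_⟩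
              have := h3 x hx (hxg.trans hu3) hxh
              omega
            rw [if_pos ⟨hu1, hue⟩]
            omega
        · unfold Hot at hu4; omega

theorem Inv.pot_le {ω : ℕ} {σ h : ℕ → ℕ} (hI : P.Inv ω σ h) :
    P.pot σ h ≤ (P.M * P.M * (P.N + 1) : ℕ) := by
  have h1 : ∑ v ∈ range P.M, (h v : ℤ) ≤ P.M * P.M := by
    calc ∑ v ∈ range P.M, (h v : ℤ) ≤ ∑ v ∈ range P.M, (P.M : ℤ) :=
          sum_le_sum fun v hv => by exact_mod_cast hI.le v (mem_range.1 hv)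
      _ = _ := by simp
  have h2 : 0 ≤ ∑ j ∈ range P.N, (h (σ j) : ℤ) := sum_nonneg fun _ _ => by positivity
  unfold pot
  push_cast
  nlinarith

theorem pot_push {σ h : ℕ → ℕ} {j v : ℕ} (hp : P.CanPush σ h j v) :
    P.pot σ h + 1 ≤ P.pot (Function.update σ j v) h := by
  have hj := mem_range.2 hp.1
  have h1 : ∑ i ∈ (range P.N).erase j, (h (σ i) : ℤ) =
      ∑ i ∈ (range P.N).erase j, (h (Function.update σ j v i) : ℤ) :=
    sum_congr rfl fun i hi => by rw [Function.update_of_ne (ne_of_mem_erase hi)]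
  have h2 : (h v : ℤ) < h (σ j) := by exact_mod_cast hp.2.2.2.2
  unfold pot
  rw [← add_sum_erase _ _ hj, ← add_sum_erase (range P.N) _ hj, h1]
  simp only [Function.update_self]
  linarith

-- Raising a machine gains `N + 1` and costs one for each job on it, at most `N`. This is what the
-- factor in `pot` is for.
open Classical in
theorem pot_raise {σ h : ℕ → ℕ} (hσ : P.Valid σ) (he : ∃ v < P.M, P.Elig σ h v) :
    P.pot σ h + 1 ≤ P.pot σ (fun v => if v < P.M ∧ P.Elig σ h v then h v + 1 else h v) := by
  set c : ℕ → ℤ := fun v => if v < P.M ∧ P.Elig σ h v then 1 else 0 with hc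
  have hc0 : ∀ v, 0 ≤ c v := fun v => by rw [hc]; dsimp only; split_ifs <;> norm_num
  have hcast : ∀ v, (((if v < P.M ∧ P.Elig σ h v then h v + 1 else h v : ℕ)) : ℤ) = h v + c v := by
    intro v; rw [hc]; dsimp only; split_ifs <;> simp
  have h1 : 1 ≤ ∑ v ∈ range P.M, c v := by
    obtain ⟨v, hv, hv'⟩ := he
    have h2 := single_le_sum (f := c) (fun i _ => hc0 i) (mem_range.2 hv)
    have : c v = 1 := if_pos ⟨hv, hv'⟩
    linarith
  have h2 : ∑ j ∈ range P.N, c (σ j) ≤ P.N * ∑ v ∈ range P.M, c v := by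
    calc ∑ j ∈ range P.N, c (σ j) ≤ ∑ j ∈ range P.N, ∑ v ∈ range P.M, c v :=
          sum_le_sum fun j hj => single_le_sum (f := c) (fun i _ => hc0 i)
            (mem_range.2 (hσ j (mem_range.1 hj)).1)
      _ = _ := by simp
  unfold pot
  simp only [hcast, sum_add_distrib]
  linarith

theorem Inv.step {ω : ℕ} (hω : ∀ i < P.N, P.wt i ≤ ω) {σ h σ' h' : ℕ → ℕ} (hI : P.Inv ω σ h)
    (hs : P.Step σ h σ' h') : P.Inv ω σ' h' := by
  rcases hs with ⟨-, rfl, rfl⟩ | ⟨-, j, v, hp, rfl, rfl⟩ | ⟨hb, hp, rfl, rfl⟩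
  · exact hI
  · exact hI.push hω hp
  · exact hI.raise hb hp

-- This allows running a fixed number of steps without testing for the end: with no eligible machine
-- there is nothing to push and raising has no effect.
open Classical in
theorem Step.halted {σ h σ' h' : ℕ → ℕ} (hσ : P.Valid σ) (hs : P.Step σ h σ' h')
    (hh : P.Halted σ h) : P.Halted σ' h' := by
  rcases hs with ⟨-, rfl, rfl⟩ | ⟨hb, j, v, hp, rfl, rfl⟩ | ⟨hb, hp, rfl, rfl⟩
  · exact hh
  · rcases hh with hh | hh
    · exact absurd hp.2.2.1 (hh _ (hσ j hp.1).1)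
    · exact absurd hh hb
  · rcases hh with hh | hh
    · have : (fun v => if v < P.M ∧ P.Elig σ' h v then h v + 1 else h v) = h :=
        funext fun v => if_neg fun hv => hh v hv.1 hv.2
      rw [this]
      exact Or.inl hh
    · exact absurd hh hb

theorem Step.pot {σ h σ' h' : ℕ → ℕ} (hσ : P.Valid σ) (hs : P.Step σ h σ' h')
    (hh : ¬ P.Halted σ h) : P.pot σ h + 1 ≤ P.pot σ' h' := by
  rcases hs with ⟨hb, rfl, rfl⟩ | ⟨hb, j, v, hp, rfl, rfl⟩ | ⟨hb, hp, rfl, rfl⟩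
  · exact absurd (Or.inr hb) hh
  · exact pot_push hp
  · refine pot_raise hσ ?_
    by_contra hcon
    push Not at hcon
    exact hh (Or.inl hcon)

/-- What is known after `k` steps. -/
def After (P : Net) (ω k : ℕ) (σ h : ℕ → ℕ) : Prop :=
  P.Inv ω σ h ∧ (P.Halted σ h ∨ (k : ℤ) ≤ P.pot σ h)

theorem After.step {ω k : ℕ} (hω : ∀ i < P.N, P.wt i ≤ ω) {σ h σ' h' : ℕ → ℕ}
    (ha : P.After ω k σ h) (hs : P.Step σ h σ' h') : P.After ω (k + 1) σ' h' := by
  refine ⟨ha.1.step hω hs, ?_⟩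
  by_cases hh : P.Halted σ h
  · exact Or.inl (hs.halted ha.1.valid hh)
  · right
    have h1 := hs.pot ha.1.valid hh
    have h2 := ha.2.resolve_left hh
    push_cast
    linarith

open Classical in
theorem exists_step (P : Net) (σ h : ℕ → ℕ) : ∃ σ' h', P.Step σ h σ' h' := by
  by_cases hb : P.Blocked σ h
  · exact ⟨_, _, Or.inl ⟨hb, rfl, rfl⟩⟩
  by_cases hp : ∃ j v, P.CanPush σ h j v
  · obtain ⟨j, v, hp⟩ := hp
    exact ⟨_, _, Or.inr (Or.inl ⟨hb, j, v, hp, rfl, rfl⟩)⟩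
  · push Not at hp
    exact ⟨_, _, Or.inr (Or.inr ⟨hb, hp, rfl, rfl⟩)⟩

/-- Otherwise one further step would lift the potential above the bound of `Inv.pot_le`. -/
theorem After.halted {ω : ℕ} (hω : ∀ i < P.N, P.wt i ≤ ω) {σ h : ℕ → ℕ}
    (ha : P.After ω (P.M * P.M * (P.N + 1)) σ h) : P.Halted σ h := by
  by_contra hh
  obtain ⟨σ', h', hs⟩ := P.exists_step σ h
  have h1 := (ha.1.step hω hs).pot_le
  have h2 := hs.pot ha.1.valid hh
  have h3 := ha.2.resolve_left hh
  linarith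

/-- Pigeonhole: the blocked machine has height at least `M`, which leaves `M - 1` machines for the
`M` heights below. -/
theorem Blocked.exists_gap {σ h : ℕ → ℕ} (hb : P.Blocked σ h) :
    ∃ k < P.M, ∀ v < P.M, h v ≠ k := by
  by_contra hcon
  push Not at hcon
  obtain ⟨y, hy, -, hyM⟩ := hb
  have hsub : range P.M ⊆ ((range P.M).erase y).image h := by
    intro k hk
    obtain ⟨v, hv, rfl⟩ := hcon k (mem_range.1 hk)
    refine mem_image_of_mem _ (mem_erase.2 ⟨?_, mem_range.2 hv⟩)
    rintro rfl
    have := mem_range.1 hk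
    omega
  have h1 := card_le_card hsub
  have h2 := h1.trans card_image_le
  rw [card_erase_of_mem (mem_range.2 hy), card_range] at h2
  omega

/-- When the search has failed, the machines above a gap in the heights keep all of their jobs. -/
theorem Inv.exists_closed {ω : ℕ} {σ h : ℕ → ℕ} (hI : P.Inv ω σ h) (hb : P.Blocked σ h) :
    ∃ k, (∃ v < P.M, P.Elig σ h v ∧ k < h v) ∧ ∀ τ, P.Valid τ →
      ∀ j < P.N, σ j ∈ (range P.M).filter (k < h ·) → τ j ∈ (range P.M).filter (k < h ·) := by
  obtain ⟨k, hk, hk'⟩ := hb.exists_gap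
  obtain ⟨y, hy, hye, hyM⟩ := hb
  refine ⟨k, ⟨y, hy, hye, by omega⟩, fun τ hτ j hj hR => ?_⟩
  obtain ⟨h1, h2⟩ := hτ j hj
  -- From a height above `k` a job reaches height `k` at worst, and no machine has height `k`.
  have h3 := hI.lip j hj _ h1 h2
  have h4 := (mem_filter.1 hR).2
  have h5 := hk' _ h1
  exact mem_filter.2 ⟨mem_range.2 h1, by omega⟩

/-- The machines above the gap keep their jobs, so `τ` puts at least as much weight on them as `σ`.
By `h1` and `h2`, however, each is loaded under `σ` at least as much as under `τ`, and the blocked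
one more. -/
theorem Inv.not_blocked_of_ungrouped {ω : ℕ} {σ h τ : ℕ → ℕ} (hI : P.Inv ω σ h)
    (hg : ∀ v < P.M, ¬ P.grp v < P.M) (hτ : P.Valid τ)
    (h1 : ∀ v < P.M, P.thr < P.A σ v + ω → P.A τ v ≤ P.A σ v)
    (h2 : ∀ v < P.M, P.thr < P.A σ v → P.A τ v < P.A σ v) : ¬ P.Blocked σ h := by
  intro hb
  obtain ⟨k, ⟨y, hy, hye, hyk⟩, hc⟩ := hI.exists_closed hb
  have h3 := sum_jobLoad_le_of_closed (wt := P.wt) fun j hj _ => hc τ hτ j hj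
  have h4 : ∑ v ∈ (range P.M).filter (k < h ·), P.A τ v <
      ∑ v ∈ (range P.M).filter (k < h ·), P.A σ v := by
    refine sum_lt_sum (fun v hv => ?_) ⟨y, mem_filter.2 ⟨mem_range.2 hy, hyk⟩, ?_⟩
    · obtain ⟨hv1, hv2⟩ := mem_filter.1 hv
      have := hI.warm v (mem_range.1 hv1) (by omega)
      rw [if_neg (hg v (mem_range.1 hv1))] at this
      exact h1 v (mem_range.1 hv1) (by omega)
    · rcases hye with hye | hye
      · exact h2 y hy hye
      · exact absurd hye.1 (hg y hy)
  unfold A at h4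
  rw [sum_add_distrib, sum_add_distrib] at h4
  omega

/-- When no machine has to give a job away, a group has at most one hot machine. -/
theorem hot_unique {σ h : ℕ → ℕ} (he : ∀ v < P.M, ¬ P.Elig σ h v) {u v : ℕ} (hu : u < P.M)
    (hv : v < P.M) (hg : P.grp v < P.M) (huv : P.grp u = P.grp v) (hhu : P.Hot σ u)
    (hhv : P.Hot σ v) : u = v := by
  classical
  by_contra hne
  obtain ⟨y, hy, hmin⟩ := exists_min_image
    ((range P.M).filter fun x => P.grp x = P.grp v ∧ P.Hot σ x) h
    ⟨v, by simp [hv, hhv]⟩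
  simp only [mem_filter, mem_range] at hy hmin
  refine he y hy.1 (Or.inr ⟨by omega, hy.2.2, ?_, fun x hx hxg hxh =>
    hmin x ⟨hx, hxg.trans hy.2.1, hxh⟩⟩)
  by_cases hyu : u = y
  · exact ⟨v, hv, by rintro rfl; exact hne hyu, hy.2.1.symm, hhv⟩
  · exact ⟨u, hu, hyu, huv.trans hy.2.1.symm, hhu⟩

/-! ### Search problems that agree on the relevant indices -/

/-- Two search problems differ only in irrelevant data. -/
structure Equiv (P Q : Net) : Prop where
  M : P.M = Q.M
  N : P.N = Q.N
  X : P.X = Q.X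
  thr : P.thr = Q.thr
  D : ∀ v < Q.M, P.D v = Q.D v
  wt : ∀ j < Q.N, P.wt j = Q.wt j
  grp : ∀ v < Q.M, P.grp v = Q.grp v
  al : ∀ j < Q.N, ∀ v < Q.M, P.al j v ↔ Q.al j v

namespace Equiv

variable {Q : Net} (E : P.Equiv Q)
include E

theorem A {v : ℕ} (hv : v < Q.M) (σ : ℕ → ℕ) : P.A σ v = Q.A σ v := by
  unfold Net.A jobLoad
  rw [E.D v hv, E.N]
  refine congrArg _ (sum_congr rfl fun j hj => ?_)
  rw [E.wt j (mem_range.1 hj)]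

theorem hot {v : ℕ} (hv : v < Q.M) (σ : ℕ → ℕ) : P.Hot σ v ↔ Q.Hot σ v := by
  unfold Hot
  rw [E.A hv, E.X, E.thr]

theorem elig {v : ℕ} (hv : v < Q.M) (σ h : ℕ → ℕ) : P.Elig σ h v ↔ Q.Elig σ h v := by
  unfold Elig
  rw [E.A hv, E.thr, E.grp v hv, E.M, E.hot hv]
  refine or_congr Iff.rfl (and_congr Iff.rfl (and_congr Iff.rfl (and_congr ?_ ?_)))
  · refine exists_congr fun u => and_congr_right fun hu => ?_
    rw [E.grp u hu, E.hot hu]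
  · refine forall_congr' fun u => forall_congr' fun hu => ?_
    rw [E.grp u hu, E.hot hu]

theorem blocked {σ h : ℕ → ℕ} : P.Blocked σ h ↔ Q.Blocked σ h := by
  unfold Blocked
  rw [E.M]
  exact exists_congr fun v => and_congr_right fun hv => by rw [E.elig hv]

theorem valid {σ : ℕ → ℕ} : P.Valid σ ↔ Q.Valid σ := by
  unfold Valid
  rw [E.M, E.N]
  exact forall_congr' fun j => forall_congr' fun hj => and_congr_right fun hv => E.al j hj _ hv

theorem inv {ω : ℕ} {σ h : ℕ → ℕ} (hI : P.Inv ω σ h) : Q.Inv ω σ h := by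
  refine ⟨E.valid.1 hI.valid, fun v hv => E.M ▸ hI.le v (E.M ▸ hv), fun j hj v hv ha => ?_,
    fun v hv h0 => ?_, fun k v hv hg hk => ?_⟩
  · exact hI.lip j (E.N ▸ hj) v (E.M ▸ hv) ((E.al j hj v hv).2 ha)
  · have := hI.warm v (E.M ▸ hv) h0
    rwa [E.A hv, E.thr, E.grp v hv, E.M, E.X] at this
  · obtain ⟨y, hy, hyg, hyk, hy'⟩ := hI.pair k v (E.M ▸ hv) (by rw [E.grp v hv, E.M]; exact hg) hk
    rw [E.M] at hy
    rw [E.grp v hv, E.grp y hy] at hyg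
    rw [E.A hy, E.thr, E.X] at hy'
    refine ⟨y, hy, hyg, hyk, hy'.imp id ?_⟩
    rintro ⟨h1, z, hz, hzy, hzg, hzk, h2⟩
    rw [E.M] at hz
    rw [E.grp v hv, E.grp z hz] at hzg
    rw [E.A hz] at h2
    exact ⟨h1, z, hz, hzy, hzg, hzk, h2⟩

end Equiv

end Net

/-! ## Two job sizes -/

/-- A balancing instance on natural numbers: job `j` is heavy if `hb j = 1`. -/
structure TwoSize where
  M : ℕ
  N : ℕ
  w : ℕ
  W : ℕ
  dl : ℕ → ℕ
  hb : ℕ → ℕ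
  al : ℕ → ℕ → Prop
  w_pos : 0 < w
  w_lt : w < W
  hb_le : ∀ j < N, hb j ≤ 1
  two : ∀ j < N, 0 < hb j → ∀ a b c, a < M → b < M → c < M →
    al j a → al j b → al j c → a = b ∨ a = c ∨ b = c

namespace TwoSize

variable (I : TwoSize)

/-- The weight of a job. -/
def jw (j : ℕ) : ℕ := if 0 < I.hb j then I.W else I.w

/-- The weight of a light job; heavy jobs are ignored. -/
def lw (j : ℕ) : ℕ := if 0 < I.hb j then 0 else I.w

/-- `σ` is an assignment. -/
def Valid (σ : ℕ → ℕ) : Prop := ∀ j < I.N, σ j < I.M ∧ I.al j (σ j)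

/-- `τ` is an assignment of makespan at most `T`. -/
def Sol (T : ℕ) (τ : ℕ → ℕ) : Prop :=
  I.Valid τ ∧ ∀ v < I.M, I.dl v + jobLoad I.N I.jw τ v ≤ T

/-- The number of heavy jobs on `v`. -/
def hc (σ : ℕ → ℕ) (v : ℕ) : ℕ := jobLoad I.N I.hb σ v

/-- The number of light jobs on `v`. -/
def lc (σ : ℕ → ℕ) (v : ℕ) : ℕ := jobLoad I.N (fun j => 1 - I.hb j) σ v

/-- The search for an assignment of the heavy jobs, at most one to each machine. -/
def heavyNet (T : ℕ) : Net where
  M := I.M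
  N := I.N
  X := I.W
  thr := 1
  -- A machine without room for `W` counts as already occupied.
  D := fun v => if T < I.dl v + I.W then 1 else 0
  wt := I.hb
  -- The group number `I.M` stands for no group.
  grp := fun _ => I.M
  al := I.al

/-- The search for an assignment of all jobs. -/
def jobNet (T : ℕ) : Net where
  M := I.M
  N := I.N
  X := I.W
  thr := T + T / 2
  D := I.dl
  wt := I.jw
  grp := fun _ => I.M
  al := I.al

/-- The search for an assignment of the light jobs. -/
def lightNet (T : ℕ) (D grp : ℕ → ℕ) : Net where
  M := I.M
  N := I.N
  X := I.W
  thr := T + T / 2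
  D := D
  wt := I.lw
  grp := grp
  al := I.al

variable {I}

theorem jobLoad_lw (σ : ℕ → ℕ) (v : ℕ) : jobLoad I.N I.lw σ v = I.w * I.lc σ v := by
  unfold lc jobLoad
  rw [mul_sum]
  refine sum_congr rfl fun j hj => ?_
  unfold lw
  rcases Nat.le_one_iff_eq_zero_or_eq_one.1 (I.hb_le j (mem_range.1 hj)) with h | h <;> simp [h]

theorem jobLoad_jw (σ : ℕ → ℕ) (v : ℕ) :
    jobLoad I.N I.jw σ v = I.W * I.hc σ v + I.w * I.lc σ v := by
  unfold lc hc jobLoad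
  rw [mul_sum, mul_sum, ← sum_add_distrib]
  refine sum_congr rfl fun j hj => ?_
  unfold jw
  rcases Nat.le_one_iff_eq_zero_or_eq_one.1 (I.hb_le j (mem_range.1 hj)) with h | h <;> simp [h]

theorem hc_pos {σ : ℕ → ℕ} {j : ℕ} (hj : j < I.N) (hh : 0 < I.hb j) : 0 < I.hc σ (σ j) := by
  refine sum_pos' (fun _ _ => Nat.zero_le _) ⟨j, mem_range.2 hj, ?_⟩
  simpa using hh

theorem eq_of_hc_le_one {σ : ℕ → ℕ} {i j : ℕ} (hi : i < I.N) (hj : j < I.N) (hhi : 0 < I.hb i)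
    (hhj : 0 < I.hb j) (h : σ i = σ j) (h1 : I.hc σ (σ j) ≤ 1) : i = j := by
  by_contra hne
  unfold hc jobLoad at h1
  have h2 := add_sum_erase (range I.N) (fun x => if σ x = σ j then I.hb x else 0) (mem_range.2 hj)
  have h3 : 0 < ∑ x ∈ (range I.N).erase j, if σ x = σ j then I.hb x else 0 := by
    refine sum_pos' (fun _ _ => Nat.zero_le _) ⟨i, mem_erase.2 ⟨hne, mem_range.2 hi⟩, ?_⟩
    rw [if_pos h]; exact hhi
  simp only [if_true] at h2
  omega

theorem hc_le_one {σ : ℕ → ℕ} {v : ℕ}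
    (h : ∀ i < I.N, ∀ j < I.N, 0 < I.hb i → 0 < I.hb j → σ i = v → σ j = v → i = j) :
    I.hc σ v ≤ 1 := by
  unfold hc jobLoad
  by_cases hex : ∃ j < I.N, 0 < I.hb j ∧ σ j = v
  · obtain ⟨j, hj, hhj, hv⟩ := hex
    rw [sum_eq_single j]
    · rw [if_pos hv]; exact I.hb_le j hj
    · intro i hi hne
      by_contra hcon
      by_cases hiv : σ i = v
      · rw [if_pos hiv] at hcon
        exact hne (h i (mem_range.1 hi) j hj (Nat.pos_of_ne_zero hcon) hhj hiv hv)
      · rw [if_neg hiv] at hcon; exact hcon rfl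
    · intro hj'; exact absurd (mem_range.2 hj) hj'
  · push Not at hex
    rw [sum_eq_zero]
    · omega
    · intro j hj
      by_cases hjv : σ j = v
      · rw [if_pos hjv]
        by_contra hcon
        exact hex j (mem_range.1 hj) (Nat.pos_of_ne_zero hcon) hjv
      · rw [if_neg hjv]

theorem hc_eq_zero {σ : ℕ → ℕ} {v : ℕ} (h : ∀ j < I.N, 0 < I.hb j → σ j ≠ v) : I.hc σ v = 0 := by
  unfold hc jobLoad
  refine sum_eq_zero fun j hj => ?_
  by_cases hjv : σ j = v
  · rw [if_pos hjv]
    by_contra hcon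
    exact h j (mem_range.1 hj) (Nat.pos_of_ne_zero hcon) hjv
  · rw [if_neg hjv]

theorem Sol.load {T : ℕ} {τ : ℕ → ℕ} (hτ : I.Sol T τ) {v : ℕ} (hv : v < I.M) :
    I.dl v + I.W * I.hc τ v + I.w * I.lc τ v ≤ T := by
  have := hτ.2 v hv
  rw [jobLoad_jw] at this
  omega

theorem Sol.hc_le {T : ℕ} {τ : ℕ → ℕ} (hτ : I.Sol T τ) (hT : T < I.W + I.W) {v : ℕ}
    (hv : v < I.M) : I.hc τ v ≤ 1 := by
  have := hτ.load hv
  by_contra hcon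
  have : I.W * 2 ≤ I.W * I.hc τ v := Nat.mul_le_mul_left _ (by omega)
  omega

theorem Sol.load_heavy {T : ℕ} {τ : ℕ → ℕ} (hτ : I.Sol T τ) {v : ℕ} (hv : v < I.M)
    (hh : 0 < I.hc τ v) : I.dl v + I.W + I.w * I.lc τ v ≤ T := by
  have := hτ.load hv
  have : I.W * 1 ≤ I.W * I.hc τ v := Nat.mul_le_mul_left _ hh
  omega

theorem Sol.load_light {T : ℕ} {τ : ℕ → ℕ} (hτ : I.Sol T τ) {v : ℕ} (hv : v < I.M) :
    I.dl v + I.w * I.lc τ v ≤ T := by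
  have := hτ.load hv
  omega

/-- If both sizes are at most `T / 2`, the search for an assignment of all jobs succeeds. -/
theorem Sol.jobNet_not_blocked {T : ℕ} {τ : ℕ → ℕ} (hτ : I.Sol T τ) (hT : ¬ T < I.W + I.W)
    {σ h : ℕ → ℕ} (hI : (I.jobNet T).Inv I.W σ h) : ¬ (I.jobNet T).Blocked σ h := by
  refine hI.not_blocked_of_ungrouped (fun v _ => lt_irrefl _) hτ.1 (fun v hv h1 => ?_)
    fun v hv h1 => ?_
  -- Since `2 W ≤ T`, a load above `T + T / 2 - W` exceeds `T`.
  all_goals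
    have h2 := hτ.2 v hv
    simp only [Net.A, jobNet] at *
    omega

/-- The heavy jobs can be assigned at most one to each machine. -/
theorem Sol.heavyNet_not_blocked {T : ℕ} {τ : ℕ → ℕ} (hτ : I.Sol T τ) (hT : T < I.W + I.W)
    {σ h : ℕ → ℕ} (hI : (I.heavyNet T).Inv 1 σ h) : ¬ (I.heavyNet T).Blocked σ h := by
  have key : ∀ v < I.M, (I.heavyNet T).A τ v ≤ 1 := by
    intro v hv
    change (if T < I.dl v + I.W then 1 else 0) + I.hc τ v ≤ 1
    have h1 := hτ.hc_le hT hv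
    split_ifs with h2
    · by_contra hcon
      have := hτ.load_heavy hv (by omega)
      omega
    · omega
  refine hI.not_blocked_of_ungrouped (fun v _ => lt_irrefl _) hτ.1 (fun v hv h1 => ?_)
    fun v hv h1 => ?_
  all_goals
    have h2 := key v hv
    have h3 : (I.heavyNet T).thr = 1 := rfl
    omega

/-! ### The forest of heavy jobs -/

variable (I)

/-- `v` receives no heavy job. -/
def Free (σ : ℕ → ℕ) (v : ℕ) : Prop := ∀ j < I.N, 0 < I.hb j → σ j ≠ v

/-- An assignment of the heavy jobs, at most one to each machine, together with a function `p` that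
sends a machine with a heavy job to the other machine allowed for this job. -/
structure Forest (T : ℕ) (σ p : ℕ → ℕ) : Prop where
  valid : I.Valid σ
  cap : ∀ v < I.M, (I.heavyNet T).A σ v ≤ 1
  p_lt : ∀ v < I.M, p v < I.M
  p_free : ∀ v < I.M, I.Free σ v → p v = v
  p_al : ∀ j < I.N, 0 < I.hb j → I.al j (p (σ j))
  p_cov : ∀ j < I.N, 0 < I.hb j → ∀ u < I.M, I.al j u → u = σ j ∨ u = p (σ j)

/-- The component of `v` has one machine without a heavy job, which could be any machine. -/
def Grouped (T : ℕ) (σ p : ℕ → ℕ) (v : ℕ) : Prop :=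
  I.Free σ (p^[I.M] v) ∧ ¬ T < I.dl (p^[I.M] v) + I.W

open Classical in
/-- The group of `v`. -/
noncomputable def grpOf (T : ℕ) (σ p : ℕ → ℕ) (v : ℕ) : ℕ :=
  if I.Grouped T σ p v then p^[I.M] v else I.M

open Classical in
/-- The load of `v` that is certain: the dedicated load, and `W` if `v` is sure to get a heavy
job. -/
noncomputable def baseOf (T : ℕ) (σ p : ℕ → ℕ) (v : ℕ) : ℕ :=
  if I.Grouped T σ p v ∨ I.Free σ v then I.dl v else I.dl v + I.W

variable {I}

/-- If `τ` moves the heavy jobs from `K` to `K'`, one to each machine, then `K'` is not smaller. -/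
theorem card_le_of_heavy {σ τ : ℕ → ℕ} (hτ : ∀ v < I.M, I.hc τ v ≤ 1) (hτv : I.Valid τ) {K K' : Finset ℕ}
    (hK : ∀ v ∈ K, ¬ I.Free σ v) (hKK : ∀ j < I.N, 0 < I.hb j → σ j ∈ K → τ j ∈ K') :
    K.card ≤ K'.card := by
  have hex : ∀ v, ∃ j, v ∈ K → j < I.N ∧ 0 < I.hb j ∧ σ j = v := by
    intro v
    by_cases hv : v ∈ K
    · have := hK v hv
      unfold Free at this
      push Not at this
      obtain ⟨j, h1, h2, h3⟩ := this
      exact ⟨j, fun _ => ⟨h1, h2, h3⟩⟩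
    · exact ⟨0, fun h => absurd h hv⟩
  choose J hJ using hex
  -- `J v` is a heavy job that `σ` puts on `v`. Distinct machines have distinct jobs, and `τ` sends
  -- these to distinct machines.
  refine card_le_card_of_injOn (fun v => τ (J v)) (fun v hv => ?_) fun u hu v hv huv => ?_
  · obtain ⟨h1, h2, h3⟩ := hJ v hv
    exact hKK _ h1 h2 (h3.symm ▸ hv)
  · obtain ⟨h1, h2, h3⟩ := hJ v hv
    obtain ⟨h4, h5, h6⟩ := hJ u hu
    have := eq_of_hc_le_one h4 h1 h5 h2 huv (hτ _ (hτv _ h1).1)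
    rw [← h3, ← h6, this]

namespace Forest

variable {T : ℕ} {σ p : ℕ → ℕ} (F : I.Forest T σ p)
include F

/-- A machine without room for `W` has base load `1` in `heavyNet`, so `cap` keeps heavy jobs away
from it. -/
theorem load_le {j : ℕ} (hj : j < I.N) (hh : 0 < I.hb j) : I.dl (σ j) + I.W ≤ T := by
  have h1 := F.cap _ (F.valid j hj).1
  change (if T < I.dl (σ j) + I.W then 1 else 0) + I.hc σ (σ j) ≤ 1 at h1
  have h2 := hc_pos (σ := σ) hj hh
  split_ifs at h1 <;> omega

theorem hc_le {v : ℕ} (hv : v < I.M) : I.hc σ v ≤ 1 := by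
  have h1 := F.cap _ hv
  change (if T < I.dl v + I.W then 1 else 0) + I.hc σ v ≤ 1 at h1
  omega

theorem inj {i j : ℕ} (hi : i < I.N) (hj : j < I.N) (hhi : 0 < I.hb i)
    (hhj : 0 < I.hb j) (h : σ i = σ j) : i = j :=
  eq_of_hc_le_one hi hj hhi hhj h (F.hc_le (F.valid j hj).1)

theorem iterate_lt {v : ℕ} (hv : v < I.M) (i : ℕ) : p^[i] v < I.M := by
  induction i with
  | zero => exact hv
  | succ i ih => rw [Function.iterate_succ_apply']; exact F.p_lt _ ih

theorem iterate_free {v : ℕ} (hv : v < I.M) {i k : ℕ} (hik : i ≤ k) (hf : I.Free σ (p^[i] v)) :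
    p^[k] v = p^[i] v := by
  obtain ⟨d, rfl⟩ := Nat.exists_eq_add_of_le hik
  induction d with
  | zero => rfl
  | succ d ih =>
    rw [← add_assoc, Function.iterate_succ_apply', ih (Nat.le_add_right _ _)]
    exact F.p_free _ (F.iterate_lt hv i) hf

/-- Two of the points reached after `0, …, M` steps agree, so the point after `M + 1` steps is
already reached within `M` steps; being free, it is not left again. -/
theorem free_root_of_succ {v : ℕ} (hv : v < I.M) (hf : I.Free σ (p^[I.M + 1] v)) :
    I.Free σ (p^[I.M] v) := by
  obtain ⟨i, hi, j, hj, hne, heq⟩ := exists_ne_map_eq_of_card_lt_of_maps_to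
    (s := range (I.M + 1)) (t := range I.M) (f := fun i => p^[i] v) (by simp)
    (fun i _ => by simpa using F.iterate_lt hv i)
  simp only [mem_range] at hi hj
  wlog hij : i < j generalizing i j
  · exact this j i hne.symm heq.symm hj hi (by omega)
  have h1 : p^[I.M + 1] v = p^[I.M + 1 - j + i] v := by
    have : I.M + 1 = (I.M + 1 - j) + j := by omega
    conv_lhs => rw [this, Function.iterate_add_apply]
    rw [← heq, ← Function.iterate_add_apply]
  rw [h1] at hf
  rwa [F.iterate_free hv (by omega : I.M + 1 - j + i ≤ I.M) hf]

theorem root_p {v : ℕ} (hv : v < I.M) (hf : I.Free σ (p^[I.M] v)) :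
    p^[I.M] (p v) = p^[I.M] v := by
  rw [← Function.iterate_succ_apply]
  exact F.iterate_free hv (Nat.le_succ _) hf

/-- Groups are closed under parents and children, so a heavy job has both its machines inside or
both outside. -/
theorem grouped_p {v : ℕ} (hv : v < I.M) : I.Grouped T σ p (p v) ↔ I.Grouped T σ p v := by
  constructor
  · intro h
    have h1 : I.Free σ (p^[I.M] v) := by
      have := h.1
      rw [← Function.iterate_succ_apply] at this
      exact F.free_root_of_succ hv this
    unfold Grouped at *
    rwa [F.root_p hv h1] at h
  · intro h
    unfold Grouped at *
    rwa [F.root_p hv h.1]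

/-- A free machine is its own root, which has room in a group; any other machine carries a heavy job
under `σ`. In particular `W ≤ T` as soon as a group exists. -/
theorem load_le_of_grouped {v : ℕ} (hv : v < I.M) (hg : I.Grouped T σ p v) :
    I.dl v + I.W ≤ T := by
  by_cases hf : I.Free σ v
  · have h1 := F.iterate_free hv (Nat.zero_le I.M) hf
    have h2 := hg.2
    rw [h1] at h2
    simpa using h2
  · unfold Free at hf
    push Not at hf
    obtain ⟨j, hj, hh, rfl⟩ := hf
    exact F.load_le hj hh

theorem grpOf_lt_iff {v : ℕ} (hv : v < I.M) : I.grpOf T σ p v < I.M ↔ I.Grouped T σ p v := by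
  unfold grpOf
  split_ifs with h
  · exact ⟨fun _ => h, fun _ => F.iterate_lt hv _⟩
  · simp [h]

theorem al_mem {τ : ℕ → ℕ} (hτ : I.Valid τ) {j : ℕ} (hj : j < I.N) (hh : 0 < I.hb j) :
    τ j = σ j ∨ τ j = p (σ j) := F.p_cov j hj hh _ (hτ j hj).1 (hτ j hj).2

/-- Outside the groups every machine that has a heavy job has one in each solution. -/
theorem hc_pos_of_not_grouped (hT : T < I.W + I.W) {τ : ℕ → ℕ} (hτ : I.Sol T τ) {v : ℕ}
    (hv : v < I.M) (hg : ¬ I.Grouped T σ p v) (hf : ¬ I.Free σ v) : 0 < I.hc τ v := by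
  classical
  by_contra hcon
  -- Under `τ` the heavy jobs of `K` stay in `K`: they do not enter a group, and a free machine
  -- outside the groups has no room for `W`. If `v` received none, too few machines would be left
  -- for them.
  set K := (range I.M).filter fun x => ¬ I.Grouped T σ p x ∧ ¬ I.Free σ x with hKdef
  have hvK : v ∈ K := by simp [hKdef, hv, hg, hf]
  have := card_le_of_heavy (fun v hv => hτ.hc_le hT hv) hτ.1 (K := K) (K' := K.erase v)
    (fun x hx => (mem_filter.1 hx).2.2) fun j hj hh hjK => ?_
  · rw [card_erase_of_mem hvK] at this
    have := card_pos.2 ⟨v, hvK⟩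
    omega
  · have h1 := hc_pos (σ := τ) hj hh
    have h2 := (hτ.1 j hj).1
    have h3 : ¬ I.Grouped T σ p (τ j) := by
      obtain ⟨h4, h5, h6⟩ := mem_filter.1 hjK
      rcases F.al_mem hτ.1 hj hh with h7 | h7
      · rwa [h7]
      · rwa [h7, F.grouped_p (mem_range.1 h4)]
    refine mem_erase.2 ⟨?_, mem_filter.2 ⟨mem_range.2 h2, h3, fun h4 => ?_⟩⟩
    · intro h4
      rw [h4] at h1
      exact hcon h1
    · have h5 := F.iterate_free h2 (Nat.zero_le I.M) h4
      refine h3 ⟨by rw [h5]; exact h4, ?_⟩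
      have h6 := hτ.load_heavy h2 h1
      rw [h5, Function.iterate_zero, id]
      omega

/-- At most one machine of a group has no heavy job in a solution. -/
theorem eq_of_hc_eq_zero (hT : T < I.W + I.W) {τ : ℕ → ℕ} (hτ : I.Sol T τ) {u v : ℕ}
    (hu : u < I.M) (hv : v < I.M) (hg : I.Grouped T σ p v) (huv : p^[I.M] u = p^[I.M] v)
    (hu0 : I.hc τ u = 0) (hv0 : I.hc τ v = 0) : u = v := by
  classical
  by_contra hne
  set r := p^[I.M] v with hr
  -- Under `σ` every machine of the component `C` except the root has a heavy job, and `τ` keeps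
  -- these jobs in `C`, on distinct machines. Two machines without a heavy job would be one too
  -- many.
  set C := (range I.M).filter fun x => p^[I.M] x = r with hC
  have hrM : r < I.M := F.iterate_lt hv _
  have hrC : r ∈ C := mem_filter.2 ⟨mem_range.2 hrM, by
    simpa using F.iterate_free hrM (Nat.zero_le I.M) hg.1⟩
  have huC : u ∈ C := mem_filter.2 ⟨mem_range.2 hu, huv⟩
  have hvC : v ∈ C.erase u := mem_erase.2 ⟨Ne.symm hne, mem_filter.2 ⟨mem_range.2 hv, rfl⟩⟩
  have := card_le_of_heavy (σ := σ) (fun v hv => hτ.hc_le hT hv) hτ.1 (K := C.erase r) (K' := (C.erase u).erase v)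
    (fun x hx hf => ?_) fun j hj hh hjK => ?_
  · rw [card_erase_of_mem hvC, card_erase_of_mem huC, card_erase_of_mem hrC] at this
    have := card_pos.2 ⟨v, hvC⟩
    rw [card_erase_of_mem huC] at this
    omega
  · obtain ⟨h1, h2⟩ := mem_erase.1 hx
    obtain ⟨h3, h4⟩ := mem_filter.1 h2
    rw [F.iterate_free (mem_range.1 h3) (Nat.zero_le I.M) hf] at h4
    exact h1 h4
  · have h1 := hc_pos (σ := τ) hj hh
    refine mem_erase.2 ⟨fun h => by rw [h] at h1; omega, mem_erase.2 ⟨fun h => by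
      rw [h] at h1; omega, mem_filter.2 ⟨mem_range.2 (hτ.1 j hj).1, ?_⟩⟩⟩
    obtain ⟨h4, h5⟩ := mem_filter.1 (mem_erase.1 hjK).2
    rcases F.al_mem hτ.1 hj hh with h7 | h7
    · rwa [h7]
    · rw [h7, F.root_p (mem_range.1 h4) (by rw [h5]; exact hg.1), h5]

end Forest

end TwoSize

/-! ### Why the search for the light jobs succeeds -/

namespace TwoSize

/-- The light jobs on a set `S` of machines of one group, compared with a solution in which the
machines `v` with `has v` carry a heavy job. The slack `e` is `0` or `1`. -/
theorem group_sum {w W T e : ℤ} (hw : 0 < w) (hwT : w ≤ T) (hWT : W ≤ T) (hW : 0 < W)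
    (he0 : 0 ≤ e) {dl l ls : ℕ → ℤ}
    {has : ℕ → Prop} {S : Finset ℕ} (hS : ∀ u ∈ S, ∀ v ∈ S, ¬ has u → ¬ has v → u = v)
    (hlight : ∀ v ∈ S, dl v + w * ls v ≤ T) (hheavy : ∀ v ∈ S, has v → dl v + W + w * ls v ≤ T)
    (hwarm : ∀ v ∈ S, 3 * T < 2 * (dl v + W + w * (l v + 1)))
    (hpair : ∃ y ∈ S, 3 * T < 2 * (dl y + w * (l y + e)) ∨ (3 * T < 2 * (dl y + W + w * l y) ∧
      ∃ z ∈ S, z ≠ y ∧ 3 * T < 2 * (dl z + W + w * (l z + e)))) :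
    1 - e ≤ ∑ v ∈ S, (l v - ls v) := by
  classical
  -- A machine with a heavy job in the solution never falls short: `w * ls v` is at most `T - dl v -
  -- W`, while `w * (l v + 1)` exceeds `3 T / 2 - dl v - W`.
  have hnn : ∀ v ∈ S, has v → 0 ≤ l v - ls v := by
    intro v hv hh
    have h1 := hheavy v hv hh
    have h2 := hwarm v hv
    by_contra hcon
    have : w * (l v - ls v + 1) ≤ 0 := mul_nonpos_of_nonneg_of_nonpos hw.le (by omega)
    nlinarith
  have hpos : ∀ a : ℤ, 0 < w * a → 1 ≤ a := by
    intro a ha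
    have := (mul_pos_iff_of_pos_left hw).1 ha
    omega
  -- Hence the sum may be cut down to any part of `S` that contains the machines without a heavy
  -- job.
  have hred : ∀ Q ⊆ S, (∀ v ∈ S, ¬ has v → v ∈ Q) → 1 - e ≤ ∑ v ∈ Q, (l v - ls v) →
      1 - e ≤ ∑ v ∈ S, (l v - ls v) := by
    intro Q hQ hQ' h
    refine h.trans (sum_le_sum_of_subset_of_nonneg hQ fun v hv hvQ => hnn v hv ?_)
    by_contra hcon
    exact hvQ (hQ' v hv hcon)
  obtain ⟨y, hy, hy'⟩ := hpair
  -- There is at most one machine `x` that can fall short; the cases are according to whether it is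
  -- one of the witnesses `y`, `z`.
  by_cases hroot : ∃ x ∈ S, ¬ has x
  · obtain ⟨x, hx, hxh⟩ := hroot
    have hx1 := hlight x hx
    have hx2 := hwarm x hx
    by_cases hyx : y = x
    · subst hyx
      rcases hy' with hy' | ⟨hy', z, hz, hzy, hz'⟩
      · refine hred {y} (by simpa using hy) (fun v hv hvh => by simp [hS v hv y hy hvh hxh]) ?_
        rw [sum_singleton]
        have := hpos (l y - ls y + e) (by nlinarith)
        omega
      · have hzh : has z := by
          by_contra h
          exact hzy (hS z hz y hy h hxh)
        refine hred {y, z} (by simp [insert_subset_iff, hy, hz])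
          (fun v hv hvh => by simp [hS v hv y hy hvh hxh]) ?_
        rw [sum_pair hzy.symm]
        have h3 := hheavy z hz hzh
        have := hpos (l y - ls y + (l z - ls z) + e) (by nlinarith)
        omega
    · have hyh : has y := by
        by_contra h
        exact hyx (hS y hy x hx h hxh)
      have h3 := hheavy y hy hyh
      rcases hy' with hy' | ⟨hy', z, hz, hzy, hz'⟩
      · refine hred {x, y} (by simp [insert_subset_iff, hx, hy])
          (fun v hv hvh => by simp [hS v hv x hx hvh hxh]) ?_
        rw [sum_pair (Ne.symm hyx)]
        have := hpos (l x - ls x + (l y - ls y) + e) (by nlinarith)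
        omega
      · by_cases hzx : z = x
        · subst hzx
          refine hred {y, z} (by simp [insert_subset_iff, hz, hy])
            (fun v hv hvh => by simp [hS v hv z hz hvh hxh]) ?_
          rw [sum_pair hzy.symm]
          have := hpos (l y - ls y + (l z - ls z) + e) (by nlinarith)
          omega
        · have hzh : has z := by
            by_contra h
            exact hzx (hS z hz x hx h hxh)
          have h4 := hheavy z hz hzh
          refine hred {x, y, z} (by simp [insert_subset_iff, hx, hy, hz])
            (fun v hv hvh => by simp [hS v hv x hx hvh hxh]) ?_
          rw [sum_insert (by simp [Ne.symm hyx, Ne.symm hzx]), sum_pair hzy.symm]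
          have ha : T < 2 * (w * (l y - ls y)) := by nlinarith
          have hb : T < 2 * (w * (l z - ls z + e)) := by nlinarith
          have hc : T < 2 * (w * (l x - ls x + 1)) + 2 * W := by nlinarith
          have ha1 := hpos (l y - ls y) (by linarith)
          have hb1 := hpos (l z - ls z + e) (by linarith)
          generalize l y - ls y = a at *
          generalize hbe : l z - ls z + e = b at *
          -- If the sum is not positive, adding `ha`, `hb`, `hc` and using `W ≤ T` gives `w > T /
          -- 2`. But `a` and `b` are at least `1`, so `x` is short by at least two jobs, and `hc`
          -- then yields `W > T / 2 + w > T`.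
          by_contra hcon
          have hsum : a + b + (l x - ls x) ≤ 0 := by omega
          have h5 : w * (a + b + (l x - ls x) + 1) ≤ w * 1 :=
            mul_le_mul_of_nonneg_left (by omega) hw.le
          have h6 : w * (l x - ls x + 1) ≤ w * (-1) :=
            mul_le_mul_of_nonneg_left (by omega) hw.le
          nlinarith
  · push Not at hroot
    refine hred {y} (by simpa using hy) (fun v hv hvh => absurd (hroot v hv) hvh) ?_
    rw [sum_singleton]
    have h3 := hheavy y hy (hroot y hy)
    rcases hy' with hy' | ⟨hy', -⟩
    · have := hpos (l y - ls y + e) (by nlinarith)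
      omega
    · have := hpos (l y - ls y) (by nlinarith)
      omega

variable {I : TwoSize} {T : ℕ} {σ p : ℕ → ℕ}

theorem lightNet_A (D grp ρ : ℕ → ℕ) (v : ℕ) :
    (I.lightNet T D grp).A ρ v = D v + I.w * I.lc ρ v := by
  rw [← jobLoad_lw]; rfl

/-- Rounding is harmless: an integer above the rounded threshold is above `3 T / 2` itself. -/
theorem three_mul_lt {T a : ℕ} (h : T + T / 2 < a) : (3 * T : ℤ) < 2 * a := by
  omega

namespace Forest

theorem baseOf_eq (F : I.Forest T σ p) {v : ℕ} (hv : v < I.M)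
    (hg : I.grpOf T σ p v < I.M) : I.baseOf T σ p v = I.dl v :=
  if_pos (Or.inl ((F.grpOf_lt_iff hv).1 hg))

theorem grpOf_eq {v : ℕ} (hg : I.grpOf T σ p v < I.M) : I.grpOf T σ p v = p^[I.M] v := by
  unfold grpOf at *
  split_ifs at * with h
  · rfl
  · omega

theorem grpOf_eq_of_not_lt (F : I.Forest T σ p) {v : ℕ} (hv : v < I.M)
    (hg : ¬ I.grpOf T σ p v < I.M) : I.grpOf T σ p v = I.M := by
  rw [F.grpOf_lt_iff hv] at hg
  exact if_neg hg

/-- Outside the groups, `W` enters the base load only where `hc_pos_of_not_grouped` forces a heavy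
job in the solution. -/
theorem baseOf_add_le (F : I.Forest T σ p) (hT : T < I.W + I.W) {τ : ℕ → ℕ} (hτ : I.Sol T τ)
    {v : ℕ} (hv : v < I.M) (hg : ¬ I.grpOf T σ p v < I.M) :
    I.baseOf T σ p v + I.w * I.lc τ v ≤ T := by
  rw [F.grpOf_lt_iff hv] at hg
  unfold baseOf
  split_ifs with h
  · exact hτ.load_light hv
  · exact hτ.load_heavy hv (F.hc_pos_of_not_grouped hT hτ hv hg fun hf => h (Or.inr hf))

/-- The sum over the machines of a group above the gap. -/
theorem sum_group_le (F : I.Forest T σ p) (hT : T < I.W + I.W) {τ : ℕ → ℕ} (hτ : I.Sol T τ)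
    {ρ h : ℕ → ℕ} (hI : (I.lightNet T (I.baseOf T σ p) (I.grpOf T σ p)).Inv I.w ρ h) {k v e : ℕ}
    (hv : v < I.M) (hg : I.grpOf T σ p v < I.M)
    (hpair : ∃ y < I.M, I.grpOf T σ p y = I.grpOf T σ p v ∧ k < h y ∧
      (T + T / 2 < I.dl y + I.w * I.lc ρ y + I.w * e ∨
        (T + T / 2 < I.dl y + I.w * I.lc ρ y + I.W ∧
        ∃ z < I.M, z ≠ y ∧ I.grpOf T σ p z = I.grpOf T σ p v ∧ k < h z ∧
          T + T / 2 < I.dl z + I.w * I.lc ρ z + I.W + I.w * e))) :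
    (1 - e : ℤ) ≤ ∑ u ∈ ((range I.M).filter (k < h ·)).filter
      (fun u => I.grpOf T σ p u = I.grpOf T σ p v), ((I.lc ρ u : ℤ) - I.lc τ u) := by
  have hgv := (F.grpOf_lt_iff hv).1 hg
  have hWT := F.load_le_of_grouped hv hgv
  have hw := I.w_pos
  have hwW := I.w_lt
  refine group_sum (w := I.w) (W := I.W) (T := T) (dl := fun v => I.dl v)
    (has := fun u => 0 < I.hc τ u) (by omega) (by omega) (by omega) (by omega) (by omega)
    ?_ ?_ ?_ ?_ ?_
  · intro a ha b hb ha0 hb0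
    simp only [mem_filter, mem_range] at ha hb
    have h1 := grpOf_eq (I := I) (T := T) (σ := σ) (p := p) (v := a) (by omega)
    have h2 := grpOf_eq (I := I) (T := T) (σ := σ) (p := p) (v := b) (by omega)
    exact F.eq_of_hc_eq_zero hT hτ ha.1.1 hb.1.1 ((F.grpOf_lt_iff hb.1.1).1 (by omega))
      (by omega) (by omega) (by omega)
  · intro u hu
    simp only [mem_filter, mem_range] at hu
    exact_mod_cast hτ.load_light hu.1.1
  · intro u hu hh
    simp only [mem_filter, mem_range] at hu
    exact_mod_cast hτ.load_heavy hu.1.1 hh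
  · intro u hu
    simp only [mem_filter, mem_range] at hu
    have h1 := hI.warm u hu.1.1 (by omega)
    have h2 : I.grpOf T σ p u < I.M := by omega
    rw [lightNet_A, F.baseOf_eq hu.1.1 h2] at h1
    have h3 : (I.lightNet T (I.baseOf T σ p) (I.grpOf T σ p)).grp u <
      (I.lightNet T (I.baseOf T σ p) (I.grpOf T σ p)).M := h2
    rw [if_pos h3] at h1
    have := three_mul_lt h1
    push_cast [lightNet] at this
    linarith
  · obtain ⟨y, hy, hyg, hyk, hy'⟩ := hpair
    refine ⟨y, by simp [hy, hyg, hyk], ?_⟩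
    rcases hy' with h1 | ⟨h1, z, hz, hzy, hzg, hzk, h2⟩
    · left
      have := three_mul_lt h1
      push_cast at this
      linarith
    · right
      have h3 := three_mul_lt h1
      have h4 := three_mul_lt h2
      push_cast at h3 h4
      exact ⟨by linarith, z, by simp [hz, hzg, hzk], hzy, by linarith⟩

/-- If there is a solution, then the search for an assignment of the light jobs succeeds. -/
theorem lightNet_not_blocked (F : I.Forest T σ p) (hT : T < I.W + I.W) {τ : ℕ → ℕ}
    (hτ : I.Sol T τ) {ρ h : ℕ → ℕ}
    (hI : (I.lightNet T (I.baseOf T σ p) (I.grpOf T σ p)).Inv I.w ρ h) :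
    ¬ (I.lightNet T (I.baseOf T σ p) (I.grpOf T σ p)).Blocked ρ h := by
  intro hb
  have hw := I.w_pos
  obtain ⟨k, ⟨y, hy, hye, hyk⟩, hc⟩ := hI.exists_closed hb
  have hcl := sum_jobLoad_le_of_closed (wt := fun j => 1 - I.hb j) fun j hj _ => hc τ hτ.1 j hj
  change ∑ v ∈ (range I.M).filter (k < h ·), I.lc ρ v ≤
    ∑ v ∈ (range I.M).filter (k < h ·), I.lc τ v at hcl
  have hcl' : ∑ v ∈ (range I.M).filter (k < h ·), ((I.lc ρ v : ℤ) - I.lc τ v) ≤ 0 := by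
    rw [sum_sub_distrib]
    have : ((∑ v ∈ (range I.M).filter (k < h ·), I.lc ρ v : ℕ) : ℤ) ≤
      (∑ v ∈ (range I.M).filter (k < h ·), I.lc τ v : ℕ) := by exact_mod_cast hcl
    push_cast at this
    linarith
  -- The sum is split by group number; the ungrouped machines form the fibre over `I.M`.
  have hmap : ∀ v ∈ (range I.M).filter (k < h ·), I.grpOf T σ p v ∈ range (I.M + 1) := by
    intro v hv
    have hvM := mem_range.1 (mem_filter.1 hv).1
    by_cases hg : I.grpOf T σ p v < I.M
    · exact mem_range.2 (by omega)
    · rw [F.grpOf_eq_of_not_lt hvM hg]; simp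
  rw [← sum_fiberwise_of_maps_to hmap] at hcl'
  refine absurd hcl' (not_le.2 ?_)
  have hung : ∀ v ∈ (range I.M).filter (k < h ·), ¬ I.grpOf T σ p v < I.M →
      (0 : ℤ) ≤ I.lc ρ v - I.lc τ v := by
    intro v hv hg
    obtain ⟨h1, h2⟩ := mem_filter.1 hv
    have h3 := hI.warm v (mem_range.1 h1) (by omega)
    rw [lightNet_A, if_neg (show ¬ (I.lightNet T (I.baseOf T σ p) (I.grpOf T σ p)).grp v <
      (I.lightNet T (I.baseOf T σ p) (I.grpOf T σ p)).M from hg)] at h3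
    have h4 := F.baseOf_add_le hT hτ (mem_range.1 h1) hg
    by_contra hcon
    have h5 : I.w * (I.lc ρ v + 1) ≤ I.w * I.lc τ v := Nat.mul_le_mul_left _ (by omega)
    simp only [lightNet] at h3
    rw [mul_add, mul_one] at h5
    omega
  -- Each fibre contributes at least `0`; for groups this is the case `e = 1`, with the slack of the
  -- invariant. The fibre of the blocked machine contributes at least `1`: being eligible, it
  -- satisfies the bounds without slack, which for a group is the case `e = 0`.
  refine sum_pos' (fun g hg => ?_) ?_
  · by_cases hex : ∃ v ∈ (range I.M).filter (k < h ·), I.grpOf T σ p v = g ∧ g < I.M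
    · obtain ⟨v, hv, rfl, hgM⟩ := hex
      obtain ⟨h1, h2⟩ := mem_filter.1 hv
      obtain ⟨y, hy, hyg, hyk, hy'⟩ := hI.pair k v (mem_range.1 h1) hgM h2
      have hyg' : I.grpOf T σ p y = I.grpOf T σ p v := hyg
      have := F.sum_group_le hT hτ hI (k := k) (e := 1) (mem_range.1 h1) hgM
        ⟨y, hy, hyg, hyk, ?_⟩
      · simpa using this
      · rw [lightNet_A, F.baseOf_eq hy (by omega)] at hy'
        rcases hy' with h3 | ⟨h3, z, hz, hzy, hzg, hzk, h4⟩
        · left; rw [mul_one]; exact h3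
        · right
          have hzg' : I.grpOf T σ p z = I.grpOf T σ p v := hzg
          rw [lightNet_A, F.baseOf_eq hz (by omega)] at h4
          exact ⟨h3, z, hz, hzy, hzg, hzk, by rw [mul_one]; exact h4⟩
    · push Not at hex
      refine sum_nonneg fun v hv => ?_
      obtain ⟨h1, h2⟩ := mem_filter.1 hv
      have h3 := hex v h1 h2
      exact hung v h1 (by omega)
  · have hyR : y ∈ (range I.M).filter (k < h ·) := mem_filter.2 ⟨mem_range.2 hy, hyk⟩
    refine ⟨I.grpOf T σ p y, hmap y hyR, ?_⟩
    by_cases hg : I.grpOf T σ p y < I.M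
    · have := F.sum_group_le hT hτ hI (k := k) (e := 0) hy hg ?_
      · refine lt_of_lt_of_le ?_ this; norm_num
      · rcases hye with h1 | ⟨-, h1, ⟨u, hu, huy, hug, h2⟩, h3⟩
        · rw [lightNet_A, F.baseOf_eq hy hg] at h1
          exact ⟨y, hy, rfl, hyk, Or.inl h1⟩
        · have h4 := h3 u hu hug h2
          have hug' : I.grpOf T σ p u = I.grpOf T σ p y := hug
          unfold Net.Hot at h1 h2
          rw [lightNet_A, F.baseOf_eq hy hg] at h1
          rw [lightNet_A, F.baseOf_eq hu (by omega)] at h2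
          exact ⟨y, hy, rfl, hyk, Or.inr ⟨h1, u, hu, huy, hug, by omega, h2⟩⟩
    · refine sum_pos' (fun v hv => ?_) ⟨y, mem_filter.2 ⟨hyR, rfl⟩, ?_⟩
      · obtain ⟨h1, h2⟩ := mem_filter.1 hv
        exact hung v h1 (by rwa [h2])
      · rcases hye with h1 | h1
        · rw [lightNet_A] at h1
          have h4 := F.baseOf_add_le hT hτ hy hg
          by_contra hcon
          have h5 : I.w * I.lc ρ y ≤ I.w * I.lc τ y := Nat.mul_le_mul_left _ (by omega)
          simp only [lightNet] at h1
          omega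
        · exact absurd h1.1 hg

/-! ### Shifting heavy jobs away from hot machines -/

/-- The machines reached from hot machines of groups. -/
def _root_.TwoSize.Marked (I : TwoSize) (T : ℕ) (σ p ρ : ℕ → ℕ) (u : ℕ) : Prop :=
  ∃ v < I.M, I.grpOf T σ p v < I.M ∧
    (I.lightNet T (I.baseOf T σ p) (I.grpOf T σ p)).Hot ρ v ∧ ∃ i < I.M, p^[i] v = u

/-- In a group every path ends in the free root, so there are no proper cycles: repeating the period
`j - i` shows that a value that recurs is the root. -/
theorem iterate_fixed_of_repeat (F : I.Forest T σ p) {v : ℕ} (hv : v < I.M)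
    (hg : I.grpOf T σ p v < I.M) {i j : ℕ} (hij : i < j) (heq : p^[i] v = p^[j] v) :
    p^[i + 1] v = p^[i] v := by
  have hgv := (F.grpOf_lt_iff hv).1 hg
  have hper : ∀ n, p^[i + n * (j - i)] v = p^[i] v := by
    intro n
    induction n with
    | zero => simp
    | succ n ih =>
      have : i + (n + 1) * (j - i) = (j - i) + (i + n * (j - i)) := by ring
      rw [this, Function.iterate_add_apply, ih, ← Function.iterate_add_apply,
        Nat.sub_add_cancel hij.le, heq]
  have h1 := F.iterate_free hv (k := i + I.M * (j - i))
    (le_trans (Nat.le_mul_of_pos_right _ (by omega)) (Nat.le_add_left _ _)) hgv.1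
  rw [hper] at h1
  rw [Function.iterate_succ_apply', h1]
  exact F.p_free _ (F.iterate_lt hv _) hgv.1

open Classical in
/-- After the light jobs have been assigned, moving heavy jobs from marked machines yields an
assignment with loads at most `3 T / 2`. -/
theorem flip (F : I.Forest T σ p) {ρ h : ℕ → ℕ}
    (hρ : I.Valid ρ)
    (he : ∀ v < I.M, ¬ (I.lightNet T (I.baseOf T σ p) (I.grpOf T σ p)).Elig ρ h v)
    {φ : ℕ → ℕ} (hφ : ∀ j < I.N, φ j = if 0 < I.hb j then
      if I.Marked T σ p ρ (σ j) then p (σ j) else σ j else ρ j) : I.Sol (T + T / 2) φ := by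
  refine ⟨fun j hj => ?_, fun v hv => ?_⟩
  · rw [hφ j hj]
    split_ifs with h1 h2
    · exact ⟨F.p_lt _ (F.valid j hj).1, F.p_al j hj h1⟩
    · exact F.valid j hj
    · exact hρ j hj
  · have hlc : I.lc φ v = I.lc ρ v := by
      unfold lc jobLoad
      refine sum_congr rfl fun j hj => ?_
      rcases Nat.le_one_iff_eq_zero_or_eq_one.1 (I.hb_le j (mem_range.1 hj)) with h | h
      · simp [h, hφ j (mem_range.1 hj)]
      · simp [h]
    have hA : ∀ u < I.M, I.baseOf T σ p u + I.w * I.lc ρ u ≤ T + T / 2 := by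
      intro u hu
      by_contra hcon
      refine he u hu (Or.inl ?_)
      rw [lightNet_A]
      simp only [lightNet]
      omega
    have hhot : ∀ u < I.M, I.grpOf T σ p u < I.M →
        ((I.lightNet T (I.baseOf T σ p) (I.grpOf T σ p)).Hot ρ u ↔
          T + T / 2 < I.dl u + I.w * I.lc ρ u + I.W) := by
      intro u hu hg
      unfold Net.Hot
      rw [lightNet_A, F.baseOf_eq hu hg]
      rfl
    have huniq := fun u v =>
      Net.hot_unique (P := I.lightNet T (I.baseOf T σ p) (I.grpOf T σ p)) he (u := u) (v := v)
    have hgi : ∀ x < I.M, I.grpOf T σ p x < I.M → ∀ i, I.grpOf T σ p (p^[i] x) = I.grpOf T σ p x := by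
      intro x hx hg i
      have hgx := (F.grpOf_lt_iff hx).1 hg
      induction i with
      | zero => rfl
      | succ i ih =>
        have hi := F.iterate_lt hx i
        have h2 : I.grpOf T σ p (p^[i] x) < I.M := by omega
        have h3 := (F.grpOf_lt_iff hi).1 h2
        rw [Function.iterate_succ_apply', ← ih]
        unfold grpOf
        rw [if_pos h3, if_pos ((F.grouped_p hi).2 h3), F.root_p hi h3.1]
    have hfix : ∀ x < I.M, I.grpOf T σ p x < I.M → p x = x → I.Free σ x := by
      intro x hx hg hpx
      have := ((F.grpOf_lt_iff hx).1 hg).1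
      rwa [Function.iterate_fixed hpx] at this
    rw [jobLoad_jw, hlc]
    by_cases hg : I.grpOf T σ p v < I.M
    · have hcle : I.hc φ v ≤ 1 := by
        refine hc_le_one fun i hi j hj hhi hhj hiv hjv => ?_
        rw [hφ i hi, if_pos hhi] at hiv
        rw [hφ j hj, if_pos hhj] at hjv
        -- A moved job does not meet one that stays: it enters the next machine of a marked path,
        -- which is marked as well, or else is the root after `M` steps and holds no heavy job.
        have hmix : ∀ i < I.N, ∀ j < I.N, 0 < I.hb j → I.Marked T σ p ρ (σ i) → p (σ i) = v →
            ¬ I.Marked T σ p ρ (σ j) → σ j = v → False := by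
          intro i hi j hj hhj ⟨x, hx, hxg, hxh, a, ha, hax⟩ hiv hmj hjv
          rw [← hax, ← Function.iterate_succ_apply' p] at hiv
          by_cases ha' : a + 1 < I.M
          · exact hmj ⟨x, hx, hxg, hxh, a + 1, ha', hiv.trans hjv.symm⟩
          · have h1 := ((F.grpOf_lt_iff hx).1 hxg).1
            rw [show I.M = a + 1 by omega, hiv] at h1
            exact h1 j hj hhj hjv
        split_ifs at hiv hjv with hmi hmj hmj
        · obtain ⟨x, hx, hxg, hxh, a, ha, hax⟩ := hmi
          obtain ⟨y, hy, hyg, hyh, b, hb, hby⟩ := hmj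
          rw [← hax, ← Function.iterate_succ_apply' p] at hiv
          rw [← hby, ← Function.iterate_succ_apply' p] at hjv
          have h1 := hgi x hx hxg (a + 1)
          have h2 := hgi y hy hyg (b + 1)
          rw [hiv] at h1
          rw [hjv] at h2
          obtain rfl := huniq x y hx hy hyg (h1.symm.trans h2) hxh hyh
          -- Both moved jobs lie on the path of the one hot machine of the group. If the path
          -- arrives at `v` at two different times, then `v` is the root, and the later job would
          -- sit on it.
          have hrep : ∀ a b, a < b → ∀ j < I.N, 0 < I.hb j → p^[b] x = σ j → p^[a + 1] x = v →
              p^[b + 1] x = v → False := by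
            intro a b hab j hj hhj hby hiv hjv
            have h3 := F.iterate_fixed_of_repeat hx hxg (i := a + 1) (j := b + 1) (by omega)
              (hiv.trans hjv.symm)
            rw [Function.iterate_succ_apply', hiv] at h3
            have h4 : p^[b] x = v := by
              have : b = (b - (a + 1)) + (a + 1) := by omega
              rw [this, Function.iterate_add_apply, hiv, Function.iterate_fixed h3]
            exact hfix v hv hg h3 j hj hhj (hby.symm.trans h4)
          rcases lt_trichotomy a b with hab | rfl | hab
          · exact (hrep a b hab j hj hhj hby hiv hjv).elim
          · exact F.inj hi hj hhi hhj (hax.symm.trans hby)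
          · exact (hrep b a hab i hi hhi hax hjv hiv).elim
        · exact (hmix i hi j hj hhj hmi hiv hmj hjv).elim
        · exact (hmix j hj i hi hhi hmj hjv hmi hiv).elim
        · exact F.inj hi hj hhi hhj (hiv.trans hjv.symm)
      have hW : I.W * I.hc φ v ≤ I.W * 1 := Nat.mul_le_mul_left _ hcle
      by_cases hh : (I.lightNet T (I.baseOf T σ p) (I.grpOf T σ p)).Hot ρ v
      -- The job of the hot machine moves away. A job could enter only along the path that starts
      -- here, and this path returns only if the machine is the root, in which case it never leaves
      -- and carries no heavy job.
      · have h0 : I.hc φ v = 0 := by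
          refine hc_eq_zero fun j hj hhj hjv => ?_
          rw [hφ j hj, if_pos hhj] at hjv
          split_ifs at hjv with hm
          · obtain ⟨x, hx, hxg, hxh, a, ha, hax⟩ := hm
            rw [← hax, ← Function.iterate_succ_apply' p] at hjv
            have h1 := hgi x hx hxg (a + 1)
            rw [hjv] at h1
            obtain rfl := huniq x v hx hv hg h1.symm hxh hh
            have h3 := F.iterate_fixed_of_repeat hx hxg (i := 0) (j := a + 1) (by omega) hjv.symm
            simp only [Function.iterate_succ, Function.iterate_zero, Function.comp, id] at h3
            rw [Function.iterate_fixed h3] at hax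
            exact hfix x hx hxg h3 j hj hhj hax.symm
          · exact hm ⟨v, hv, hg, hh, 0, by omega, hjv.symm⟩
        have := hA v hv
        rw [F.baseOf_eq hv hg] at this
        rw [h0]
        omega
      · rw [hhot v hv hg] at hh
        omega
    -- Marked paths stay in their groups, so a machine outside gains no heavy job.
    · have hcφ : I.hc φ v ≤ I.hc σ v := by
        unfold hc jobLoad
        refine sum_le_sum fun j hj => ?_
        have hjN := mem_range.1 hj
        by_cases hhj : 0 < I.hb j
        · by_cases hm : I.Marked T σ p ρ (σ j)
          · obtain ⟨x, hx, hxg, hxh, a, ha, hax⟩ := hm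
            have h1 := hgi x hx hxg (a + 1)
            have h2 : φ j ≠ v := by
              rw [hφ j hjN, if_pos hhj, if_pos ⟨x, hx, hxg, hxh, a, ha, hax⟩, ← hax,
                ← Function.iterate_succ_apply' p]
              exact fun h3 => hg (h3 ▸ h1.trans_lt hxg)
            rw [if_neg h2]
            exact Nat.zero_le _
          · rw [hφ j hjN, if_pos hhj, if_neg hm]
        · rw [Nat.eq_zero_of_not_pos hhj]
          simp
      have h1 := hA v hv
      have h2 := F.hc_le hv
      have hW : I.W * I.hc φ v ≤ I.W * I.hc σ v := Nat.mul_le_mul_left _ hcφ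
      rw [F.grpOf_lt_iff hv] at hg
      unfold baseOf at h1
      split_ifs at h1 with h3
      · have : I.hc σ v = 0 := hc_eq_zero (h3.resolve_left hg)
        rw [this] at hW
        omega
      · have : I.W * I.hc σ v ≤ I.W * 1 := Nat.mul_le_mul_left _ h2
        omega

end Forest

end TwoSize

/-! ## Programs with bounded loops -/

namespace RAM

/-- Programs in which every loop runs through the numbers below one of the variables `0`, `1`,
`2`. -/
inductive Cmd where
  | skip : Cmd
  | set (x : ℕ) (e : Exp) : Cmd
  | put (a : ℕ) (i e : Exp) : Cmd
  | seq (p q : Cmd) : Cmd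
  | ite (e f : Exp) (p q : Cmd) : Cmd
  | rep (x b : ℕ) (p : Cmd) : Cmd

/-- `f 0`, then `f 1`, and so on, up to `f (n - 1)`. -/
def iter (f : ℕ → State → State) : ℕ → State → State
  | 0, s => s
  | n + 1, s => f n (iter f n s)

namespace Cmd

/-- The program for a command. -/
def compile : Cmd → Prog
  | skip => .skip
  | set x e => .set x e
  | put a i e => .put a i e
  | seq p q => .seq p.compile q.compile
  | ite e f p q => .ite e f p.compile q.compile
  | rep x b p => .seq (.set x (.const 0)) (.loop (.var x) (.var b)
      (.seq p.compile (.set x (.add (.var x) (.const 1)))))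

/-- The effect of a command. -/
def exec : Cmd → State → State
  | skip, s => s
  | set x e, s => s.setVar x (e.eval s)
  | put a i e, s => s.setCell a (i.eval s) (e.eval s)
  | seq p q, s => q.exec (p.exec s)
  | ite e f p q, s => if e.eval s < f.eval s then p.exec s else q.exec s
  | rep x b p, s => iter (fun i t => (p.exec t).setVar x (i + 1)) (s.var b) (s.setVar x 0)

/-- Does a command write to variable `y`? -/
def writesVar (y : ℕ) : Cmd → Bool
  | skip => false
  | set x _ => x == y
  | put _ _ _ => false
  | seq p q => p.writesVar y || q.writesVar y
  | ite _ _ p q => p.writesVar y || q.writesVar y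
  | rep x _ p => x == y || p.writesVar y

/-- Does a command write to array `c`? -/
def writesArr (c : ℕ) : Cmd → Bool
  | skip => false
  | set _ _ => false
  | put a _ _ => a == c
  | seq p q => p.writesArr c || q.writesArr c
  | ite _ _ p q => p.writesArr c || q.writesArr c
  | rep _ _ p => p.writesArr c

/-- The variables `0`, `1`, `2` are not written to, and loops do not write to their counters. -/
def ok : Cmd → Bool
  | skip => true
  | set x _ => 2 < x
  | put _ _ _ => true
  | seq p q => p.ok && q.ok
  | ite _ _ p q => p.ok && q.ok
  | rep x b p => 2 < x && b < 3 && !p.writesVar x && p.ok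

/-- A time bound in terms of a bound for the variables `0`, `1`, `2`. -/
noncomputable def time : Cmd → Polynomial ℕ
  | skip => 1
  | set _ e => (e.cost + 1 : ℕ)
  | put _ i e => (i.cost + e.cost + 1 : ℕ)
  | seq p q => p.time + q.time
  | ite e f p q => (e.cost + f.cost + 1 : ℕ) + (p.time + q.time)
  -- The `5` pays for resetting the counter (`2`) and the last test (`3`); the `7` pays for the test
  -- (`3`) and the increment (`4`) in each round.
  | rep _ _ p => 5 + Polynomial.X * (p.time + 7)

/-- Frame rule: `writesVar` computes, so for a concrete command the hypothesis is proved by `rfl`.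
-/
theorem exec_var {y : ℕ} {p : Cmd} (h : p.writesVar y = false) (s : State) :
    (p.exec s).var y = s.var y := by
  induction p generalizing s with
  | skip => rfl
  | set x e =>
    simp only [writesVar, beq_eq_false_iff_ne] at h
    exact Function.update_of_ne h.symm _ _
  | put a i e => rfl
  | seq p q ihp ihq =>
    simp only [writesVar, Bool.or_eq_false_iff] at h
    simp only [exec]
    rw [ihq h.2, ihp h.1]
  | ite e f p q ihp ihq =>
    simp only [writesVar, Bool.or_eq_false_iff] at h
    simp only [exec]
    split_ifs
    · exact ihp h.1 s
    · exact ihq h.2 s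
  | rep x b p ih =>
    simp only [writesVar, Bool.or_eq_false_iff, beq_eq_false_iff_ne] at h
    simp only [exec]
    generalize s.var b = n
    induction n with
    | zero => exact Function.update_of_ne h.1.symm _ _
    | succ n ihn =>
      simp only [iter, State.setVar] at *
      rw [Function.update_of_ne h.1.symm, ih h.2, ihn]

theorem exec_arr {c : ℕ} {p : Cmd} (h : p.writesArr c = false) (s : State) :
    (p.exec s).arr c = s.arr c := by
  induction p generalizing s with
  | skip => rfl
  | set x e => rfl
  | put a i e =>
    simp only [writesArr, beq_eq_false_iff_ne] at h
    exact Function.update_of_ne h.symm _ _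
  | seq p q ihp ihq =>
    simp only [writesArr, Bool.or_eq_false_iff] at h
    simp only [exec]
    rw [ihq h.2, ihp h.1]
  | ite e f p q ihp ihq =>
    simp only [writesArr, Bool.or_eq_false_iff] at h
    simp only [exec]
    split_ifs
    · exact ihp h.1 s
    · exact ihq h.2 s
  | rep x b p ih =>
    simp only [writesArr] at h
    simp only [exec]
    generalize s.var b = n
    induction n with
    | zero => rfl
    | succ n ihn =>
      simp only [iter, State.setVar] at *
      rw [ih h, ihn]

theorem writesVar_of_ok {y : ℕ} (hy : y < 3) {p : Cmd} (h : p.ok = true) :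
    p.writesVar y = false := by
  induction p with
  | skip => rfl
  | set x e =>
    simp only [ok, decide_eq_true_eq] at h
    simp only [writesVar, beq_eq_false_iff_ne]
    omega
  | put a i e => rfl
  | seq p q ihp ihq =>
    simp only [ok, Bool.and_eq_true] at h
    simp [writesVar, ihp h.1, ihq h.2]
  | ite e f p q ihp ihq =>
    simp only [ok, Bool.and_eq_true] at h
    simp [writesVar, ihp h.1, ihq h.2]
  | rep x b p ih =>
    simp only [ok, Bool.and_eq_true, decide_eq_true_eq] at h
    simp only [writesVar, ih h.2, Bool.or_false, beq_eq_false_iff_ne]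
    omega

/-- Loop bounds are never overwritten, so each loop makes at most `L` rounds, and nested loops
multiply to a polynomial. -/
theorem runs {p : Cmd} (h : p.ok = true) {L : ℕ} {s : State} (hs : ∀ b < 3, s.var b ≤ L) :
    ∃ k, Runs p.compile s (p.exec s) k ∧ k ≤ p.time.eval L := by
  induction p generalizing s with
  | skip => exact ⟨_, Runs.skip s, by simp [time]⟩
  | set x e => exact ⟨_, Runs.set x e s, by simp [time]⟩
  | put a i e => exact ⟨_, Runs.put a i e s, by simp [time]⟩
  | seq p q ihp ihq =>
    simp only [ok, Bool.and_eq_true] at h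
    obtain ⟨k, hk, hk'⟩ := ihp h.1 hs
    obtain ⟨l, hl, hl'⟩ := ihq (s := p.exec s) h.2 fun b hb => by
      rw [exec_var (writesVar_of_ok hb h.1)]; exact hs b hb
    exact ⟨_, Runs.seq hk hl, by simp only [time, Polynomial.eval_add]; omega⟩
  | ite e f p q ihp ihq =>
    simp only [ok, Bool.and_eq_true] at h
    simp only [time, Polynomial.eval_add, Polynomial.eval_natCast, exec, compile]
    split_ifs with hc
    · obtain ⟨k, hk, hk'⟩ := ihp h.1 hs
      exact ⟨_, Runs.ite_true hc hk, by push_cast; omega⟩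
    · obtain ⟨k, hk, hk'⟩ := ihq h.2 hs
      exact ⟨_, Runs.ite_false hc hk, by push_cast; omega⟩
  | rep x b p ih =>
    simp only [ok, Bool.and_eq_true, decide_eq_true_eq, Bool.not_eq_true'] at h
    obtain ⟨⟨⟨hx, hb⟩, hpx⟩, hp⟩ := h
    set f : ℕ → State → State := fun i t => (p.exec t).setVar x (i + 1) with hf
    set n := s.var b with hn
    have hvar : ∀ i, ∀ y < 3, (iter f i (s.setVar x 0)).var y = s.var y := by
      intro i y hy
      induction i with
      | zero => exact Function.update_of_ne (by omega) _ _
      | succ i ihi =>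
        simp only [iter, hf, State.setVar]
        rw [Function.update_of_ne (by omega), exec_var (writesVar_of_ok hy hp)]
        exact ihi
    have hcount : ∀ i, (iter f i (s.setVar x 0)).var x = i := by
      intro i
      cases i <;> simp [iter, hf, State.setVar]
    -- Induction on the number `d` of rounds left, because `Runs` unfolds a loop at its front
    -- whereas `iter` grows at its end.
    have key : ∀ d i, i + d = n → ∃ k, Runs (.loop (.var x) (.var b)
        (.seq p.compile (.set x (.add (.var x) (.const 1))))) (iter f i (s.setVar x 0))
        (iter f n (s.setVar x 0)) k ∧ k ≤ 3 + d * (p.time.eval L + 7) := by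
      intro d
      induction d with
      | zero =>
        intro i hi
        obtain rfl : i = n := by omega
        refine ⟨_, Runs.loop_false ?_, by simp [Exp.cost]⟩
        simp only [Exp.eval, hcount, hvar _ b hb]
        omega
      | succ d ihd =>
        intro i hi
        obtain ⟨k, hk, hk'⟩ := ih (s := iter f i (s.setVar x 0)) hp fun b hb => by
          rw [hvar i b hb]; exact hs b hb
        obtain ⟨l, hl, hl'⟩ := ihd (i + 1) (by omega)
        have hstep : f i (iter f i (s.setVar x 0)) = (p.exec (iter f i (s.setVar x 0))).setVar x
            ((Exp.add (.var x) (.const 1)).eval (p.exec (iter f i (s.setVar x 0)))) := by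
          simp only [Exp.eval, exec_var hpx, hcount]
          rfl
        have hrun := Runs.set x (.add (.var x) (.const 1)) (p.exec (iter f i (s.setVar x 0)))
        rw [← hstep] at hrun
        refine ⟨_, Runs.loop_true ?_ (Runs.seq hk hrun) hl, ?_⟩
        · simp only [Exp.eval, hcount, hvar _ b hb]
          omega
        · simp only [Exp.cost]
          rw [add_mul]
          omega
    obtain ⟨k, hk, hk'⟩ := key n 0 (by omega)
    refine ⟨_, Runs.seq (Runs.set x (.const 0) s) hk, ?_⟩
    have h1 : n * (p.time.eval L + 7) ≤ L * (p.time.eval L + 7) :=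
      Nat.mul_le_mul_right _ (hs b hb)
    simp only [time, Polynomial.eval_add, Polynomial.eval_mul, Polynomial.eval_X,
      Polynomial.eval_ofNat, Exp.cost]
    omega

/-- An invariant of a loop holds at its end. -/
theorem rep_inv {x b : ℕ} {p : Cmd} (h : (rep x b p).ok = true) {s : State}
    (Inv : ℕ → State → Prop) (h0 : Inv 0 (s.setVar x 0))
    (hs : ∀ i < s.var b, ∀ t : State, t.var x = i →
      (∀ y, (rep x b p).writesVar y = false → t.var y = s.var y) →
      (∀ c, p.writesArr c = false → t.arr c = s.arr c) → Inv i t →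
      Inv (i + 1) ((p.exec t).setVar x (i + 1))) :
    Inv (s.var b) ((rep x b p).exec s) := by
  simp only [ok, Bool.and_eq_true, decide_eq_true_eq, Bool.not_eq_true'] at h
  obtain ⟨⟨⟨hx, hb⟩, hpx⟩, hp⟩ := h
  simp only [exec]
  have key : ∀ i ≤ s.var b,
      Inv i (iter (fun i t => (p.exec t).setVar x (i + 1)) i (s.setVar x 0)) ∧
      (iter (fun i t => (p.exec t).setVar x (i + 1)) i (s.setVar x 0)).var x = i ∧
      (∀ y, (rep x b p).writesVar y = false →
        (iter (fun i t => (p.exec t).setVar x (i + 1)) i (s.setVar x 0)).var y = s.var y) ∧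
      (∀ c, p.writesArr c = false →
        (iter (fun i t => (p.exec t).setVar x (i + 1)) i (s.setVar x 0)).arr c = s.arr c) := by
    intro i
    induction i with
    | zero =>
      refine fun _ => ⟨h0, by simp [iter, State.setVar], fun y hy => ?_, fun _ _ => rfl⟩
      simp only [writesVar, Bool.or_eq_false_iff, beq_eq_false_iff_ne] at hy
      exact Function.update_of_ne hy.1.symm _ _
    | succ i ih =>
      intro hi
      obtain ⟨h1, h2, h3, h4⟩ := ih (by omega)
      refine ⟨hs i (by omega) _ h2 h3 h4 h1, by simp [iter, State.setVar], fun y hy => ?_,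
        fun c hc => ?_⟩
      · have := h3 y hy
        simp only [writesVar, Bool.or_eq_false_iff, beq_eq_false_iff_ne] at hy
        simp only [iter, State.setVar] at *
        rw [Function.update_of_ne hy.1.symm, exec_var hy.2, this]
      · have := h4 c hc
        simp only [iter, State.setVar] at *
        rw [exec_arr hc, this]
  exact (key _ le_rfl).1

/-- `p` if `e < f`. -/
abbrev when (e f : Exp) (p : Cmd) : Cmd := .ite e f p .skip

/-- `p` if `e = f`. -/
abbrev whenEq (e f : Exp) (p : Cmd) : Cmd := .ite e f .skip (.ite f e .skip p)

theorem exec_when (e f : Exp) (p : Cmd) (s : State) :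
    (when e f p).exec s = if e.eval s < f.eval s then p.exec s else s := rfl

theorem exec_whenEq (e f : Exp) (p : Cmd) (s : State) :
    (whenEq e f p).exec s = if e.eval s = f.eval s then p.exec s else s := by
  simp only [exec]
  split_ifs <;> first | rfl | omega

/-- A loop that fills the cells of an array. -/
theorem exec_rep_table {x b : ℕ} {p : Cmd} (h : (rep x b p).ok = true) {s : State} {a : ℕ}
    (f : ℕ → ℕ)
    (hs : ∀ i < s.var b, ∀ t : State, t.var x = i →
      (∀ y, (rep x b p).writesVar y = false → t.var y = s.var y) →
      (∀ c, p.writesArr c = false → t.arr c = s.arr c) →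
      (p.exec t).arr a = Function.update (t.arr a) i (f i)) :
    ((rep x b p).exec s).arr a = fun i => if i < s.var b then f i else s.arr a i := by
  refine rep_inv h (fun n t => t.arr a = fun i => if i < n then f i else s.arr a i) ?_ ?_
  · simp [State.setVar]
  · intro i hi t ht hv ha hI
    change (p.exec t).arr a = _
    rw [hs i hi t ht hv ha, hI]
    funext v
    by_cases hvi : v = i
    · subst hvi; simp
    · rw [Function.update_of_ne hvi]
      have : v < i + 1 ↔ v < i := by omega
      simp only [this]

end Cmd

end RAM

namespace RAM

open Cmd Exp

/-! ## The local search as a program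

Variables: `0` number of machines, `1` number of jobs, `2` its successor, `3` light weight, `4`
heavy weight, `5` guess of the optimum, `6` threshold, `7` one plus the best makespan guess so far
or `0`, the others are counters and flags.
Arrays: `0` input, `1` best assignment, `2` position of a job in the input, `3` base loads, `4`
weights, `5` groups, `6` current assignment, `7` heights, `8` loads, `9` machines that have to
give a job away, `10` heavy assignment, `11` parents, `12` free machines, `13` roots, `14` marks. -/

/-- The entry of the input that tells whether the job in variable `j` is heavy. -/
abbrev heavyExp (j : ℕ) : Exp := get 0 (get 2 (var j))

/-- The entry of the input that tells whether the job in variable `j` may go to the machine in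
variable `v`. -/
abbrev allowedExp (j v : ℕ) : Exp := get 0 (add (add (get 2 (var j)) (var v)) (const 1))

/-- The dedicated load of the machine in variable `v`. -/
abbrev dlExp (v : ℕ) : Exp := get 0 (add (var v) (const 4))

/-- The search problem in memory. -/
def netOf (s : State) : Net where
  M := s.var 0
  N := s.var 1
  X := s.var 4
  thr := s.var 6
  D := s.arr 3
  wt := s.arr 4
  grp := s.arr 5
  al := fun j v => 0 < s.arr 0 (s.arr 2 j + v + 1)

theorem netOf_exec {p : Cmd} (h : (!p.writesVar 0 && !p.writesVar 1 && !p.writesVar 4 &&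
    !p.writesVar 6 && !p.writesArr 0 && !p.writesArr 2 && !p.writesArr 3 && !p.writesArr 4 &&
    !p.writesArr 5) = true) (s : State) : netOf (p.exec s) = netOf s := by
  simp only [Bool.and_eq_true, Bool.not_eq_true'] at h
  obtain ⟨⟨⟨⟨⟨⟨⟨⟨h1, h2⟩, h3⟩, h4⟩, h5⟩, h6⟩, h7⟩, h8⟩, h9⟩ := h
  simp only [netOf, exec_var h1, exec_var h2, exec_var h3, exec_var h4, exec_arr h5, exec_arr h6,
    exec_arr h7, exec_arr h8, exec_arr h9]

/-- Compute the loads. -/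
def loadCmd : Cmd :=
  .seq (.rep 8 0 (.put 8 (var 8) (get 3 (var 8))))
    (.rep 10 1 (.put 8 (get 6 (var 10)) (add (get 8 (get 6 (var 10))) (get 4 (var 10)))))

theorem loadCmd_spec (s : State) : ∀ v < s.var 0,
    (loadCmd.exec s).arr 8 v = (netOf s).A (s.arr 6) v := by
  have h1 := exec_rep_table (x := 8) (b := 0) (p := .put 8 (var 8) (get 3 (var 8))) rfl (s := s)
    (a := 8) (s.arr 3) (fun i hi t ht hv ha => by
      simp [exec, State.setCell, eval, ht, ha 3 rfl])
  set s1 := (rep 8 0 (.put 8 (var 8) (get 3 (var 8)))).exec s with hs1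
  have e6 : s1.arr 6 = s.arr 6 := exec_arr rfl s
  have e4 : s1.arr 4 = s.arr 4 := exec_arr rfl s
  have e1 : s1.var 1 = s.var 1 := exec_var rfl s
  have key := rep_inv (x := 10) (b := 1) (p := .put 8 (get 6 (var 10))
    (add (get 8 (get 6 (var 10))) (get 4 (var 10)))) rfl (s := s1)
    (fun n t => ∀ v < s.var 0, t.arr 8 v = s.arr 3 v + jobLoad n (s.arr 4) (s.arr 6) v)
    (fun v hv => by simp [State.setVar, h1, hv, jobLoad]) ?_
  · intro v hv
    have := key v hv
    rw [e1] at this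
    exact this
  · intro i hi t ht hva har hI v hv
    simp only [exec, State.setCell, State.setVar, eval, ht, har 6 rfl, har 4 rfl, e6, e4,
      Function.update_self, jobLoad, sum_range_succ]
    by_cases hvi : v = s.arr 6 i
    · subst hvi
      rw [Function.update_self, hI _ hv, if_pos rfl]
      unfold jobLoad
      omega
    · rw [Function.update_of_ne hvi, hI _ hv, if_neg (Ne.symm hvi)]
      rfl

/-- Compare the machines in variables `8` and `9`. -/
def compareCmd : Cmd :=
  whenEq (get 5 (var 9)) (get 5 (var 8)) (when (var 6) (add (get 8 (var 9)) (var 4))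
    (.seq (.ite (var 8) (var 9) (.set 15 (const 1)) (when (var 9) (var 8) (.set 15 (const 1))))
      (when (get 7 (var 9)) (get 7 (var 8)) (.set 16 (const 0)))))

/-- Decide whether the machine in variable `8` has to give a job away. -/
def eligOneCmd : Cmd :=
  .seq (.put 9 (var 8) (const 0)) <| .seq (.set 15 (const 0)) <| .seq (.set 16 (const 1)) <|
  .seq (.rep 9 0 compareCmd) <|
  .seq (when (const 0) (var 15) <| when (const 0) (var 16) <| when (get 5 (var 8)) (var 0) <|
    when (var 6) (add (get 8 (var 8)) (var 4)) <| .put 9 (var 8) (const 1))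
    (when (var 6) (get 8 (var 8)) (.put 9 (var 8) (const 1)))

/-- Find the machines that have to give a job away. -/
def eligCmd : Cmd := .rep 8 0 eligOneCmd

/-- Variable `15` records that the group has another hot machine; variable `16` drops to `0` when a
hot machine of the group is lower. -/
theorem compareCmd_spec (s : State) :
    (0 < (compareCmd.exec s).var 15 ↔ 0 < s.var 15 ∨ (s.var 9 ≠ s.var 8 ∧
      s.arr 5 (s.var 9) = s.arr 5 (s.var 8) ∧ s.var 6 < s.arr 8 (s.var 9) + s.var 4)) ∧
    (0 < (compareCmd.exec s).var 16 ↔ 0 < s.var 16 ∧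
      (s.arr 5 (s.var 9) = s.arr 5 (s.var 8) → s.var 6 < s.arr 8 (s.var 9) + s.var 4 →
      s.arr 7 (s.var 8) ≤ s.arr 7 (s.var 9))) := by
  unfold compareCmd
  rw [exec_whenEq, exec_when]
  simp only [eval]
  by_cases h1 : s.arr 5 (s.var 9) = s.arr 5 (s.var 8)
  · by_cases h2 : s.var 6 < s.arr 8 (s.var 9) + s.var 4
    · by_cases h4 : s.arr 7 (s.var 9) < s.arr 7 (s.var 8) <;>
      rcases lt_trichotomy (s.var 8) (s.var 9) with h3 | h3 | h3
      · simp [exec, eval, State.setVar, h1, h2, h3, h4, h3.ne']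
      · simp [exec, eval, h2, h3]
      · simp [exec, eval, State.setVar, h1, h2, h3, h4, h3.ne]
      · simp [exec, eval, State.setVar, h1, h2, h3, h4, h3.ne', not_lt.1 h4]
      · simp [exec, eval, h2, h3]
      · simp [exec, eval, State.setVar, h1, h2, h3, h4, h3.ne, not_lt.1 h4]
    · simp [h1, h2]
  · simp [h1]

theorem eligOneCmd_spec (s : State) (A : ℕ → ℕ) (hA : ∀ v < s.var 0, s.arr 8 v = A v)
    (hv : s.var 8 < s.var 0) {q : Prop} [Decidable q]
    (hq : q ↔ (s.var 6 < A (s.var 8) ∨ (s.arr 5 (s.var 8) < s.var 0 ∧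
        s.var 6 < A (s.var 8) + s.var 4 ∧ (∃ u < s.var 0, u ≠ s.var 8 ∧
          s.arr 5 u = s.arr 5 (s.var 8) ∧ s.var 6 < A u + s.var 4) ∧
        ∀ u < s.var 0, s.arr 5 u = s.arr 5 (s.var 8) → s.var 6 < A u + s.var 4 →
          s.arr 7 (s.var 8) ≤ s.arr 7 u))) :
    (eligOneCmd.exec s).arr 9 = Function.update (s.arr 9) (s.var 8) (if q then 1 else 0) := by
  unfold eligOneCmd
  -- The fourth equation of `exec` is the one for `seq`; loops and tests stay folded.
  simp only [exec.eq_4]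
  set s1 := (Cmd.set 16 (const 1)).exec ((Cmd.set 15 (const 0)).exec
    ((Cmd.put 9 (var 8) (const 0)).exec s)) with hs1
  have a9 : s1.arr 9 = Function.update (s.arr 9) (s.var 8) 0 := by
    simp [hs1, exec, State.setVar, State.setCell, eval]
  have key := rep_inv (x := 9) (b := 0) (p := compareCmd) rfl (s := s1)
    (fun n t => (0 < t.var 15 ↔ ∃ u < n, u ≠ s.var 8 ∧ s.arr 5 u = s.arr 5 (s.var 8) ∧
        s.var 6 < s.arr 8 u + s.var 4) ∧
      (0 < t.var 16 ↔ ∀ u < n, s.arr 5 u = s.arr 5 (s.var 8) → s.var 6 < s.arr 8 u + s.var 4 →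
          s.arr 7 (s.var 8) ≤ s.arr 7 u))
    (by simp [hs1, exec, State.setVar, State.setCell, eval]) ?_
  · set s2 := (rep 9 0 compareCmd).exec s1 with hs2
    have b9 : s2.arr 9 = s1.arr 9 := exec_arr rfl s1
    have b8 : s2.arr 8 = s.arr 8 := exec_arr rfl s1
    have b5 : s2.arr 5 = s.arr 5 := exec_arr rfl s1
    have v0 : s2.var 0 = s.var 0 := exec_var rfl s1
    have v4 : s2.var 4 = s.var 4 := exec_var rfl s1
    have v6 : s2.var 6 = s.var 6 := exec_var rfl s1
    have v8 : s2.var 8 = s.var 8 := exec_var rfl s1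
    have w0 : s1.var 0 = s.var 0 := rfl
    rw [w0] at key
    have c1 : (∃ u < s.var 0, u ≠ s.var 8 ∧ s.arr 5 u = s.arr 5 (s.var 8) ∧
        s.var 6 < s.arr 8 u + s.var 4) ↔ (∃ u < s.var 0, u ≠ s.var 8 ∧
          s.arr 5 u = s.arr 5 (s.var 8) ∧ s.var 6 < A u + s.var 4) := by
      refine exists_congr fun u => and_congr_right fun hu => by rw [hA u hu]
    have c2 : (∀ u < s.var 0, s.arr 5 u = s.arr 5 (s.var 8) → s.var 6 < s.arr 8 u + s.var 4 →
          s.arr 7 (s.var 8) ≤ s.arr 7 u) ↔ ∀ u < s.var 0, s.arr 5 u = s.arr 5 (s.var 8) →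
          s.var 6 < A u + s.var 4 → s.arr 7 (s.var 8) ≤ s.arr 7 u := by
      refine forall_congr' fun u => forall_congr' fun hu => by rw [hA u hu]
    rw [c1, c2] at key
    rw [← key.1, ← key.2] at hq
    simp only [exec_when, eval, b8, b5, v0, v4, v6, v8]
    rw [hA _ hv]
    by_cases e1 : 0 < s2.var 15 <;> by_cases e2 : 0 < s2.var 16 <;>
    by_cases e3 : s.arr 5 (s.var 8) < s.var 0 <;>
    by_cases e4 : s.var 6 < A (s.var 8) + s.var 4 <;>
    by_cases e5 : s.var 6 < A (s.var 8) <;>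
    simp [hq, e1, e2, e3, e4, e5, exec, State.setCell, eval, hA _ hv, b9, b8, v6, v8, a9]
  · intro i hi t ht hva har hI
    have d8 : t.arr 8 = s.arr 8 := har 8 rfl
    have d5 : t.arr 5 = s.arr 5 := har 5 rfl
    have d7 : t.arr 7 = s.arr 7 := har 7 rfl
    have x8 : t.var 8 = s.var 8 := hva 8 rfl
    have x6 : t.var 6 = s.var 6 := hva 6 rfl
    have x4 : t.var 4 = s.var 4 := hva 4 rfl
    obtain ⟨k1, k2⟩ := compareCmd_spec t
    rw [ht, d8, d5, x8, x6, x4, hI.1] at k1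
    rw [ht, d8, d5, d7, x8, x6, x4, hI.2] at k2
    have y1 : ((compareCmd.exec t).setVar 9 (i + 1)).var 15 = (compareCmd.exec t).var 15 := rfl
    have y2 : ((compareCmd.exec t).setVar 9 (i + 1)).var 16 = (compareCmd.exec t).var 16 := rfl
    rw [y1, y2, k1, k2, Nat.exists_lt_succ_right, Nat.forall_lt_succ_right]
    exact ⟨Iff.rfl, Iff.rfl⟩

open Classical in
theorem eligCmd_spec (s : State) (hA : ∀ v < s.var 0, s.arr 8 v = (netOf s).A (s.arr 6) v) :
    ∀ v < s.var 0, (eligCmd.exec s).arr 9 v =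
      if (netOf s).Elig (s.arr 6) (s.arr 7) v then 1 else 0 := by
  have key := exec_rep_table (x := 8) (b := 0) (p := eligOneCmd) rfl (s := s) (a := 9)
    (fun v => if (netOf s).Elig (s.arr 6) (s.arr 7) v then 1 else 0)
    (fun i hi t ht hv ha => ?_)
  · intro v hv
    unfold eligCmd
    rw [key]
    simp only [hv, if_true]
  · have v0 : t.var 0 = s.var 0 := hv 0 rfl
    have v4 : t.var 4 = s.var 4 := hv 4 rfl
    have v6 : t.var 6 = s.var 6 := hv 6 rfl
    have a5 : t.arr 5 = s.arr 5 := ha 5 rfl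
    have a7 : t.arr 7 = s.arr 7 := ha 7 rfl
    have a8 : t.arr 8 = s.arr 8 := ha 8 rfl
    rw [eligOneCmd_spec t ((netOf s).A (s.arr 6)) (by rw [v0, a8]; exact hA)
      (by rw [ht, v0]; exact hi) (q := (netOf s).Elig (s.arr 6) (s.arr 7) i), ht]
    rw [ht, v0, v4, v6, a5, a7]
    rfl

/-- Look for a job that can be pushed. -/
def searchCmd : Cmd :=
  .seq (.set 11 (const 0)) <| .rep 10 1 <| when (const 0) (get 9 (get 6 (var 10))) <|
    .rep 8 0 <| when (const 0) (allowedExp 10 8) <|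
      when (get 7 (var 8)) (get 7 (get 6 (var 10))) <|
      .seq (.set 11 (const 1)) <| .seq (.set 12 (var 10)) (.set 13 (var 8))

/-- Variable `11` is the flag for success, variables `12` and `13` hold the job and its destination.
Later finds overwrite earlier ones. -/
theorem searchCmd_spec (s : State) :
    (0 < (searchCmd.exec s).var 11 → (searchCmd.exec s).var 12 < s.var 1 ∧
      (searchCmd.exec s).var 13 < s.var 0 ∧
      0 < s.arr 9 (s.arr 6 ((searchCmd.exec s).var 12)) ∧
      0 < s.arr 0 (s.arr 2 ((searchCmd.exec s).var 12) + (searchCmd.exec s).var 13 + 1) ∧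
      s.arr 7 ((searchCmd.exec s).var 13) < s.arr 7 (s.arr 6 ((searchCmd.exec s).var 12))) ∧
    (¬ 0 < (searchCmd.exec s).var 11 → ∀ j < s.var 1, ∀ v < s.var 0,
      ¬ (0 < s.arr 9 (s.arr 6 j) ∧ 0 < s.arr 0 (s.arr 2 j + v + 1) ∧
        s.arr 7 v < s.arr 7 (s.arr 6 j))) := by
  set s1 := (Cmd.set 11 (const 0)).exec s with hs1
  set good : ℕ → ℕ → Prop := fun j v => 0 < s.arr 9 (s.arr 6 j) ∧
    0 < s.arr 0 (s.arr 2 j + v + 1) ∧ s.arr 7 v < s.arr 7 (s.arr 6 j) with hgood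
  set Fnd : State → Prop := fun t => 0 < t.var 11 → t.var 12 < s.var 1 ∧ t.var 13 < s.var 0 ∧
    good (t.var 12) (t.var 13) with hF
  have key := rep_inv (x := 10) (b := 1) (p := when (const 0) (get 9 (get 6 (var 10))) <|
    .rep 8 0 <| when (const 0) (allowedExp 10 8) <|
      when (get 7 (var 8)) (get 7 (get 6 (var 10))) <|
      .seq (.set 11 (const 1)) <| .seq (.set 12 (var 10)) (.set 13 (var 8))) rfl (s := s1)
    (fun n t => Fnd t ∧ (¬ 0 < t.var 11 → ∀ j < n, ∀ v < s.var 0, ¬ good j v))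
    ⟨fun h => absurd h (by simp [hs1, exec, State.setVar, eval]), fun _ j hj => by omega⟩ ?_
  · exact key
  · intro i hi t ht hva har ⟨hI1, hI2⟩
    have hi1 : i < s.var 1 := hi
    have a0 : t.arr 0 = s.arr 0 := har 0 rfl
    have a2 : t.arr 2 = s.arr 2 := har 2 rfl
    have a6 : t.arr 6 = s.arr 6 := har 6 rfl
    have a7 : t.arr 7 = s.arr 7 := har 7 rfl
    have a9 : t.arr 9 = s.arr 9 := har 9 rfl
    have v0 : t.var 0 = s.var 0 := hva 0 rfl
    rw [exec_when]
    simp only [eval, ht, a6, a9]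
    split_ifs with hc
    · have key := rep_inv (x := 8) (b := 0) (p := when (const 0) (allowedExp 10 8) <|
        when (get 7 (var 8)) (get 7 (get 6 (var 10))) <|
        .seq (.set 11 (const 1)) <| .seq (.set 12 (var 10)) (.set 13 (var 8))) rfl (s := t)
        (fun n u => Fnd u ∧ (¬ 0 < u.var 11 → (∀ j < i, ∀ v < s.var 0, ¬ good j v) ∧
          ∀ v < n, ¬ good i v))
        ⟨hI1, fun h => ⟨hI2 h, fun v hv => by omega⟩⟩ ?_
      · refine ⟨key.1, fun h => ?_⟩
        obtain ⟨h1, h2⟩ := key.2 h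
        rw [v0] at h2
        rw [Nat.forall_lt_succ_right]
        exact ⟨h1, h2⟩
      · intro x hx u hu huv hua ⟨hJ1, hJ2⟩
        have b0 : u.arr 0 = s.arr 0 := (hua 0 rfl).trans a0
        have b2 : u.arr 2 = s.arr 2 := (hua 2 rfl).trans a2
        have b6 : u.arr 6 = s.arr 6 := (hua 6 rfl).trans a6
        have b7 : u.arr 7 = s.arr 7 := (hua 7 rfl).trans a7
        have w10 : u.var 10 = i := (huv 10 rfl).trans ht
        simp only [exec_when, eval, b0, b2, b6, b7, w10, hu]
        by_cases hg : 0 < s.arr 0 (s.arr 2 i + x + 1) ∧ s.arr 7 x < s.arr 7 (s.arr 6 i)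
        · rw [if_pos hg.1, if_pos hg.2]
          refine ⟨fun _ => ?_, fun h => absurd h ?_⟩
          · simpa [exec, State.setVar, eval, w10, hu, hgood, hc, hg, hi1] using v0 ▸ hx
          · simp [exec, State.setVar, eval]
        · have : (if 0 < s.arr 0 (s.arr 2 i + x + 1) then
              if s.arr 7 x < s.arr 7 (s.arr 6 i) then
                (Cmd.seq (.set 11 (const 1)) <| .seq (.set 12 (var 10)) (.set 13 (var 8))).exec u
              else u else u) = u := by
            split_ifs with h1 h2
            · exact absurd ⟨h1, h2⟩ hg
            · rfl
            · rfl
          rw [this]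
          refine ⟨hJ1, fun h => ⟨(hJ2 h).1, ?_⟩⟩
          rw [Nat.forall_lt_succ_right]
          exact ⟨(hJ2 h).2, fun h => hg h.2⟩
    · refine ⟨hI1, fun h => ?_⟩
      rw [Nat.forall_lt_succ_right]
      exact ⟨hI2 h, fun v _ h => hc h.1⟩

/-- Is a machine that has to give a job away at maximal height? -/
def blockedCmd : Cmd :=
  .seq (.set 14 (const 0)) <| .rep 8 0 <| when (const 0) (get 9 (var 8)) <|
    .ite (get 7 (var 8)) (var 0) .skip (.set 14 (const 1))

theorem blockedCmd_spec (s : State) : 0 < (blockedCmd.exec s).var 14 ↔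
    ∃ v < s.var 0, 0 < s.arr 9 v ∧ s.var 0 ≤ s.arr 7 v := by
  have key := rep_inv (x := 8) (b := 0) (p := when (const 0) (get 9 (var 8)) <|
    .ite (get 7 (var 8)) (var 0) .skip (.set 14 (const 1))) rfl
    (s := (Cmd.set 14 (const 0)).exec s)
    (fun n t => 0 < t.var 14 ↔ ∃ v < n, 0 < s.arr 9 v ∧ s.var 0 ≤ s.arr 7 v)
    (by simp [exec, State.setVar, eval]) ?_
  · exact key
  · intro i hi t ht hva har hI
    have a9 : t.arr 9 = s.arr 9 := har 9 rfl
    have a7 : t.arr 7 = s.arr 7 := har 7 rfl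
    have v0 : t.var 0 = s.var 0 := hva 0 rfl
    rw [Nat.exists_lt_succ_right, ← hI]
    by_cases h1 : 0 < s.arr 9 i <;> by_cases h2 : s.arr 7 i < s.var 0 <;>
    simp [exec, eval, State.setVar, ht, a9, a7, v0, h1, h2]
    omega

/-- Raise the machines that have to give a job away. -/
def raiseCmd : Cmd :=
  .rep 8 0 <| when (const 0) (get 9 (var 8)) <| .put 7 (var 8) (add (get 7 (var 8)) (const 1))

theorem raiseCmd_spec (s : State) : (raiseCmd.exec s).arr 7 =
    fun v => if v < s.var 0 ∧ 0 < s.arr 9 v then s.arr 7 v + 1 else s.arr 7 v := by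
  have key := rep_inv (x := 8) (b := 0) (p := when (const 0) (get 9 (var 8)) <|
    .put 7 (var 8) (add (get 7 (var 8)) (const 1))) rfl (s := s)
    (fun n t => t.arr 7 = fun v => if v < n ∧ 0 < s.arr 9 v then s.arr 7 v + 1 else s.arr 7 v)
    (by simp [State.setVar]) ?_
  · exact key
  · intro i hi t ht hva har hI
    have a9 : t.arr 9 = s.arr 9 := har 9 rfl
    funext v
    change ((when (const 0) (get 9 (var 8))
      (.put 7 (var 8) (add (get 7 (var 8)) (const 1)))).exec t).arr 7 v = _
    rw [exec_when]
    simp only [eval, ht, a9]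
    split_ifs with h1 h2 h2
    · by_cases hv : v = i
      · subst hv; simp [exec, State.setCell, eval, ht, hI]
      · have : v < i := by omega
        simp [exec, State.setCell, eval, ht, hI, hv, this, h2.2]
    · have hv : v ≠ i := by rintro rfl; exact h2 ⟨by omega, h1⟩
      have : ¬ (v < i ∧ 0 < s.arr 9 v) := fun h => h2 ⟨by omega, h.2⟩
      simp [exec, State.setCell, eval, ht, hI, hv, this]
    · have hv : v ≠ i := by rintro rfl; exact h1 h2.2
      have : v < i := by omega
      simp [hI, this, h2.2]
    · have : ¬ (v < i ∧ 0 < s.arr 9 v) := fun h => h2 ⟨by omega, h.2⟩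
      simp [hI, this]

/-- One step of the local search. -/
def stepCmd : Cmd :=
  .seq loadCmd <| .seq eligCmd <| .seq searchCmd <| .seq blockedCmd <|
    .ite (const 0) (var 14) .skip <|
    .ite (const 0) (var 11) (.put 6 (var 12) (var 13)) raiseCmd

/-- Validity is needed because the flags in array `9` are guaranteed only for machines below `M`,
and they are read at the machines of the jobs. -/
theorem stepCmd_spec (s : State) (hσ : (netOf s).Valid (s.arr 6)) :
    (netOf s).Step (s.arr 6) (s.arr 7) ((stepCmd.exec s).arr 6) ((stepCmd.exec s).arr 7) := by
  classical
  set P := netOf s with hP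
  set s1 := loadCmd.exec s with hs1
  set s2 := eligCmd.exec s1 with hs2
  set s3 := searchCmd.exec s2 with hs3
  set s4 := blockedCmd.exec s3 with hs4
  have hP1 : netOf s1 = P := netOf_exec rfl s
  have b6 : s1.arr 6 = s.arr 6 := exec_arr rfl s
  have b7 : s1.arr 7 = s.arr 7 := exec_arr rfl s
  have w0 : s1.var 0 = s.var 0 := exec_var rfl s
  have hel := eligCmd_spec s1 (by rw [hP1, b6, w0]; exact loadCmd_spec s)
  rw [w0, hP1, b6, b7] at hel
  have hel' : ∀ v < P.M, (0 < s2.arr 9 v ↔ P.Elig (s.arr 6) (s.arr 7) v) := by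
    intro v hv
    rw [hel v hv]
    split_ifs with h <;> simp [h]
  have c0 : s2.arr 0 = s.arr 0 := (exec_arr rfl s1).trans (exec_arr rfl s)
  have c2 : s2.arr 2 = s.arr 2 := (exec_arr rfl s1).trans (exec_arr rfl s)
  have c6 : s2.arr 6 = s.arr 6 := (exec_arr rfl s1).trans b6
  have c7 : s2.arr 7 = s.arr 7 := (exec_arr rfl s1).trans b7
  have x0 : s2.var 0 = P.M := (exec_var rfl s1).trans w0
  have x1 : s2.var 1 = P.N := (exec_var rfl s1).trans (exec_var rfl s)
  have d9 : s3.arr 9 = s2.arr 9 := exec_arr rfl s2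
  have d7 : s3.arr 7 = s.arr 7 := (exec_arr rfl s2).trans c7
  have d6 : s3.arr 6 = s.arr 6 := (exec_arr rfl s2).trans c6
  have y0 : s3.var 0 = P.M := (exec_var rfl s2).trans x0
  obtain ⟨hf, hnf⟩ := searchCmd_spec s2
  rw [c0, c2, c6, c7, x0, x1] at hf hnf
  have hb := blockedCmd_spec s3
  rw [d9, d7, y0] at hb
  have hb' : 0 < s4.var 14 ↔ P.Blocked (s.arr 6) (s.arr 7) := by
    rw [hb]
    exact exists_congr fun v => and_congr_right fun hv => by rw [hel' v hv]
  have e6 : s4.arr 6 = s.arr 6 := (exec_arr rfl s3).trans d6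
  have e7 : s4.arr 7 = s.arr 7 := (exec_arr rfl s3).trans d7
  have e9 : s4.arr 9 = s2.arr 9 := (exec_arr rfl s3).trans d9
  have z0 : s4.var 0 = P.M := (exec_var rfl s3).trans y0
  have z11 : s4.var 11 = s3.var 11 := exec_var rfl s3
  have z12 : s4.var 12 = s3.var 12 := exec_var rfl s3
  have z13 : s4.var 13 = s3.var 13 := exec_var rfl s3
  have hexec : stepCmd.exec s = if 0 < s4.var 14 then s4 else if 0 < s4.var 11 then
    s4.setCell 6 (s4.var 12) (s4.var 13) else raiseCmd.exec s4 := rfl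
  rw [hexec]
  by_cases h14 : 0 < s4.var 14
  · rw [if_pos h14]
    exact Or.inl ⟨hb'.1 h14, e6, e7⟩
  · rw [if_neg h14]
    have hnb : ¬ P.Blocked (s.arr 6) (s.arr 7) := fun h => h14 (hb'.2 h)
    by_cases h11 : 0 < s4.var 11
    · rw [if_pos h11]
      rw [z11] at h11
      obtain ⟨g1, g2, g3, g4, g5⟩ := hf h11
      refine Or.inr (Or.inl ⟨hnb, s4.var 12, s4.var 13, ?_, ?_, e7⟩)
      · rw [z12, z13]
        exact ⟨g1, g2, (hel' _ (hσ _ g1).1).1 g3, g4, g5⟩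
      · simp [State.setCell, e6]
    · rw [if_neg h11]
      rw [z11] at h11
      refine Or.inr (Or.inr ⟨hnb, ?_, (exec_arr rfl s4).trans e6, ?_⟩)
      · rintro j v ⟨g1, g2, g3, g4, g5⟩
        exact hnf h11 j g1 v g2 ⟨(hel' _ (hσ _ g1).1).2 g3, g4, g5⟩
      · rw [raiseCmd_spec, z0, e9, e7]
        funext v
        have : (v < P.M ∧ 0 < s2.arr 9 v) ↔ (v < P.M ∧ P.Elig (s.arr 6) (s.arr 7) v) :=
          and_congr_right fun hv => hel' v hv
        simp only [this]

end RAM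

/-! ### Running the local search to its end -/

namespace RAM

open Cmd Exp

/-- For bodies that do not care about the loop counter. Applied three times, it turns the nested
loops into `M * M * (N + 1)` steps of the search. -/
theorem Cmd.rep_count {x b : ℕ} {p : Cmd} (h : (rep x b p).ok = true) {s : State}
    (Q : ℕ → State → Prop) (hset : ∀ k t c, Q k t → Q k (t.setVar x c)) {c n k : ℕ}
    (hp : ∀ k t, Q k t → Q (k + c) (p.exec t)) (hn : s.var b = n) (hQ : Q k s) :
    Q (k + n * c) ((rep x b p).exec s) := by
  subst hn
  refine rep_inv h (fun i t => Q (k + i * c) t) (by simpa using hset k s 0 hQ) ?_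
  intro i _ t _ _ _ hI
  have := hset _ _ (i + 1) (hp _ _ hI)
  rwa [add_assoc, ← Nat.succ_mul] at this

/-- Set variable `20` if some machine has to give a job away. -/
def failCmd : Cmd :=
  .seq (.set 20 (const 0)) (.rep 8 0 (when (const 0) (get 9 (var 8)) (.set 20 (const 1))))

theorem failCmd_spec (s : State) :
    0 < (failCmd.exec s).var 20 ↔ ∃ v < s.var 0, 0 < s.arr 9 v := by
  have key := rep_inv (x := 8) (b := 0) (p := when (const 0) (get 9 (var 8)) (.set 20 (const 1)))
    rfl (s := (Cmd.set 20 (const 0)).exec s)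
    (fun n t => 0 < t.var 20 ↔ ∃ v < n, 0 < s.arr 9 v)
    (by simp [exec, State.setVar, eval]) ?_
  · exact key
  · intro i hi t ht hva har hI
    have a9 : t.arr 9 = s.arr 9 := har 9 rfl
    rw [Nat.exists_lt_succ_right, ← hI]
    by_cases h1 : 0 < s.arr 9 i <;> simp [exec, eval, State.setVar, ht, a9, h1]

/-- The local search. -/
def localSearchCmd : Cmd :=
  .seq (.rep 8 0 (.put 7 (var 8) (const 0))) <|
  .seq (.rep 17 0 (.rep 18 0 (.rep 19 2 stepCmd))) <|
  -- The loads and flags left by the last step may predate its move, so they are computed afresh.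
  .seq loadCmd <| .seq eligCmd failCmd

/-- The search starts from any valid assignment in array `6` and runs until the potential is
exhausted. An eligible machine in a halted state means that the search is blocked. The loads in
array `8` are reported because the marking reads them. -/
theorem localSearchCmd_spec {s : State} {Q : Net} (E : (netOf s).Equiv Q) {ω : ℕ}
    (hω : ∀ j < Q.N, Q.wt j ≤ ω) (hσ : Q.Valid (s.arr 6)) (h2 : s.var 2 = s.var 1 + 1) :
    ∃ h, Q.Inv ω ((localSearchCmd.exec s).arr 6) h ∧
      (0 < (localSearchCmd.exec s).var 20 → Q.Blocked ((localSearchCmd.exec s).arr 6) h) ∧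
      (¬ 0 < (localSearchCmd.exec s).var 20 →
        ∀ v < Q.M, ¬ Q.Elig ((localSearchCmd.exec s).arr 6) h v) ∧
      ∀ v < Q.M, (localSearchCmd.exec s).arr 8 v = Q.A ((localSearchCmd.exec s).arr 6) v := by
  classical
  set P := netOf s with hP
  have hω' : ∀ j < P.N, P.wt j ≤ ω := fun j hj => by
    rw [E.N] at hj
    rw [E.wt j hj]
    exact hω j hj
  set s1 := (Cmd.rep 8 0 (.put 7 (var 8) (const 0))).exec s with hs1
  have hP1 : netOf s1 = P := netOf_exec rfl s
  have h7 : ∀ v < P.M, s1.arr 7 v = 0 := by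
    intro v hv
    have h1 := exec_rep_table (x := 8) (b := 0) (p := .put 7 (var 8) (const 0)) rfl (s := s)
      (a := 7) (fun _ => 0) (fun i hi t ht hv ha => by simp [exec, State.setCell, eval, ht])
    rw [hs1, h1]
    exact if_pos hv
  have b6 : s1.arr 6 = s.arr 6 := exec_arr rfl s
  have b2 : s1.var 2 = s.var 2 := exec_var rfl s
  set G : ℕ → State → Prop := fun k t => netOf t = P ∧ t.var 2 = P.N + 1 ∧
    P.After ω k (t.arr 6) (t.arr 7) with hG
  have hstep : ∀ k t, G k t → G (k + 1) (stepCmd.exec t) := by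
    rintro k t ⟨g1, g2, g3⟩
    refine ⟨(netOf_exec rfl t).trans g1, (exec_var rfl t).trans g2, ?_⟩
    have := stepCmd_spec t (by rw [g1]; exact g3.1.valid)
    rw [g1] at this
    exact g3.step hω' this
  have hG0 : G 0 s1 := by
    refine ⟨hP1, b2.trans h2, ?_, Or.inr ?_⟩
    · rw [b6]
      exact Net.Inv.init (E.valid.2 hσ) h7
    · have hv1 : ∑ v ∈ range P.M, (s1.arr 7 v : ℤ) = 0 :=
        sum_eq_zero fun v hv => by rw [h7 v (mem_range.1 hv)]; rfl
      have hv2 : ∑ j ∈ range P.N, (s1.arr 7 (s1.arr 6 j) : ℤ) = 0 :=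
        sum_eq_zero fun j hj => by
          rw [b6, h7 _ (E.valid.2 hσ j (mem_range.1 hj)).1]; rfl
      simp [Net.pot, hv1, hv2]
  have var0 : ∀ k t, G k t → t.var 0 = P.M := fun k t ht => by rw [← ht.1]; rfl
  have hG1 : G (0 + P.M * (P.M * ((P.N + 1) * 1)))
      ((Cmd.rep 17 0 (.rep 18 0 (.rep 19 2 stepCmd))).exec s1) := by
    refine rep_count (x := 17) rfl G (fun _ _ _ h => ⟨h.1, h.2.1, h.2.2⟩) (fun k t ht => ?_) (var0 _ _ hG0) hG0
    refine rep_count (x := 18) rfl G (fun _ _ _ h => ⟨h.1, h.2.1, h.2.2⟩) (fun k t ht => ?_) (var0 _ _ ht) ht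
    exact rep_count (x := 19) rfl G (fun _ _ _ h => ⟨h.1, h.2.1, h.2.2⟩) hstep ht.2.1 ht
  set s2 := (Cmd.rep 17 0 (.rep 18 0 (.rep 19 2 stepCmd))).exec s1 with hs2
  obtain ⟨hP2, -, hA⟩ := hG1
  have hcount : 0 + P.M * (P.M * ((P.N + 1) * 1)) = P.M * P.M * (P.N + 1) := by ring
  rw [hcount] at hA
  have hH := hA.halted hω'
  set s3 := loadCmd.exec s2 with hs3
  set s4 := eligCmd.exec s3 with hs4
  have hexec : localSearchCmd.exec s = failCmd.exec s4 := rfl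
  have c6 : s3.arr 6 = s2.arr 6 := exec_arr rfl s2
  have c7 : s3.arr 7 = s2.arr 7 := exec_arr rfl s2
  have hP3 : netOf s3 = P := (netOf_exec rfl s2).trans hP2
  have m2 : s2.var 0 = P.M := by rw [← hP2]; rfl
  have m3 : s3.var 0 = P.M := by rw [← hP3]; rfl
  have m4 : s4.var 0 = P.M := (exec_var rfl s3).trans m3
  have hld := loadCmd_spec s2
  rw [m2, hP2] at hld
  have hel := eligCmd_spec s3 (by rw [m3, hP3, c6]; exact hld)
  rw [m3, hP3, c6, c7] at hel
  have hfail := failCmd_spec s4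
  rw [m4] at hfail
  have d6 : (failCmd.exec s4).arr 6 = s2.arr 6 := (exec_arr rfl s4).trans ((exec_arr rfl s3).trans c6)
  have d8 : (failCmd.exec s4).arr 8 = s3.arr 8 := (exec_arr rfl s4).trans (exec_arr rfl s3)
  have hel' : ∀ v < P.M, (0 < s4.arr 9 v ↔ P.Elig (s2.arr 6) (s2.arr 7) v) := by
    intro v hv
    rw [hel v hv]
    split_ifs with h <;> simp [h]
  have hfail' : 0 < (failCmd.exec s4).var 20 ↔ ∃ v < P.M, P.Elig (s2.arr 6) (s2.arr 7) v :=
    hfail.trans (exists_congr fun v => and_congr_right fun hv => hel' v hv)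
  rw [hexec, d6, d8, hfail']
  refine ⟨s2.arr 7, E.inv hA.1, ?_, ?_, ?_⟩
  · rintro ⟨v, hv, hv'⟩
    rcases hH with hH | hH
    · exact absurd hv' (hH v hv)
    · exact E.blocked.1 hH
  · intro hne v hv hv'
    exact hne ⟨v, E.M ▸ hv, (E.elig hv _ _).2 hv'⟩
  · intro v hv
    rw [← E.A hv, hld v (E.M ▸ hv)]

/-! ## Searching for an assignment for a given guess of the optimum -/

/-- The memory holds the instance. -/
structure Ctx (I : TwoSize) (s : State) : Prop where
  M : s.var 0 = I.M
  N : s.var 1 = I.N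
  N1 : s.var 2 = I.N + 1
  w : s.var 3 = I.w
  W : s.var 4 = I.W
  dl : ∀ v < I.M, s.arr 0 (v + 4) = I.dl v
  hb : ∀ j < I.N, s.arr 0 (s.arr 2 j) = I.hb j
  al : ∀ j < I.N, ∀ v < I.M, 0 < s.arr 0 (s.arr 2 j + v + 1) ↔ I.al j v
  valid : I.Valid (s.arr 6)

theorem Ctx.congr {I : TwoSize} {s t : State} (h : Ctx I s) (hv : ∀ x < 5, t.var x = s.var x)
    (h0 : t.arr 0 = s.arr 0) (h2 : t.arr 2 = s.arr 2) (h6 : I.Valid (t.arr 6)) : Ctx I t where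
  M := (hv 0 (by omega)).trans h.M
  N := (hv 1 (by omega)).trans h.N
  N1 := (hv 2 (by omega)).trans h.N1
  w := (hv 3 (by omega)).trans h.w
  W := (hv 4 (by omega)).trans h.W
  dl := by rw [h0]; exact h.dl
  hb := by rw [h0, h2]; exact h.hb
  al := by rw [h0, h2]; exact h.al
  valid := h6

/-- A command does not change the instance in memory or the guess. -/
def Cmd.keeps (p : Cmd) : Bool :=
  !p.writesVar 0 && !p.writesVar 1 && !p.writesVar 2 && !p.writesVar 3 && !p.writesVar 4 &&
    !p.writesVar 5 && !p.writesArr 0 && !p.writesArr 2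

theorem Ctx.exec {I : TwoSize} {s : State} (h : Ctx I s) {p : Cmd} (hp : p.keeps = true)
    (h6 : I.Valid ((p.exec s).arr 6)) : Ctx I (p.exec s) := by
  simp only [Cmd.keeps, Bool.and_eq_true, Bool.not_eq_true'] at hp
  obtain ⟨⟨⟨⟨⟨⟨⟨h0, h1⟩, h2⟩, h3⟩, h4⟩, h5⟩, h7⟩, h8⟩ := hp
  refine h.congr (fun x hx => ?_) (exec_arr h7 s) (exec_arr h8 s) h6
  interval_cases x
  · exact exec_var h0 s
  · exact exec_var h1 s
  · exact exec_var h2 s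
  · exact exec_var h3 s
  · exact exec_var h4 s

theorem Ctx.exec' {I : TwoSize} {s : State} (h : Ctx I s) {p : Cmd} (hp : p.keeps = true)
    (h6 : p.writesArr 6 = false) : Ctx I (p.exec s) :=
  h.exec hp (by rw [exec_arr h6]; exact h.valid)

theorem Ctx.loop {I : TwoSize} {s t : State} (h : Ctx I s) {x b : ℕ} {p : Cmd}
    (hv : ∀ y, (rep x b p).writesVar y = false → t.var y = s.var y)
    (ha : ∀ c, p.writesArr c = false → t.arr c = s.arr c)
    (hp : (rep x b p).keeps = true) (h6 : p.writesArr 6 = false) : Ctx I t := by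
  simp only [Cmd.keeps, Bool.and_eq_true, Bool.not_eq_true'] at hp
  obtain ⟨⟨⟨⟨⟨⟨⟨h0, h1⟩, h2⟩, h3⟩, h4⟩, h5⟩, h7⟩, h8⟩ := hp
  refine h.congr (fun x hx => ?_) (ha 0 h7) (ha 2 h8) (by rw [ha 6 h6]; exact h.valid)
  interval_cases x
  · exact hv 0 h0
  · exact hv 1 h1
  · exact hv 2 h2
  · exact hv 3 h3
  · exact hv 4 h4

/-- Set up the search for an assignment of all jobs. -/
def setupJobsCmd : Cmd :=
  .seq (.rep 8 0 (.seq (.put 3 (var 8) (dlExp 8)) (.put 5 (var 8) (var 0)))) <|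
  .seq (.rep 10 1 (.ite (const 0) (heavyExp 10) (.put 4 (var 10) (var 4))
    (.put 4 (var 10) (var 3)))) (.set 6 (add (var 5) (half (var 5))))

theorem setupJobsCmd_spec {I : TwoSize} {s : State} (h : Ctx I s) :
    (netOf (setupJobsCmd.exec s)).Equiv (I.jobNet (s.var 5)) := by
  set p1 : Cmd := .rep 8 0 (.seq (.put 3 (var 8) (dlExp 8)) (.put 5 (var 8) (var 0))) with hp1
  set p2 : Cmd := .rep 10 1 (.ite (const 0) (heavyExp 10) (.put 4 (var 10) (var 4))
    (.put 4 (var 10) (var 3))) with hp2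
  have h1 : Ctx I (p1.exec s) := h.exec' rfl rfl
  have h2 : Ctx I (p2.exec (p1.exec s)) := h1.exec' rfl rfl
  have e3 := exec_rep_table (x := 8) (b := 0) (p := .seq (.put 3 (var 8) (dlExp 8))
    (.put 5 (var 8) (var 0))) rfl (s := s) (a := 3) I.dl (fun i hi t ht hv ha => by
      have := h.dl i (h.M ▸ hi)
      simp [exec, State.setCell, eval, ht, ha 0 rfl, this])
  have e5 := exec_rep_table (x := 8) (b := 0) (p := .seq (.put 3 (var 8) (dlExp 8))
    (.put 5 (var 8) (var 0))) rfl (s := s) (a := 5) (fun _ => I.M) (fun i hi t ht hv ha => by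
      simp [exec, State.setCell, eval, ht, hv 0 rfl, h.M])
  have e4 := exec_rep_table (x := 10) (b := 1) (p := .ite (const 0) (heavyExp 10)
    (.put 4 (var 10) (var 4)) (.put 4 (var 10) (var 3))) rfl (s := p1.exec s) (a := 4) I.jw
    (fun i hi t ht hv ha => by
      have := h1.hb i (h1.N ▸ hi)
      simp only [exec, eval, ht, ha 0 rfl, ha 2 rfl, this, TwoSize.jw]
      split_ifs <;> simp [State.setCell, hv 4 rfl, hv 3 rfl, h1.W, h1.w])
  constructor
  · exact h2.M
  · exact h2.N
  · exact h2.W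
  · change (p2.exec (p1.exec s)).var 5 + (p2.exec (p1.exec s)).var 5 / 2 = _
    rw [exec_var (p := p2) rfl, exec_var (p := p1) rfl]
    rfl
  · intro v hv
    change (p2.exec (p1.exec s)).arr 3 v = _
    rw [exec_arr (p := p2) rfl, e3]
    exact if_pos (h.M ▸ hv)
  · intro j hj
    change (p2.exec (p1.exec s)).arr 4 j = _
    rw [e4]
    exact if_pos (h1.N ▸ hj)
  · intro v hv
    change (p2.exec (p1.exec s)).arr 5 v = _
    rw [exec_arr (p := p2) rfl, e5]
    exact if_pos (h.M ▸ hv)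
  · exact h2.al

/-- Set up the search for an assignment of the heavy jobs. -/
def setupHeavyCmd : Cmd :=
  .seq (.rep 8 0 (.seq (.ite (var 5) (add (dlExp 8) (var 4)) (.put 3 (var 8) (const 1))
    (.put 3 (var 8) (const 0))) (.put 5 (var 8) (var 0)))) <|
  .seq (.rep 10 1 (.put 4 (var 10) (heavyExp 10))) (.set 6 (const 1))

theorem setupHeavyCmd_spec {I : TwoSize} {s : State} (h : Ctx I s) :
    (netOf (setupHeavyCmd.exec s)).Equiv (I.heavyNet (s.var 5)) := by
  set q1 : Cmd := .seq (.ite (var 5) (add (dlExp 8) (var 4)) (.put 3 (var 8) (const 1))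
    (.put 3 (var 8) (const 0))) (.put 5 (var 8) (var 0)) with hq1
  set p1 : Cmd := .rep 8 0 q1 with hp1
  set p2 : Cmd := .rep 10 1 (.put 4 (var 10) (heavyExp 10)) with hp2
  have h1 : Ctx I (p1.exec s) := h.exec' rfl rfl
  have h2 : Ctx I (p2.exec (p1.exec s)) := h1.exec' rfl rfl
  have e3 := exec_rep_table (x := 8) (b := 0) (p := q1) rfl (s := s) (a := 3)
    (I.heavyNet (s.var 5)).D (fun i hi t ht hv ha => by
      have := h.dl i (h.M ▸ hi)
      simp only [hq1, exec, eval, ht, ha 0 rfl, this, hv 5 rfl, hv 4 rfl, h.W, TwoSize.heavyNet]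
      split_ifs <;> simp [State.setCell])
  have e5 := exec_rep_table (x := 8) (b := 0) (p := q1) rfl (s := s) (a := 5) (fun _ => I.M)
    (fun i hi t ht hv ha => by
      by_cases hc : t.var 5 < t.arr 0 (i + 4) + t.var 4 <;>
      simp [hq1, exec, eval, State.setCell, ht, hc, hv 0 rfl, h.M])
  have e4 := exec_rep_table (x := 10) (b := 1) (p := .put 4 (var 10) (heavyExp 10)) rfl
    (s := p1.exec s) (a := 4) I.hb
    (fun i hi t ht hv ha => by
      have := h1.hb i (h1.N ▸ hi)
      simp only [exec, eval, ht, ha 0 rfl, ha 2 rfl, this, State.setCell, Function.update_self])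
  constructor
  · exact h2.M
  · exact h2.N
  · exact h2.W
  · rfl
  · intro v hv
    change (p2.exec (p1.exec s)).arr 3 v = _
    rw [exec_arr (p := p2) rfl, e3]
    exact if_pos (h.M ▸ hv)
  · intro j hj
    change (p2.exec (p1.exec s)).arr 4 j = _
    rw [e4]
    exact if_pos (h1.N ▸ hj)
  · intro v hv
    change (p2.exec (p1.exec s)).arr 5 v = _
    rw [exec_arr (p := p2) rfl, e5]
    exact if_pos (h.M ▸ hv)
  · exact h2.al

end RAM

/-! ### Parents, roots, groups and marks in memory -/

namespace RAM

open Cmd Exp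

/-- Redirect the parent of the machine with the heavy job in variable `10`. -/
def parentOneCmd : Cmd :=
  when (const 0) (heavyExp 10) <| .seq (.put 12 (get 10 (var 10)) (const 0)) <|
    .rep 8 0 <| when (const 0) (allowedExp 10 8) <|
      .ite (var 8) (get 10 (var 10)) (.put 11 (get 10 (var 10)) (var 8)) <|
      when (get 10 (var 10)) (var 8) (.put 11 (get 10 (var 10)) (var 8))

/-- Save the heavy assignment, compute the parents and find the machines without heavy job. -/
def parentCmd : Cmd :=
  .seq (.rep 10 1 (.put 10 (var 10) (get 6 (var 10)))) <|
  .seq (.rep 8 0 (.seq (.put 11 (var 8) (var 8)) (.put 12 (var 8) (const 1)))) <|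
  .rep 10 1 parentOneCmd

/-- If the heavy job has a single machine, then `z` is this machine, a fixed point that is not free.
Otherwise `z` is the other machine, unique by `two`. -/
theorem parentOneCmd_spec {I : TwoSize} {s : State} (h : Ctx I s) {j : ℕ} (hs : s.var 10 = j)
    (hj : j < I.N) (hv : s.arr 10 j < I.M) (ha : I.al j (s.arr 10 j)) :
    (I.hb j = 0 → (parentOneCmd.exec s).arr 11 = s.arr 11 ∧
      (parentOneCmd.exec s).arr 12 = s.arr 12) ∧
    (0 < I.hb j → s.arr 11 (s.arr 10 j) = s.arr 10 j →
      (parentOneCmd.exec s).arr 12 = Function.update (s.arr 12) (s.arr 10 j) 0 ∧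
      ∃ z < I.M, (parentOneCmd.exec s).arr 11 = Function.update (s.arr 11) (s.arr 10 j) z ∧
        I.al j z ∧ ∀ u < I.M, I.al j u → u = s.arr 10 j ∨ u = z) := by
  have hbj := h.hb j hj
  unfold parentOneCmd
  rw [exec_when]
  simp only [eval, hs, hbj]
  refine ⟨fun h0 => by simp [h0], fun h0 hself => ?_⟩
  rw [if_pos h0]
  set s1 := (Cmd.put 12 (get 10 (var 10)) (const 0)).exec s with hs1
  have h1 : Ctx I s1 := h.exec' rfl rfl
  set q : Cmd := when (const 0) (allowedExp 10 8) <|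
      .ite (var 8) (get 10 (var 10)) (.put 11 (get 10 (var 10)) (var 8)) <|
      when (get 10 (var 10)) (var 8) (.put 11 (get 10 (var 10)) (var 8)) with hq
  have b12 : s1.arr 12 = Function.update (s.arr 12) (s.arr 10 j) 0 := by
    simp [hs1, exec, State.setCell, eval, hs]
  have key := rep_inv (x := 8) (b := 0) (p := q) rfl (s := s1)
    (fun n t => ∃ z < I.M, t.arr 11 = Function.update (s.arr 11) (s.arr 10 j) z ∧
      I.al j z ∧ (z = s.arr 10 j → ∀ u < n, I.al j u → u = s.arr 10 j))
    ⟨s.arr 10 j, hv, by rw [Function.update_eq_self_iff.2 hself.symm]; rfl, ha,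
      fun _ u hu => by omega⟩ ?_
  · refine ⟨(exec_arr (p := rep 8 0 q) rfl s1).trans b12, ?_⟩
    obtain ⟨z, hz, hz1, hz2, hz3⟩ := key
    rw [h1.M] at hz3
    refine ⟨z, hz, hz1, hz2, fun u hu hau => ?_⟩
    by_cases hzv : z = s.arr 10 j
    · exact Or.inl (hz3 hzv u hu hau)
    · rcases I.two j hj h0 z (s.arr 10 j) u hz hv hu hz2 ha hau with h3 | h3 | h3
      · exact absurd h3 hzv
      · exact Or.inr h3.symm
      · exact Or.inl h3.symm
  · rintro i hi t ht hva har ⟨z, hz, hz1, hz2, hz3⟩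
    have hc : Ctx I t := h1.loop hva har rfl rfl
    have t10 : t.var 10 = j := (hva 10 rfl).trans hs
    have c10 : t.arr 10 = s.arr 10 := har 10 rfl
    have hi' : i < I.M := h1.M ▸ hi
    have hal := hc.al j hj i hi'
    by_cases hai : I.al j i
    · have hpos := hal.2 hai
      rcases lt_trichotomy i (s.arr 10 j) with h3 | h3 | h3
      · refine ⟨i, hi', ?_, hai, fun h => by omega⟩
        simp [hq, exec, eval, State.setCell, State.setVar, t10, ht, c10, hpos, h3, hz1]
      · refine ⟨z, hz, ?_, hz2, fun h u hu hau => ?_⟩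
        · simp [hq, exec, eval, State.setVar, t10, ht, c10, h3, hz1]
        · rcases Nat.lt_succ_iff_lt_or_eq.1 hu with h4 | h4
          · exact hz3 h u h4 hau
          · exact h4.trans h3
      · refine ⟨i, hi', ?_, hai, fun h => by omega⟩
        simp [hq, exec, eval, State.setCell, State.setVar, t10, ht, c10, hpos, h3, hz1]
    · have hpos : ¬ 0 < t.arr 0 (t.arr 2 j + i + 1) := fun h => hai (hal.1 h)
      refine ⟨z, hz, ?_, hz2, fun h u hu hau => ?_⟩
      · simp only [hq, exec_when, eval, t10, ht, hpos, if_false]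
        exact hz1
      · rcases Nat.lt_succ_iff_lt_or_eq.1 hu with h4 | h4
        · exact hz3 h u h4 hau
        · exact absurd (h4 ▸ hau) hai

/-- Heavy jobs lie on different machines, so no parent is redirected twice, and it is still the
initial self-loop when its job is treated, as `parentOneCmd_spec` requires. -/
theorem parentCmd_spec {I : TwoSize} {s : State} (h : Ctx I s) {T : ℕ}
    (hcap : ∀ v < I.M, (I.heavyNet T).A (s.arr 6) v ≤ 1) :
    I.Forest T ((parentCmd.exec s).arr 10) ((parentCmd.exec s).arr 11) ∧
    ∀ v < I.M, (0 < (parentCmd.exec s).arr 12 v ↔ I.Free ((parentCmd.exec s).arr 10) v) := by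
  set p1 : Cmd := .rep 10 1 (.put 10 (var 10) (get 6 (var 10))) with hp1
  set p2 : Cmd := .rep 8 0 (.seq (.put 11 (var 8) (var 8)) (.put 12 (var 8) (const 1))) with hp2
  set s1 := p1.exec s with hs1
  set s2 := p2.exec s1 with hs2
  have hexec : parentCmd.exec s = (rep 10 1 parentOneCmd).exec s2 := rfl
  have h1 : Ctx I s1 := h.exec' rfl rfl
  have h2 : Ctx I s2 := h1.exec' rfl rfl
  have e10 := exec_rep_table (x := 10) (b := 1) (p := .put 10 (var 10) (get 6 (var 10))) rfl
    (s := s) (a := 10) (s.arr 6)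
    (fun i hi t ht hv ha => by simp [exec, State.setCell, eval, ht, ha 6 rfl])
  have e11 := exec_rep_table (x := 8) (b := 0)
    (p := .seq (.put 11 (var 8) (var 8)) (.put 12 (var 8) (const 1))) rfl
    (s := s1) (a := 11) id (fun i hi t ht hv ha => by simp [exec, State.setCell, eval, ht])
  have e12 := exec_rep_table (x := 8) (b := 0)
    (p := .seq (.put 11 (var 8) (var 8)) (.put 12 (var 8) (const 1))) rfl
    (s := s1) (a := 12) (fun _ => 1) (fun i hi t ht hv ha => by simp [exec, State.setCell, eval, ht])
  set σ := s2.arr 10 with hσ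
  have hσ' : ∀ j < I.N, σ j = s.arr 6 j := by
    intro j hj
    rw [hσ, hs2, exec_arr (p := p2) rfl, hs1, e10]
    exact if_pos (h.N ▸ hj)
  have hval : I.Valid σ := fun j hj => by rw [hσ' j hj]; exact h.valid j hj
  have hAσ : ∀ v < I.M, (I.heavyNet T).A σ v ≤ 1 := by
    intro v hv
    have : (I.heavyNet T).A σ v = (I.heavyNet T).A (s.arr 6) v := by
      unfold Net.A jobLoad
      refine congrArg _ (sum_congr rfl fun j hj => ?_)
      rw [hσ' j (mem_range.1 hj)]
    rw [this]
    exact hcap v hv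
  have hinj : ∀ i < I.N, ∀ j < I.N, 0 < I.hb i → 0 < I.hb j → σ i = σ j → i = j := by
    intro i hi j hj hhi hhj hij
    refine TwoSize.eq_of_hc_le_one hi hj hhi hhj hij ?_
    have := hAσ _ (hval j hj).1
    change _ + I.hc σ (σ j) ≤ 1 at this
    omega
  have f10 : ((rep 10 1 parentOneCmd).exec s2).arr 10 = σ := exec_arr rfl s2
  have key := rep_inv (x := 10) (b := 1) (p := parentOneCmd) rfl (s := s2)
    (fun n t => (∀ v < I.M, (0 < t.arr 12 v ↔ ∀ j < n, 0 < I.hb j → σ j ≠ v)) ∧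
      (∀ v < I.M, t.arr 11 v < I.M) ∧
      (∀ v < I.M, (∀ j < n, 0 < I.hb j → σ j ≠ v) → t.arr 11 v = v) ∧
      (∀ j < n, 0 < I.hb j → I.al j (t.arr 11 (σ j)) ∧
        ∀ u < I.M, I.al j u → u = σ j ∨ u = t.arr 11 (σ j))) ?_ ?_
  · rw [h2.N] at key
    obtain ⟨k1, k2, k3, k4⟩ := key
    rw [hexec, f10]
    exact ⟨⟨hval, hAσ, k2, k3, fun j hj hh => (k4 j hj hh).1,
      fun j hj hh => (k4 j hj hh).2⟩, k1⟩
  · have k12 : ∀ v < I.M, s2.arr 12 v = 1 := by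
      intro v hv
      rw [hs2, e12]
      exact if_pos (h1.M ▸ hv)
    have k11 : ∀ v < I.M, s2.arr 11 v = v := by
      intro v hv
      rw [hs2, e11]
      exact if_pos (h1.M ▸ hv)
    refine ⟨fun v hv => ?_, fun v hv => ?_, fun v hv _ => ?_, fun j hj => by omega⟩
    · simp [State.setVar, k12 v hv]
    · simp [State.setVar, k11 v hv, hv]
    · simp [State.setVar, k11 v hv]
  · rintro i hi t ht hva har ⟨k1, k2, k3, k4⟩
    have hc : Ctx I t := h2.loop hva har rfl rfl
    have hi' : i < I.N := h2.N ▸ hi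
    have t10 : t.arr 10 = σ := har 10 rfl
    obtain ⟨m1, m2⟩ := parentOneCmd_spec hc ht hi' (by rw [t10]; exact (hval i hi').1)
      (by rw [t10]; exact (hval i hi').2)
    rw [t10] at m2
    change (∀ v < I.M, (0 < (parentOneCmd.exec t).arr 12 v ↔ _)) ∧
      (∀ v < I.M, (parentOneCmd.exec t).arr 11 v < I.M) ∧
      (∀ v < I.M, _ → (parentOneCmd.exec t).arr 11 v = v) ∧
      (∀ j < i + 1, 0 < I.hb j → I.al j ((parentOneCmd.exec t).arr 11 (σ j)) ∧
        ∀ u < I.M, I.al j u → u = σ j ∨ u = (parentOneCmd.exec t).arr 11 (σ j))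
    by_cases h0 : 0 < I.hb i
    · have hne : ∀ j < i, 0 < I.hb j → σ j ≠ σ i := by
        intro j hj hhj hji
        have := hinj j (by omega) i hi' hhj h0 hji
        omega
      obtain ⟨m3, z, hz, m4, m5, m6⟩ := m2 h0 (k3 _ (hval i hi').1 hne)
      rw [m3, m4]
      refine ⟨fun v hv => ?_, fun v hv => ?_, fun v hv hf => ?_, fun j hj hh => ?_⟩
      · rw [Nat.forall_lt_succ_right]
        by_cases hvi : v = σ i
        · subst hvi
          simp [h0]
        · rw [Function.update_of_ne hvi, k1 v hv]
          exact ⟨fun h => ⟨h, fun _ => Ne.symm hvi⟩, fun h => h.1⟩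
      · by_cases hvi : v = σ i
        · subst hvi; simpa using hz
        · rw [Function.update_of_ne hvi]; exact k2 v hv
      · have hvi : v ≠ σ i := (hf i (by omega) h0).symm
        rw [Function.update_of_ne hvi]
        exact k3 v hv fun j hj => hf j (by omega)
      · rcases Nat.lt_succ_iff_lt_or_eq.1 hj with h4 | rfl
        · rw [Function.update_of_ne (hne j h4 hh)]
          exact k4 j h4 hh
        · simp only [Function.update_self]
          exact ⟨m5, m6⟩
    · obtain ⟨m3, m4⟩ := m1 (by omega)
      rw [m3, m4]
      refine ⟨fun v hv => ?_, k2, fun v hv hf => ?_, fun j hj hh => ?_⟩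
      · rw [Nat.forall_lt_succ_right, k1 v hv]
        exact ⟨fun h => ⟨h, fun h' => absurd h' h0⟩, fun h => h.1⟩
      · exact k3 v hv fun j hj => hf j (by omega)
      · rcases Nat.lt_succ_iff_lt_or_eq.1 hj with h4 | rfl
        · exact k4 j h4 hh
        · exact absurd hh h0

/-- Follow the parents from the machine in variable `8`. -/
def rootCmd : Cmd :=
  .rep 8 0 <| .seq (.set 9 (var 8)) <| .seq (.rep 17 0 (.set 9 (get 11 (var 9)))) <|
    .put 13 (var 8) (var 9)

theorem iterate_loop (s : State) :
    ((Cmd.rep 17 0 (.set 9 (get 11 (var 9)))).exec s).var 9 = (s.arr 11)^[s.var 0] (s.var 9) := by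
  refine rep_inv (x := 17) (b := 0) (p := .set 9 (get 11 (var 9))) rfl (s := s)
    (fun n t => t.var 9 = (s.arr 11)^[n] (s.var 9)) rfl ?_
  intro i hi t ht hva har hI
  rw [Function.iterate_succ_apply', ← hI]
  simp [exec, State.setVar, eval, har 11 rfl]

theorem rootCmd_spec (s : State) : (rootCmd.exec s).arr 13 =
    fun v => if v < s.var 0 then (s.arr 11)^[s.var 0] v else s.arr 13 v := by
  refine exec_rep_table rfl _ fun i hi t ht hva har => ?_
  have h1 := iterate_loop ((Cmd.set 9 (var 8)).exec t)
  have t11 : t.arr 11 = s.arr 11 := har 11 rfl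
  have t0 : t.var 0 = s.var 0 := hva 0 rfl
  have e1 : ((Cmd.set 9 (var 8)).exec t).arr 11 = s.arr 11 := t11
  have e2 : ((Cmd.set 9 (var 8)).exec t).var 0 = s.var 0 := t0
  have e3 : ((Cmd.set 9 (var 8)).exec t).var 9 = i := by simp [exec, State.setVar, eval, ht]
  rw [e1, e2, e3] at h1
  set u := (Cmd.rep 17 0 (.set 9 (get 11 (var 9)))).exec ((Cmd.set 9 (var 8)).exec t) with hu
  have u8 : u.var 8 = i := (exec_var rfl _).trans ht
  have u13 : u.arr 13 = t.arr 13 := (exec_arr rfl _).trans rfl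
  change (u.setCell 13 (u.var 8) (u.var 9)).arr 13 = _
  rw [u8, h1, ← u13]
  simp [State.setCell]

/-- Compute the group and the base load of the machine in variable `8`. -/
def baseOneCmd : Cmd :=
  -- Defaults for an ungrouped machine with a heavy job; the tests below overwrite them in the other
  -- cases.
  .seq (.put 5 (var 8) (var 0)) <| .seq (.put 3 (var 8) (add (dlExp 8) (var 4))) <|
  .seq (when (const 0) (get 12 (var 8)) (.put 3 (var 8) (dlExp 8))) <|
  when (const 0) (get 12 (get 13 (var 8))) <|
    .ite (var 5) (add (get 0 (add (get 13 (var 8)) (const 4))) (var 4)) .skip <|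
    .seq (.put 5 (var 8) (get 13 (var 8))) (.put 3 (var 8) (dlExp 8))

/-- Set up the search for an assignment of the light jobs. -/
def setupLightCmd : Cmd :=
  .seq (.rep 8 0 baseOneCmd) <|
  .seq (.rep 10 1 (.ite (const 0) (heavyExp 10) (.put 4 (var 10) (const 0))
    (.put 4 (var 10) (var 3)))) (.set 6 (add (var 5) (half (var 5))))

theorem setupLightCmd_spec {I : TwoSize} {s : State} (h : Ctx I s)
    (F : I.Forest (s.var 5) (s.arr 10) (s.arr 11))
    (hF : ∀ v < I.M, (0 < s.arr 12 v ↔ I.Free (s.arr 10) v))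
    (hR : ∀ v < I.M, s.arr 13 v = (s.arr 11)^[I.M] v) :
    (netOf (setupLightCmd.exec s)).Equiv (I.lightNet (s.var 5)
      (I.baseOf (s.var 5) (s.arr 10) (s.arr 11)) (I.grpOf (s.var 5) (s.arr 10) (s.arr 11))) := by
  classical
  set p1 : Cmd := .rep 8 0 baseOneCmd with hp1
  set p2 : Cmd := .rep 10 1 (.ite (const 0) (heavyExp 10) (.put 4 (var 10) (const 0))
    (.put 4 (var 10) (var 3))) with hp2
  have h1 : Ctx I (p1.exec s) := h.exec' rfl rfl
  have h2 : Ctx I (p2.exec (p1.exec s)) := h1.exec' rfl rfl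
  have hone : ∀ i < s.var 0, ∀ t : State, t.var 8 = i →
      (∀ y, (rep 8 0 baseOneCmd).writesVar y = false → t.var y = s.var y) →
      (∀ c, baseOneCmd.writesArr c = false → t.arr c = s.arr c) →
      (baseOneCmd.exec t).arr 3 = Function.update (t.arr 3) i
        (I.baseOf (s.var 5) (s.arr 10) (s.arr 11) i) ∧
      (baseOneCmd.exec t).arr 5 = Function.update (t.arr 5) i
        (I.grpOf (s.var 5) (s.arr 10) (s.arr 11) i) := by
    intro i hi t ht hv ha
    have hi' : i < I.M := h.M ▸ hi
    have hr := F.iterate_lt hi' I.M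
    have hd := h.dl i hi'
    have hd' := h.dl _ hr
    have hf1 := hF i hi'
    have hf2 := hF _ hr
    rw [← hR i hi'] at hd' hf2
    have hg : I.Grouped (s.var 5) (s.arr 10) (s.arr 11) i ↔ 0 < s.arr 12 (s.arr 13 i) ∧
        ¬ s.var 5 < I.dl (s.arr 13 i) + I.W := by
      rw [hf2, hR i hi']; rfl
    unfold TwoSize.baseOf TwoSize.grpOf
    rw [← hR i hi']
    simp only [hg, ← hf1]
    have a0 : t.arr 0 = s.arr 0 := ha 0 rfl
    have a12 : t.arr 12 = s.arr 12 := ha 12 rfl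
    have a13 : t.arr 13 = s.arr 13 := ha 13 rfl
    have v0 : t.var 0 = I.M := (hv 0 rfl).trans h.M
    have v4 : t.var 4 = I.W := (hv 4 rfl).trans h.W
    have v5 : t.var 5 = s.var 5 := hv 5 rfl
    by_cases c1 : 0 < s.arr 12 i <;> by_cases c2 : 0 < s.arr 12 (s.arr 13 i) <;>
    by_cases c3 : s.var 5 < I.dl (s.arr 13 i) + I.W <;>
    simp [baseOneCmd, exec, eval, State.setCell, ht, a0, a12, a13, v0, v4, v5, hd, hd', c1, c2, c3]
  have e3 := exec_rep_table (x := 8) (b := 0) (p := baseOneCmd) rfl (s := s) (a := 3) _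
    (fun i hi t ht hv ha => (hone i hi t ht hv ha).1)
  have e5 := exec_rep_table (x := 8) (b := 0) (p := baseOneCmd) rfl (s := s) (a := 5) _
    (fun i hi t ht hv ha => (hone i hi t ht hv ha).2)
  have e4 := exec_rep_table (x := 10) (b := 1) (p := .ite (const 0) (heavyExp 10)
    (.put 4 (var 10) (const 0)) (.put 4 (var 10) (var 3))) rfl (s := p1.exec s) (a := 4) I.lw
    (fun i hi t ht hv ha => by
      have := h1.hb i (h1.N ▸ hi)
      simp only [exec, eval, ht, ha 0 rfl, ha 2 rfl, this, TwoSize.lw]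
      split_ifs <;> simp [State.setCell, hv 3 rfl, h1.w])
  constructor
  · exact h2.M
  · exact h2.N
  · exact h2.W
  · change (p2.exec (p1.exec s)).var 5 + (p2.exec (p1.exec s)).var 5 / 2 = _
    rw [exec_var (p := p2) rfl, exec_var (p := p1) rfl]
    rfl
  · intro v hv
    change (p2.exec (p1.exec s)).arr 3 v = _
    rw [exec_arr (p := p2) rfl, e3]
    exact if_pos (h.M ▸ hv)
  · intro j hj
    change (p2.exec (p1.exec s)).arr 4 j = _
    rw [e4]
    exact if_pos (h1.N ▸ hj)
  · intro v hv
    change (p2.exec (p1.exec s)).arr 5 v = _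
    rw [exec_arr (p := p2) rfl, e5]
    exact if_pos (h.M ▸ hv)
  · exact h2.al

/-- Mark the machines reached from hot machines of groups. -/
def markCmd : Cmd :=
  .seq (.rep 8 0 (.put 14 (var 8) (const 0))) <|
  .rep 8 0 <| when (get 5 (var 8)) (var 0) <| when (var 6) (add (get 8 (var 8)) (var 4)) <|
    .seq (.set 9 (var 8)) <|
    .rep 17 0 (.seq (.put 14 (var 9) (const 1)) (.set 9 (get 11 (var 9))))

theorem mark_loop (s : State) (u : ℕ) :
    0 < ((Cmd.rep 17 0 (.seq (.put 14 (var 9) (const 1)) (.set 9 (get 11 (var 9))))).exec s).arr 14 u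
      ↔ 0 < s.arr 14 u ∨ ∃ i < s.var 0, (s.arr 11)^[i] (s.var 9) = u := by
  have key := rep_inv (x := 17) (b := 0)
    (p := .seq (.put 14 (var 9) (const 1)) (.set 9 (get 11 (var 9)))) rfl (s := s)
    (fun n t => t.var 9 = (s.arr 11)^[n] (s.var 9) ∧
      (0 < t.arr 14 u ↔ 0 < s.arr 14 u ∨ ∃ i < n, (s.arr 11)^[i] (s.var 9) = u))
    ⟨rfl, by simp [State.setVar]⟩ ?_
  · exact key.2
  · rintro i hi t ht hva har ⟨hI1, hI2⟩
    constructor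
    · rw [Function.iterate_succ_apply', ← hI1]
      simp [exec, State.setVar, State.setCell, eval, har 11 rfl]
    · rw [Nat.exists_lt_succ_right, ← or_assoc, ← hI2, ← hI1]
      by_cases hu : u = t.var 9
      · simp [exec, State.setVar, State.setCell, eval, hu]
      · simp [exec, State.setVar, State.setCell, eval, hu, Ne.symm hu]

theorem markCmd_spec (s : State) {u : ℕ} (hu : u < s.var 0) : 0 < (markCmd.exec s).arr 14 u ↔
    ∃ v < s.var 0, s.arr 5 v < s.var 0 ∧ s.var 6 < s.arr 8 v + s.var 4 ∧
      ∃ i < s.var 0, (s.arr 11)^[i] v = u := by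
  set s1 := (Cmd.rep 8 0 (.put 14 (var 8) (const 0))).exec s with hs1
  have e14 := exec_rep_table (x := 8) (b := 0) (p := .put 14 (var 8) (const 0)) rfl (s := s)
    (a := 14) (fun _ => 0) (fun i hi t ht hv ha => by simp [exec, State.setCell, eval, ht])
  have v0 : s1.var 0 = s.var 0 := exec_var rfl s
  have v4 : s1.var 4 = s.var 4 := exec_var rfl s
  have v6 : s1.var 6 = s.var 6 := exec_var rfl s
  have a5 : s1.arr 5 = s.arr 5 := exec_arr rfl s
  have a8 : s1.arr 8 = s.arr 8 := exec_arr rfl s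
  have a11 : s1.arr 11 = s.arr 11 := exec_arr rfl s
  have key := rep_inv (x := 8) (b := 0) (p := when (get 5 (var 8)) (var 0) <|
    when (var 6) (add (get 8 (var 8)) (var 4)) <| .seq (.set 9 (var 8)) <|
    .rep 17 0 (.seq (.put 14 (var 9) (const 1)) (.set 9 (get 11 (var 9))))) rfl (s := s1)
    (fun n t => 0 < t.arr 14 u ↔ ∃ v < n, s.arr 5 v < s.var 0 ∧ s.var 6 < s.arr 8 v + s.var 4 ∧
      ∃ i < s.var 0, (s.arr 11)^[i] v = u) (by simp [State.setVar, hs1, e14, hu]) ?_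
  · rw [v0] at key
    exact key
  · intro i hi t ht hva har hI
    have w0 : t.var 0 = s.var 0 := (hva 0 rfl).trans v0
    have w4 : t.var 4 = s.var 4 := (hva 4 rfl).trans v4
    have w6 : t.var 6 = s.var 6 := (hva 6 rfl).trans v6
    have b5 : t.arr 5 = s.arr 5 := (har 5 rfl).trans a5
    have b8 : t.arr 8 = s.arr 8 := (har 8 rfl).trans a8
    have b11 : t.arr 11 = s.arr 11 := (har 11 rfl).trans a11
    rw [Nat.exists_lt_succ_right, ← hI, exec_when, exec_when]
    simp only [eval, ht, w0, w4, w6, b5, b8]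
    by_cases c1 : s.arr 5 i < s.var 0
    · by_cases c2 : s.var 6 < s.arr 8 i + s.var 4
      · have := mark_loop ((Cmd.set 9 (var 8)).exec t) u
        have e1 : ((Cmd.set 9 (var 8)).exec t).arr 11 = s.arr 11 := b11
        have e2 : ((Cmd.set 9 (var 8)).exec t).var 0 = s.var 0 := w0
        have e3 : ((Cmd.set 9 (var 8)).exec t).var 9 = i := by
          simp [exec, State.setVar, eval, ht]
        have e4 : ((Cmd.set 9 (var 8)).exec t).arr 14 = t.arr 14 := rfl
        rw [e1, e2, e3, e4] at this
        simp only [c1, c2, if_true, true_and]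
        exact this
      · simp only [c1, c2, if_true, if_false, false_and, and_false, or_false]
        rfl
    · simp only [c1, if_false, false_and, or_false]
      rfl

/-- Write the assignment of all jobs to array `1` and record the guess. -/
def recordJobsCmd : Cmd :=
  .seq (.rep 10 1 (.put 1 (var 10) (get 6 (var 10)))) (.set 7 (add (var 5) (const 1)))

/-- Write the combined assignment of heavy and light jobs to array `1` and record the guess. -/
def recordMixedCmd : Cmd :=
  .seq (.rep 10 1 (.ite (const 0) (heavyExp 10)
    (.ite (const 0) (get 14 (get 10 (var 10))) (.put 1 (var 10) (get 11 (get 10 (var 10))))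
      (.put 1 (var 10) (get 10 (var 10)))) (.put 1 (var 10) (get 6 (var 10)))))
    (.set 7 (add (var 5) (const 1)))

theorem recordJobsCmd_spec (s : State) : (∀ j < s.var 1, (recordJobsCmd.exec s).arr 1 j = s.arr 6 j) ∧
    (recordJobsCmd.exec s).var 7 = s.var 5 + 1 := by
  have e := exec_rep_table (x := 10) (b := 1) (p := .put 1 (var 10) (get 6 (var 10))) rfl
    (s := s) (a := 1) (s.arr 6)
    (fun i hi t ht hv ha => by simp [exec, State.setCell, eval, ht, ha 6 rfl])
  refine ⟨fun j hj => ?_, ?_⟩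
  · change ((Cmd.rep 10 1 (.put 1 (var 10) (get 6 (var 10)))).exec s).arr 1 j = _
    rw [e]
    exact if_pos hj
  · change ((Cmd.rep 10 1 (.put 1 (var 10) (get 6 (var 10)))).exec s).var 5 + 1 = _
    rw [exec_var rfl]

theorem recordMixedCmd_spec {I : TwoSize} {s : State} (h : Ctx I s) :
    (∀ j < I.N, (recordMixedCmd.exec s).arr 1 j = if 0 < I.hb j then
      if 0 < s.arr 14 (s.arr 10 j) then s.arr 11 (s.arr 10 j) else s.arr 10 j else s.arr 6 j) ∧
    (recordMixedCmd.exec s).var 7 = s.var 5 + 1 := by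
  set q : Cmd := .ite (const 0) (heavyExp 10)
    (.ite (const 0) (get 14 (get 10 (var 10))) (.put 1 (var 10) (get 11 (get 10 (var 10))))
      (.put 1 (var 10) (get 10 (var 10)))) (.put 1 (var 10) (get 6 (var 10))) with hq
  have e := exec_rep_table (x := 10) (b := 1) (p := q) rfl
    (s := s) (a := 1) (fun j => if 0 < I.hb j then
      if 0 < s.arr 14 (s.arr 10 j) then s.arr 11 (s.arr 10 j) else s.arr 10 j else s.arr 6 j)
    (fun i hi t ht hv ha => by
      have := h.hb i (h.N ▸ hi)
      simp only [hq, exec, eval, ht, ha 0 rfl, ha 2 rfl, ha 14 rfl, ha 10 rfl, ha 11 rfl,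
        ha 6 rfl, this, State.setCell]
      split_ifs <;> simp)
  refine ⟨fun j hj => ?_, ?_⟩
  · change ((Cmd.rep 10 1 q).exec s).arr 1 j = _
    rw [e]
    exact if_pos (h.N ▸ hj)
  · change ((Cmd.rep 10 1 q).exec s).var 5 + 1 = _
    rw [exec_var (p := rep 10 1 q) rfl]

/-- Look for an assignment for the guess in variable `5`, which is at least twice the heavy
weight. -/
def tryJobsCmd : Cmd :=
  .seq setupJobsCmd <| .seq localSearchCmd <| .ite (const 0) (var 20) .skip recordJobsCmd

/-- Assign the light jobs and combine them with the heavy jobs. -/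
def lightCmd : Cmd :=
  .seq setupLightCmd <| .seq localSearchCmd <| .ite (const 0) (var 20) .skip <|
  .seq markCmd recordMixedCmd

/-- Look for an assignment for the guess in variable `5`, which is less than twice the heavy
weight. -/
def tryMixedCmd : Cmd :=
  .seq setupHeavyCmd <| .seq localSearchCmd <| .ite (const 0) (var 20) .skip <|
  .seq parentCmd <| .seq rootCmd lightCmd

/-- The outcome of a search with guess `T` that leads from memory `s` to memory `t`. -/
def Outcome (I : TwoSize) (T : ℕ) (s t : State) : Prop :=
  (t.var 7 = T + 1 ∧ I.Sol (T + T / 2) (t.arr 1)) ∨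
  (t.var 7 = s.var 7 ∧ t.arr 1 = s.arr 1 ∧ ∀ τ, ¬ I.Sol T τ)

theorem _root_.TwoSize.Sol.congr {I : TwoSize} {T : ℕ} {σ τ : ℕ → ℕ} (h : I.Sol T σ)
    (hστ : ∀ j < I.N, τ j = σ j) : I.Sol T τ := by
  refine ⟨fun j hj => by rw [hστ j hj]; exact h.1 j hj, fun v hv => ?_⟩
  have : jobLoad I.N I.jw τ v = jobLoad I.N I.jw σ v :=
    sum_congr rfl fun j hj => by rw [hστ j (mem_range.1 hj)]
  rw [this]
  exact h.2 v hv

theorem tryJobsCmd_spec {I : TwoSize} {s : State} (h : Ctx I s) (hT : ¬ s.var 5 < I.W + I.W) :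
    Ctx I (tryJobsCmd.exec s) ∧ Outcome I (s.var 5) s (tryJobsCmd.exec s) := by
  set s1 := setupJobsCmd.exec s with hs1
  set s2 := localSearchCmd.exec s1 with hs2
  have h1 : Ctx I s1 := h.exec' rfl rfl
  have E := setupJobsCmd_spec h
  obtain ⟨ht, hI, hb, he, -⟩ := localSearchCmd_spec E (ω := I.W) (fun j hj => by
    have := I.w_lt
    change I.jw j ≤ I.W
    unfold TwoSize.jw
    split_ifs <;> omega) h1.valid (by rw [h1.N1, h1.N])
  have h2 : Ctx I s2 := h1.exec rfl hI.valid
  have f7 : s2.var 7 = s.var 7 := (exec_var rfl s1).trans (exec_var rfl s)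
  have f5 : s2.var 5 = s.var 5 := (exec_var rfl s1).trans (exec_var rfl s)
  have f1 : s2.arr 1 = s.arr 1 := (exec_arr rfl s1).trans (exec_arr rfl s)
  have hexec : tryJobsCmd.exec s = if 0 < s2.var 20 then s2 else recordJobsCmd.exec s2 := rfl
  rw [hexec]
  split_ifs with h20
  · refine ⟨h2, Or.inr ⟨f7, f1, fun τ hτ => hτ.jobNet_not_blocked hT hI (hb h20)⟩⟩
  · obtain ⟨r1, r2⟩ := recordJobsCmd_spec s2
    refine ⟨h2.exec' rfl rfl, Or.inl ⟨by rw [r2, f5], ?_⟩⟩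
    refine TwoSize.Sol.congr (σ := s2.arr 6) ⟨hI.valid, fun v hv => ?_⟩
      fun j hj => r1 j (h2.N ▸ hj)
    by_contra hcon
    exact he h20 v hv (Or.inl (not_le.1 hcon))

/-- Failure is refuted by `lightNet_not_blocked`, success is turned into a solution by
`Forest.flip`. Array `14` agrees with `Marked` because groups, loads and threshold in memory are
those of `lightNet`. -/
theorem lightCmd_spec {I : TwoSize} {s : State} (h : Ctx I s) (hT : s.var 5 < I.W + I.W)
    (F : I.Forest (s.var 5) (s.arr 10) (s.arr 11))
    (hF : ∀ v < I.M, (0 < s.arr 12 v ↔ I.Free (s.arr 10) v))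
    (hR : ∀ v < I.M, s.arr 13 v = (s.arr 11)^[I.M] v) :
    Ctx I (lightCmd.exec s) ∧ Outcome I (s.var 5) s (lightCmd.exec s) := by
  have E := setupLightCmd_spec h F hF hR
  have h1 : Ctx I (setupLightCmd.exec s) := h.exec' rfl rfl
  have e1 : ((setupLightCmd.exec s).arr 1 = s.arr 1 ∧ (setupLightCmd.exec s).arr 10 = s.arr 10 ∧
      (setupLightCmd.exec s).arr 11 = s.arr 11) ∧
      ((setupLightCmd.exec s).var 5 = s.var 5 ∧ (setupLightCmd.exec s).var 7 = s.var 7) :=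
    ⟨⟨exec_arr rfl s, exec_arr rfl s, exec_arr rfl s⟩, exec_var rfl s, exec_var rfl s⟩
  have hexec : lightCmd.exec s = if 0 < (localSearchCmd.exec (setupLightCmd.exec s)).var 20 then
    localSearchCmd.exec (setupLightCmd.exec s) else recordMixedCmd.exec
      (markCmd.exec (localSearchCmd.exec (setupLightCmd.exec s))) := rfl
  rw [hexec]
  clear hexec
  generalize setupLightCmd.exec s = s1 at *
  obtain ⟨h', hI, hb, he, hl⟩ := localSearchCmd_spec E (ω := I.w) (fun j hj => by
    change I.lw j ≤ I.w
    unfold TwoSize.lw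
    split_ifs <;> omega) h1.valid (by rw [h1.N1, h1.N])
  have h2 : Ctx I (localSearchCmd.exec s1) := h1.exec rfl hI.valid
  have e2 : ((localSearchCmd.exec s1).arr 1 = s1.arr 1 ∧
      (localSearchCmd.exec s1).arr 5 = s1.arr 5 ∧ (localSearchCmd.exec s1).arr 10 = s1.arr 10 ∧
      (localSearchCmd.exec s1).arr 11 = s1.arr 11) ∧
      ((localSearchCmd.exec s1).var 5 = s1.var 5 ∧ (localSearchCmd.exec s1).var 6 = s1.var 6 ∧
      (localSearchCmd.exec s1).var 7 = s1.var 7) :=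
    ⟨⟨exec_arr rfl s1, exec_arr rfl s1, exec_arr rfl s1, exec_arr rfl s1⟩,
      exec_var rfl s1, exec_var rfl s1, exec_var rfl s1⟩
  generalize localSearchCmd.exec s1 = s2 at *
  obtain ⟨⟨a1, a10, a11⟩, v5, v7⟩ := e1
  obtain ⟨⟨b1, b5, b10, b11⟩, w5, w6, w7⟩ := e2
  by_cases h20 : 0 < s2.var 20
  · rw [if_pos h20]
    exact ⟨h2, Or.inr ⟨w7.trans v7, b1.trans a1,
      fun τ hτ => F.lightNet_not_blocked hT hτ hI (hb h20)⟩⟩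
  rw [if_neg h20]
  have h3 : Ctx I (markCmd.exec s2) := h2.exec' rfl rfl
  have e3 : ((markCmd.exec s2).arr 6 = s2.arr 6 ∧ (markCmd.exec s2).arr 10 = s2.arr 10 ∧
      (markCmd.exec s2).arr 11 = s2.arr 11) ∧ (markCmd.exec s2).var 5 = s2.var 5 :=
    ⟨⟨exec_arr rfl s2, exec_arr rfl s2, exec_arr rfl s2⟩, exec_var rfl s2⟩
  have hmark := fun u => markCmd_spec s2 (u := u)
  generalize markCmd.exec s2 = s3 at *
  obtain ⟨⟨c6, c10, c11⟩, x5⟩ := e3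
  obtain ⟨r1, r2⟩ := recordMixedCmd_spec h3
  refine ⟨h3.exec' rfl rfl, Or.inl ⟨by rw [r2, x5, w5, v5], ?_⟩⟩
  refine F.flip hI.valid (he h20) fun j hj => ?_
  rw [r1 j hj, c10, b10, a10, c11, b11, a11, c6]
  by_cases hh : 0 < I.hb j
  · rw [if_pos hh, if_pos hh]
    have hv := (F.valid j hj).1
    have hiff : 0 < s3.arr 14 (s.arr 10 j) ↔
        I.Marked (s.var 5) (s.arr 10) (s.arr 11) (s2.arr 6) (s.arr 10 j) := by
      rw [hmark _ (by rw [h2.M]; exact hv), h2.M, b11, a11]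
      refine exists_congr fun v => and_congr_right fun hv => ?_
      have q1 : s2.arr 5 v = _ := (congrFun b5 v).trans (E.grp v hv)
      have q2 := hl v hv
      have q3 : s2.var 6 = _ := w6.trans E.thr
      rw [q1, q3, q2, h2.W]
      rfl
    split_ifs with k1 k2 k2
    · rfl
    · exact absurd (hiff.1 k1) k2
    · exact absurd (hiff.2 k2) k1
    · rfl
  · rw [if_neg hh, if_neg hh]

theorem tryMixedCmd_spec {I : TwoSize} {s : State} (h : Ctx I s) (hT : s.var 5 < I.W + I.W) :
    Ctx I (tryMixedCmd.exec s) ∧ Outcome I (s.var 5) s (tryMixedCmd.exec s) := by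
  have E := setupHeavyCmd_spec h
  have h1 : Ctx I (setupHeavyCmd.exec s) := h.exec' rfl rfl
  have e1 : (setupHeavyCmd.exec s).arr 1 = s.arr 1 ∧ (setupHeavyCmd.exec s).var 5 = s.var 5 ∧
      (setupHeavyCmd.exec s).var 7 = s.var 7 := ⟨exec_arr rfl s, exec_var rfl s, exec_var rfl s⟩
  have hexec : tryMixedCmd.exec s = if 0 < (localSearchCmd.exec (setupHeavyCmd.exec s)).var 20 then
    localSearchCmd.exec (setupHeavyCmd.exec s) else lightCmd.exec (rootCmd.exec
      (parentCmd.exec (localSearchCmd.exec (setupHeavyCmd.exec s)))) := rfl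
  rw [hexec]
  clear hexec
  generalize setupHeavyCmd.exec s = s1 at *
  obtain ⟨h', hI, hb, he, -⟩ := localSearchCmd_spec E (ω := 1) (fun j hj => I.hb_le j hj)
    h1.valid (by rw [h1.N1, h1.N])
  have h2 : Ctx I (localSearchCmd.exec s1) := h1.exec rfl hI.valid
  have e2 : (localSearchCmd.exec s1).arr 1 = s1.arr 1 ∧ (localSearchCmd.exec s1).var 5 = s1.var 5 ∧
      (localSearchCmd.exec s1).var 7 = s1.var 7 :=
    ⟨exec_arr rfl s1, exec_var rfl s1, exec_var rfl s1⟩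
  generalize localSearchCmd.exec s1 = s2 at *
  obtain ⟨a1, v5, v7⟩ := e1
  obtain ⟨b1, w5, w7⟩ := e2
  by_cases h20 : 0 < s2.var 20
  · rw [if_pos h20]
    exact ⟨h2, Or.inr ⟨w7.trans v7, b1.trans a1,
      fun τ hτ => hτ.heavyNet_not_blocked hT hI (hb h20)⟩⟩
  rw [if_neg h20]
  -- No machine is eligible in `heavyNet`, so none exceeds the threshold `1`.
  have hcap : ∀ v < I.M, (I.heavyNet (s.var 5)).A (s2.arr 6) v ≤ 1 := by
    intro v hv
    by_contra hcon
    exact he h20 v hv (Or.inl (not_le.1 hcon))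
  obtain ⟨F, hF⟩ := parentCmd_spec h2 hcap
  have h3 : Ctx I (parentCmd.exec s2) := h2.exec' rfl rfl
  have e3 : (parentCmd.exec s2).arr 1 = s2.arr 1 ∧ (parentCmd.exec s2).var 5 = s2.var 5 ∧
      (parentCmd.exec s2).var 7 = s2.var 7 := ⟨exec_arr rfl s2, exec_var rfl s2, exec_var rfl s2⟩
  generalize parentCmd.exec s2 = s3 at *
  obtain ⟨c1, x5, x7⟩ := e3
  have h4 : Ctx I (rootCmd.exec s3) := h3.exec' rfl rfl
  have e4 : ((rootCmd.exec s3).arr 1 = s3.arr 1 ∧ (rootCmd.exec s3).arr 10 = s3.arr 10 ∧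
      (rootCmd.exec s3).arr 11 = s3.arr 11 ∧ (rootCmd.exec s3).arr 12 = s3.arr 12) ∧
      (rootCmd.exec s3).var 5 = s3.var 5 ∧ (rootCmd.exec s3).var 7 = s3.var 7 :=
    ⟨⟨exec_arr rfl s3, exec_arr rfl s3, exec_arr rfl s3, exec_arr rfl s3⟩,
      exec_var rfl s3, exec_var rfl s3⟩
  have hR := rootCmd_spec s3
  generalize rootCmd.exec s3 = s4 at *
  obtain ⟨⟨d1, d10, d11, d12⟩, y5, y7⟩ := e4
  have z5 : s4.var 5 = s.var 5 := by rw [y5, x5, w5, v5]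
  have key := lightCmd_spec h4 (by rw [z5]; exact hT) (by rw [z5, d10, d11]; exact F)
    (by rw [d10, d12]; exact hF)
    (fun v hv => by rw [hR, d11, h3.M]; exact if_pos hv)
  rw [z5] at key
  refine ⟨key.1, key.2.imp id fun ⟨k1, k2, k3⟩ => ⟨?_, ?_, k3⟩⟩
  · rw [k1, y7, x7, w7, v7]
  · rw [k2, d1, c1, b1, a1]

/-- Look for an assignment for the guess in variable `5` if it beats the guesses that were
successful so far. -/
def tryCmd : Cmd :=
  .seq (.set 21 (const 0)) <| .seq (when (var 7) (const 1) (.set 21 (const 1))) <|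
  .seq (when (add (var 5) (const 1)) (var 7) (.set 21 (const 1))) <|
  when (const 0) (var 21) <| .ite (var 5) (add (var 4) (var 4)) tryMixedCmd tryJobsCmd

/-- The memory holds an assignment for the best guess so far. -/
def Best (I : TwoSize) (s : State) : Prop :=
  Ctx I s ∧ ∀ T, s.var 7 = T + 1 → I.Sol (T + T / 2) (s.arr 1)

/-- A guess is tried only if none has succeeded or it is below the best one. Hence the best guess
never gets worse, and the search need not be monotone in the guess. -/
theorem tryCmd_spec {I : TwoSize} {s : State} (h : Best I s) :
    Best I (tryCmd.exec s) ∧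
    (0 < s.var 7 → 0 < (tryCmd.exec s).var 7 ∧ (tryCmd.exec s).var 7 ≤ s.var 7) ∧
    ∀ τ, I.Sol (s.var 5) τ → 0 < (tryCmd.exec s).var 7 ∧
      (tryCmd.exec s).var 7 ≤ s.var 5 + 1 := by
  set s1 := (Cmd.set 21 (const 0)).exec s with hs1
  set s2 := (when (var 7) (const 1) (.set 21 (const 1))).exec s1 with hs2
  set s3 := (when (add (var 5) (const 1)) (var 7) (.set 21 (const 1))).exec s2 with hs3
  have h3 : Ctx I s3 := ((h.1.exec' (p := .set 21 (const 0)) rfl rfl).exec'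
    (p := when (var 7) (const 1) (.set 21 (const 1))) rfl rfl).exec'
    (p := when (add (var 5) (const 1)) (var 7) (.set 21 (const 1))) rfl rfl
  have v5 : s3.var 5 = s.var 5 := (exec_var rfl s2).trans ((exec_var rfl s1).trans rfl)
  have v7 : s3.var 7 = s.var 7 := (exec_var rfl s2).trans ((exec_var rfl s1).trans rfl)
  have a1 : s3.arr 1 = s.arr 1 := (exec_arr rfl s2).trans ((exec_arr rfl s1).trans rfl)
  have h21 : 0 < s3.var 21 ↔ s.var 7 = 0 ∨ s.var 5 + 1 < s.var 7 := by
    by_cases c1 : s.var 7 < 1 <;> by_cases c2 : s.var 5 + 1 < s.var 7 <;>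
    simp [hs3, hs2, hs1, exec, eval, State.setVar, c1, c2] <;> omega
  have hexec : tryCmd.exec s = if 0 < s3.var 21 then
    (if s3.var 5 < s3.var 4 + s3.var 4 then tryMixedCmd.exec s3 else tryJobsCmd.exec s3)
    else s3 := rfl
  rw [hexec, h3.W]
  by_cases hgo : 0 < s3.var 21
  · rw [if_pos hgo]
    have hout : Ctx I (if s3.var 5 < I.W + I.W then tryMixedCmd.exec s3 else tryJobsCmd.exec s3) ∧
        Outcome I (s3.var 5) s3
          (if s3.var 5 < I.W + I.W then tryMixedCmd.exec s3 else tryJobsCmd.exec s3) := by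
      split_ifs with hT
      · exact tryMixedCmd_spec h3 hT
      · exact tryJobsCmd_spec h3 hT
    generalize (if s3.var 5 < I.W + I.W then tryMixedCmd.exec s3 else tryJobsCmd.exec s3) = t at *
    obtain ⟨hc, hout⟩ := hout
    rw [h21] at hgo
    rcases hout with ⟨o1, o2⟩ | ⟨o1, o2, o3⟩
    · rw [v5] at o1 o2
      refine ⟨⟨hc, fun T hT => ?_⟩, fun h0 => ?_, fun τ hτ => ?_⟩
      · obtain rfl : T = s.var 5 := by omega
        exact o2
      · omega
      · omega
    · rw [v7] at o1
      rw [a1] at o2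
      rw [v5] at o3
      refine ⟨⟨hc, fun T hT => ?_⟩, fun h0 => ?_, fun τ hτ => absurd hτ (o3 τ)⟩
      · rw [o2]
        exact h.2 T (by omega)
      · omega
  · rw [if_neg hgo]
    rw [h21] at hgo
    refine ⟨⟨h3, fun T hT => ?_⟩, fun h0 => ?_, fun τ hτ => ?_⟩
    · rw [a1]
      exact h.2 T (by omega)
    · omega
    · omega

end RAM

namespace RAM

open Cmd Exp

/-! ## Trying all candidates for the optimum -/

/-- If `T` is the makespan of an assignment, then the best guess so far is at most `T`. -/
def Beats (I : TwoSize) (T : ℕ) (s : State) : Prop :=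
  ∀ τ, I.Sol T τ → 0 < s.var 7 ∧ s.var 7 ≤ T + 1

/-- The best guess in memory `t` is at least as good as the one in memory `s`. -/
def Improves (s t : State) : Prop := 0 < s.var 7 → 0 < t.var 7 ∧ t.var 7 ≤ s.var 7

theorem Improves.trans {s t u : State} (h : Improves s t) (h' : Improves t u) : Improves s u :=
  fun h0 => ⟨(h' (h h0).1).1, (h' (h h0).1).2.trans (h h0).2⟩

theorem Beats.mono {I : TwoSize} {T : ℕ} {s t : State} (h : Beats I T s) (h' : Improves s t) :
    Beats I T t := fun τ hτ => ⟨(h' (h τ hτ).1).1, (h' (h τ hτ).1).2.trans (h τ hτ).2⟩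

theorem Best.setVar {I : TwoSize} {s : State} (h : Best I s) {x : ℕ} (hx : x = 5 ∨ 7 < x) (c : ℕ) :
    Best I (s.setVar x c) := by
  refine ⟨h.1.congr (fun y hy => Function.update_of_ne (by omega) _ _) rfl rfl h.1.valid,
    fun T hT => h.2 T ?_⟩
  rw [← hT]
  exact (Function.update_of_ne (by omega) _ _).symm

/-- Try all numbers of light jobs. -/
def lightLoopCmd : Cmd := .rep 23 2 (.seq tryCmd (.set 5 (add (var 5) (var 3))))

/-- Try all numbers of heavy and light jobs. -/
def heavyLoopCmd : Cmd :=
  .rep 22 2 (.seq (.set 5 (var 25)) (.seq lightLoopCmd (.set 25 (add (var 25) (var 4)))))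

/-- Try all machines and all numbers of heavy and light jobs. -/
def machineLoopCmd : Cmd := .rep 24 0 (.seq (.set 25 (dlExp 24)) heavyLoopCmd)

/-- Candidates are produced by repeated addition, as the machine cannot multiply. A bound once
reached persists because the best guess only improves. -/
theorem lightLoopCmd_spec {I : TwoSize} {s : State} (h : Best I s) :
    Best I (lightLoopCmd.exec s) ∧ Improves s (lightLoopCmd.exec s) ∧
    ∀ b < I.N + 1, Beats I (s.var 5 + b * I.w) (lightLoopCmd.exec s) := by
  have key := rep_inv (x := 23) (b := 2) (p := .seq tryCmd (.set 5 (add (var 5) (var 3)))) rfl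
    (s := s) (fun n t => Best I t ∧ Improves s t ∧ t.var 5 = s.var 5 + n * I.w ∧
      ∀ b < n, Beats I (s.var 5 + b * I.w) t)
    ⟨h.setVar (by omega) 0, fun h0 => ⟨h0, le_rfl⟩, by simp [State.setVar],
      fun b hb => by omega⟩ ?_
  · rw [h.1.N1] at key
    exact ⟨key.1, key.2.1, key.2.2.2⟩
  · rintro i hi t ht hva har ⟨h1, h2, h3, h4⟩
    obtain ⟨k1, k2, k3⟩ := tryCmd_spec h1
    have v5 : (tryCmd.exec t).var 5 = t.var 5 := exec_var rfl t
    have himp : Improves t (((Cmd.seq tryCmd (.set 5 (add (var 5) (var 3)))).exec t).setVar 23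
      (i + 1)) := k2
    refine ⟨(k1.setVar (Or.inl rfl) _).setVar (by omega) _, h2.trans himp, ?_, ?_⟩
    · change (tryCmd.exec t).var 5 + (tryCmd.exec t).var 3 = _
      rw [v5, k1.1.w, h3]
      ring
    · rw [Nat.forall_lt_succ_right]
      refine ⟨fun b hb => (h4 b hb).mono himp, ?_⟩
      rw [← h3]
      exact k3

theorem heavyLoopCmd_spec {I : TwoSize} {s : State} (h : Best I s) :
    Best I (heavyLoopCmd.exec s) ∧ Improves s (heavyLoopCmd.exec s) ∧
    ∀ a < I.N + 1, ∀ b < I.N + 1,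
      Beats I (s.var 25 + a * I.W + b * I.w) (heavyLoopCmd.exec s) := by
  have key := rep_inv (x := 22) (b := 2) (p := .seq (.set 5 (var 25)) (.seq lightLoopCmd
    (.set 25 (add (var 25) (var 4))))) rfl
    (s := s) (fun n t => Best I t ∧ Improves s t ∧ t.var 25 = s.var 25 + n * I.W ∧
      ∀ a < n, ∀ b < I.N + 1, Beats I (s.var 25 + a * I.W + b * I.w) t)
    ⟨h.setVar (by omega) 0, fun h0 => ⟨h0, le_rfl⟩, by simp [State.setVar],
      fun b hb => by omega⟩ ?_
  · rw [h.1.N1] at key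
    exact ⟨key.1, key.2.1, key.2.2.2⟩
  · rintro i hi t ht hva har ⟨h1, h2, h3, h4⟩
    obtain ⟨k1, k2, k3⟩ := lightLoopCmd_spec (h1.setVar (x := 5) (Or.inl rfl) (t.var 25))
    have v5 : (t.setVar 5 (t.var 25)).var 5 = t.var 25 := rfl
    rw [v5, h3] at k3
    have v25 : (lightLoopCmd.exec (t.setVar 5 (t.var 25))).var 25 = t.var 25 := exec_var rfl _
    have hexec : (Cmd.seq (.set 5 (var 25)) (.seq lightLoopCmd
      (.set 25 (add (var 25) (var 4))))).exec t = (lightLoopCmd.exec (t.setVar 5 (t.var 25))).setVar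
        25 ((lightLoopCmd.exec (t.setVar 5 (t.var 25))).var 25 +
          (lightLoopCmd.exec (t.setVar 5 (t.var 25))).var 4) := rfl
    rw [hexec, v25, k1.1.W, h3]
    rw [h3] at k1 k2
    generalize lightLoopCmd.exec (t.setVar 5 (s.var 25 + i * I.W)) = t' at *
    have himp : Improves t ((t'.setVar 25 (s.var 25 + i * I.W + I.W)).setVar 22 (i + 1)) := k2
    refine ⟨(k1.setVar (by omega) _).setVar (by omega) _, h2.trans himp, ?_, ?_⟩
    · change s.var 25 + i * I.W + I.W = _
      ring
    · rw [Nat.forall_lt_succ_right]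
      exact ⟨fun a ha b hb => (h4 a ha b hb).mono himp, k3⟩

theorem machineLoopCmd_spec {I : TwoSize} {s : State} (h : Best I s) :
    Best I (machineLoopCmd.exec s) ∧ ∀ v < I.M, ∀ a < I.N + 1, ∀ b < I.N + 1,
      Beats I (I.dl v + a * I.W + b * I.w) (machineLoopCmd.exec s) := by
  have key := rep_inv (x := 24) (b := 0) (p := .seq (.set 25 (dlExp 24)) heavyLoopCmd) rfl
    (s := s) (fun n t => Best I t ∧
      ∀ v < n, ∀ a < I.N + 1, ∀ b < I.N + 1, Beats I (I.dl v + a * I.W + b * I.w) t)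
    ⟨h.setVar (by omega) 0, fun b hb => by omega⟩ ?_
  · rw [h.1.M] at key
    exact key
  · rintro i hi t ht hva har ⟨h1, h4⟩
    obtain ⟨k1, k2, k3⟩ := heavyLoopCmd_spec (h1.setVar (x := 25) (by omega) (I.dl i))
    have hd := h1.1.dl i (h.1.M ▸ hi)
    have hexec : (Cmd.seq (.set 25 (dlExp 24)) heavyLoopCmd).exec t = heavyLoopCmd.exec
        (t.setVar 25 (t.arr 0 (t.var 24 + 4))) := rfl
    rw [hexec, ht, hd]
    have v25 : (t.setVar 25 (I.dl i)).var 25 = I.dl i := rfl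
    rw [v25] at k3
    generalize heavyLoopCmd.exec (t.setVar 25 (I.dl i)) = t' at *
    have himp : Improves t (t'.setVar 24 (i + 1)) := k2
    refine ⟨k1.setVar (by omega) _, ?_⟩
    rw [Nat.forall_lt_succ_right]
    exact ⟨fun v hv a ha b hb => (h4 v hv a ha b hb).mono himp, k3⟩

/-! ## Reading the input -/

/-- Compute where the jobs are described in the input. -/
def offsetCmd : Cmd :=
  .seq (.set 22 (add (var 0) (const 4))) <|
  .rep 10 1 (.seq (.put 2 (var 10) (var 22)) (.set 22 (add (add (var 22) (var 0)) (const 1))))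

theorem offsetCmd_spec (s : State) : ∀ j < s.var 1,
    (offsetCmd.exec s).arr 2 j = s.var 0 + 4 + j * (s.var 0 + 1) := by
  have key := rep_inv (x := 10) (b := 1) (p := .seq (.put 2 (var 10) (var 22))
    (.set 22 (add (add (var 22) (var 0)) (const 1)))) rfl (s := s.setVar 22 (s.var 0 + 4))
    (fun n t => t.var 22 = s.var 0 + 4 + n * (s.var 0 + 1) ∧
      ∀ j < n, t.arr 2 j = s.var 0 + 4 + j * (s.var 0 + 1))
    ⟨by simp [State.setVar], fun j hj => by omega⟩ ?_
  · exact key.2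
  · rintro i hi t ht hva har ⟨h1, h2⟩
    have v0 : t.var 0 = s.var 0 := hva 0 rfl
    refine ⟨?_, ?_⟩
    · change t.var 22 + t.var 0 + 1 = _
      rw [h1, v0]
      ring
    · rw [Nat.forall_lt_succ_right]
      refine ⟨fun j hj => ?_, ?_⟩
      · have : j ≠ i := by omega
        simp [exec, State.setVar, State.setCell, eval, ht, this, h2 j hj]
      · simp [exec, State.setVar, State.setCell, eval, ht, h1]

/-- Assign every job to some machine to which it may be assigned. -/
def assignCmd : Cmd :=
  .rep 10 1 <| .rep 8 0 <| when (const 0) (allowedExp 10 8) (.put 6 (var 10) (var 8))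

theorem assignCmd_spec (s : State)
    (hs : ∀ j < s.var 1, ∃ v < s.var 0, 0 < s.arr 0 (s.arr 2 j + v + 1)) : ∀ j < s.var 1,
    (assignCmd.exec s).arr 6 j < s.var 0 ∧
      0 < s.arr 0 (s.arr 2 j + (assignCmd.exec s).arr 6 j + 1) := by
  have key := rep_inv (x := 10) (b := 1) (p := .rep 8 0 <| when (const 0) (allowedExp 10 8)
    (.put 6 (var 10) (var 8))) rfl (s := s)
    (fun n t => ∀ j < n, t.arr 6 j < s.var 0 ∧ 0 < s.arr 0 (s.arr 2 j + t.arr 6 j + 1))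
    (fun j hj => by omega) ?_
  · exact key
  · rintro i hi t ht hva har hI
    have v0 : t.var 0 = s.var 0 := hva 0 rfl
    have a0 : t.arr 0 = s.arr 0 := har 0 rfl
    have a2 : t.arr 2 = s.arr 2 := har 2 rfl
    -- The last allowed machine met is kept; nothing is claimed about `z` until one has been met.
    have key := rep_inv (x := 8) (b := 0) (p := when (const 0) (allowedExp 10 8)
      (.put 6 (var 10) (var 8))) rfl (s := t)
      (fun n u => ∃ z, u.arr 6 = Function.update (t.arr 6) i z ∧
        ((∃ v < n, 0 < s.arr 0 (s.arr 2 i + v + 1)) → z < s.var 0 ∧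
          0 < s.arr 0 (s.arr 2 i + z + 1)))
      ⟨t.arr 6 i, by simp [State.setVar], by rintro ⟨v, hv, -⟩; omega⟩ ?_
    · rw [v0] at key
      obtain ⟨z, hz, hz'⟩ := key
      intro j hj
      change ((Cmd.rep 8 0 (when (const 0) (allowedExp 10 8) (.put 6 (var 10) (var 8)))).exec t).arr
        6 j < _ ∧ 0 < s.arr 0 (s.arr 2 j + ((Cmd.rep 8 0 (when (const 0) (allowedExp 10 8)
          (.put 6 (var 10) (var 8)))).exec t).arr 6 j + 1)
      rw [hz]
      by_cases hji : j = i
      · subst hji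
        simpa using hz' (hs j hi)
      · rw [Function.update_of_ne hji]
        exact hI j (by omega)
    · rintro x hx u hu huv hua ⟨z, hz, hz'⟩
      have b0 : u.arr 0 = s.arr 0 := (hua 0 rfl).trans a0
      have b2 : u.arr 2 = s.arr 2 := (hua 2 rfl).trans a2
      have w10 : u.var 10 = i := (huv 10 rfl).trans ht
      rw [exec_when]
      simp only [eval, b0, b2, w10, hu]
      split_ifs with hc
      · refine ⟨x, ?_, fun _ => ⟨v0 ▸ hx, hc⟩⟩
        simp [exec, State.setVar, State.setCell, eval, hu, w10, hz]
      · refine ⟨z, hz, ?_⟩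
        rw [Nat.exists_lt_succ_right]
        rintro (h | h)
        · exact hz' h
        · exact absurd h hc

/-- The program, once the numbers of machines and jobs have been read. -/
def mainCmd : Cmd :=
  .seq (.set 3 (get 0 (const 2))) <| .seq (.set 4 (get 0 (const 3))) <|
  .seq offsetCmd <| .seq assignCmd machineLoopCmd

/-- A solution for one of the candidates forces the final value `T + 1` of variable `7` to be
positive with `T` at most this candidate; `Best` then says what array `1` holds. -/
theorem mainCmd_spec {I : TwoSize} {s : State} (hM : s.var 0 = I.M) (hN : s.var 1 = I.N)
    (hN1 : s.var 2 = I.N + 1) (h7 : s.var 7 = 0) (hw : s.arr 0 2 = I.w) (hW : s.arr 0 3 = I.W)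
    (hdl : ∀ v < I.M, s.arr 0 (v + 4) = I.dl v)
    (hhb : ∀ j < I.N, s.arr 0 (I.M + 4 + j * (I.M + 1)) = I.hb j)
    (hal : ∀ j < I.N, ∀ v < I.M, 0 < s.arr 0 (I.M + 4 + j * (I.M + 1) + v + 1) ↔ I.al j v)
    (hne : ∀ j < I.N, ∃ v < I.M, I.al j v) {v a b : ℕ} (hv : v < I.M) (ha : a ≤ I.N) (hb : b ≤ I.N)
    {τ : ℕ → ℕ} (hτ : I.Sol (I.dl v + a * I.W + b * I.w) τ) :
    ∃ T ≤ I.dl v + a * I.W + b * I.w, I.Sol (T + T / 2) ((mainCmd.exec s).arr 1) := by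
  set s1 := (s.setVar 3 (s.arr 0 2)).setVar 4 (s.arr 0 3) with hs1
  have hoff := offsetCmd_spec s1
  have f1 : (s1.var 0 = I.M ∧ s1.var 1 = I.N ∧ s1.var 2 = I.N + 1 ∧ s1.var 3 = I.w ∧
      s1.var 4 = I.W ∧ s1.var 7 = 0) ∧ s1.arr 0 = s.arr 0 :=
    ⟨⟨hM, hN, hN1, hw, hW, h7⟩, rfl⟩
  have hexec : mainCmd.exec s = machineLoopCmd.exec (assignCmd.exec (offsetCmd.exec s1)) := rfl
  rw [hexec]
  clear hexec
  clear_value s1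
  have f2 : ((offsetCmd.exec s1).var 0 = s1.var 0 ∧ (offsetCmd.exec s1).var 1 = s1.var 1 ∧
      (offsetCmd.exec s1).var 2 = s1.var 2 ∧ (offsetCmd.exec s1).var 3 = s1.var 3 ∧
      (offsetCmd.exec s1).var 4 = s1.var 4 ∧ (offsetCmd.exec s1).var 7 = s1.var 7) ∧
      (offsetCmd.exec s1).arr 0 = s1.arr 0 :=
    ⟨⟨exec_var rfl s1, exec_var rfl s1, exec_var rfl s1, exec_var rfl s1, exec_var rfl s1,
      exec_var rfl s1⟩, exec_arr rfl s1⟩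
  generalize offsetCmd.exec s1 = s2 at *
  obtain ⟨⟨x0, x1, x2, x3, x4, x7⟩, x⟩ := f1
  obtain ⟨⟨y0, y1, y2, y3, y4, y7⟩, y⟩ := f2
  rw [x0, x1] at hoff
  have hasg := assignCmd_spec s2 (by
    rw [y0, x0, y1, x1, y, x]
    intro j hj
    obtain ⟨v, hv, hv'⟩ := hne j hj
    rw [hoff j hj]
    exact ⟨v, hv, (hal j hj v hv).2 hv'⟩)
  rw [y0, x0, y1, x1, y, x] at hasg
  have f3 : ((assignCmd.exec s2).var 0 = s2.var 0 ∧ (assignCmd.exec s2).var 1 = s2.var 1 ∧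
      (assignCmd.exec s2).var 2 = s2.var 2 ∧ (assignCmd.exec s2).var 3 = s2.var 3 ∧
      (assignCmd.exec s2).var 4 = s2.var 4 ∧ (assignCmd.exec s2).var 7 = s2.var 7) ∧
      (assignCmd.exec s2).arr 0 = s2.arr 0 ∧ (assignCmd.exec s2).arr 2 = s2.arr 2 :=
    ⟨⟨exec_var rfl s2, exec_var rfl s2, exec_var rfl s2, exec_var rfl s2, exec_var rfl s2,
      exec_var rfl s2⟩, exec_arr rfl s2, exec_arr rfl s2⟩
  generalize assignCmd.exec s2 = s3 at *
  obtain ⟨⟨z0, z1, z2, z3, z4, z7⟩, z, z'⟩ := f3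
  have hctx : Ctx I s3 := by
    refine ⟨by omega, by omega, by omega, by omega, by omega, ?_, ?_, ?_, ?_⟩
    · rw [z, y, x]; exact hdl
    · intro j hj
      rw [z, y, x, z', hoff j hj]
      exact hhb j hj
    · intro j hj v hv
      rw [z, y, x, z', hoff j hj]
      exact hal j hj v hv
    · intro j hj
      obtain ⟨h1, h2⟩ := hasg j hj
      rw [hoff j hj, hal j hj _ h1] at h2
      exact ⟨h1, h2⟩
  obtain ⟨k1, k2⟩ := machineLoopCmd_spec (I := I) (s := s3) ⟨hctx, fun T hT => by omega⟩
  obtain ⟨h1, h2⟩ := k2 v hv a (by omega) b (by omega) τ hτ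
  exact ⟨_, Nat.sub_le_iff_le_add.2 h2, k1.2 _ (Nat.sub_add_cancel h1).symm⟩

end RAM

/-! ## The instance and its encoding -/

theorem List.getD_flatten_of_length {α : Type*} {L : ℕ} (d : α) :
    ∀ (l : List (List α)), (∀ x ∈ l, x.length = L) → ∀ j r, j < l.length → r < L →
      l.flatten.getD (j * L + r) d = (l.getD j []).getD r d
  | [], _, j, r, hj, _ => by simp at hj
  | x :: l, hl, 0, r, _, hr => by
    have hx := hl x (by simp)
    rw [List.flatten_cons, zero_mul, zero_add, List.getD_append _ _ _ _ (by omega)]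
    simp
  | x :: l, hl, j + 1, r, hj, hr => by
    have hx := hl x (by simp)
    rw [List.flatten_cons, List.getD_append_right _ _ _ _ (by rw [hx, add_mul]; omega), hx,
      show (j + 1) * L + r - L = j * L + r by rw [add_mul]; omega,
      List.getD_flatten_of_length d l (fun y hy => hl y (by simp [hy])) j r (by simpa using hj) hr]
    simp

theorem List.getD_ofFn {α : Type*} {n : ℕ} (f : Fin n → α) (d : α) (i : Fin n) :
    (List.ofFn f).getD i d = f i := by
  rw [List.getD_eq_getElem _ _ (by simp)]
  simp

namespace BalancingInstance

variable (I : BalancingInstance)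

/-- The description of a job in the encoding. -/
def jobCode (j : Fin I.n) : List ℕ :=
  (I.heavy j).toNat :: List.ofFn fun v => if v ∈ I.allowed j then 1 else 0

theorem encode_eq : I.encode =
    I.m :: I.n :: I.w :: I.W :: (List.ofFn I.dl ++ (List.ofFn I.jobCode).flatten) := by
  simp [encode]
  rfl

theorem length_jobCode (j : Fin I.n) : (I.jobCode j).length = I.m + 1 := by
  simp [jobCode]

theorem encode_getD_dl (v : Fin I.m) : I.encode.getD (v + 4) 0 = I.dl v := by
  rw [encode_eq]
  simp only [List.getD_cons_succ]
  rw [List.getD_append _ _ _ _ (by simp), List.getD_ofFn]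

theorem encode_getD_job (j : Fin I.n) {r : ℕ} (hr : r < I.m + 1) :
    I.encode.getD (I.m + 4 + j * (I.m + 1) + r) 0 = (I.jobCode j).getD r 0 := by
  rw [encode_eq, show I.m + 4 + (j : ℕ) * (I.m + 1) + r = (I.m + (j * (I.m + 1) + r)) + 4 by ring]
  simp only [List.getD_cons_succ]
  rw [List.getD_append_right _ _ _ _ (by simp)]
  simp only [List.length_ofFn, Nat.add_sub_cancel_left]
  rw [List.getD_flatten_of_length 0 _ (by simp [length_jobCode]) _ _
    (by simp) hr, List.getD_ofFn]

theorem length_encode : I.encode.length = I.m + 4 + I.n * (I.m + 1) := by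
  rw [encode_eq]
  simp [List.length_flatten, List.map_ofFn, Function.comp_def, length_jobCode]
  ring

/-- The separator makes even a zero count. As the encoding has more than `m` and more than `n`
entries, all loop bounds are at most the bit size. -/
theorem length_le_bitSize (l : List ℕ) : l.length ≤ RAM.bitSize l := by
  unfold RAM.bitSize
  induction l with
  | nil => simp
  | cons a l ih => simp only [List.length_cons, List.map_cons, List.sum_cons]; omega

/-- The instance with machines and jobs as natural numbers. -/
def toTwoSize : TwoSize where
  M := I.m
  N := I.n
  w := I.w
  W := I.W
  dl := fun v => if h : v < I.m then I.dl ⟨v, h⟩ else 0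
  hb := fun j => if h : j < I.n then (I.heavy ⟨j, h⟩).toNat else 0
  al := fun j v => ∃ (hj : j < I.n) (hv : v < I.m), (⟨v, hv⟩ : Fin I.m) ∈ I.allowed ⟨j, hj⟩
  w_pos := I.w_pos
  w_lt := I.w_lt_W
  hb_le := fun j hj => by
    rw [dif_pos hj]
    exact Bool.toNat_le _
  two := by
    rintro j hj hh a b c ha hb hc ⟨_, _, ha'⟩ ⟨_, _, hb'⟩ ⟨_, _, hc'⟩
    rw [dif_pos hj] at hh
    have h2 := I.allowed_heavy ⟨j, hj⟩ (by revert hh; cases I.heavy ⟨j, hj⟩ <;> simp)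
    by_contra! hne
    obtain ⟨h1, h3, h4⟩ := hne
    have h5 : ({⟨a, ha⟩, ⟨b, hb⟩, ⟨c, hc⟩} : Finset (Fin I.m)) ⊆ I.allowed ⟨j, hj⟩ := by
      simp [Finset.insert_subset_iff, ha', hb', hc']
    have h6 := Finset.card_le_card h5
    rw [Finset.card_insert_of_notMem (by simp [h1, h3]), Finset.card_pair (by simp [h4])] at h6
    omega

theorem toTwoSize_dl (v : Fin I.m) : I.toTwoSize.dl v = I.dl v := dif_pos v.2

theorem toTwoSize_hb (j : Fin I.n) : I.toTwoSize.hb j = (I.heavy j).toNat := dif_pos j.2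

variable {I}

theorem jobLoad_eq {σ : Fin I.n → Fin I.m} {φ : ℕ → ℕ} (h : ∀ j : Fin I.n, φ j = σ j) (v : Fin I.m) :
    I.toTwoSize.dl v + jobLoad I.n I.toTwoSize.jw φ v = I.load σ v := by
  unfold load jobLoad
  rw [Finset.sum_filter, Finset.sum_range]
  congr 1
  · simp [toTwoSize]
  · refine Finset.sum_congr rfl fun j _ => ?_
    have h1 : φ j = v ↔ σ j = v := by rw [h j, Fin.val_inj]
    have h2 : I.toTwoSize.jw j = I.weight j := by
      cases hj : I.heavy j <;> simp [TwoSize.jw, toTwoSize, weight, hj]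
    simp only [h1, h2]

theorem sol_iff {σ : Fin I.n → Fin I.m} {φ : ℕ → ℕ} (h : ∀ j : Fin I.n, φ j = σ j) (T : ℕ) :
    I.toTwoSize.Sol T φ ↔ I.IsAssignment σ ∧ I.makespan σ ≤ T := by
  unfold TwoSize.Sol makespan
  refine and_congr ⟨fun hv j => ?_, fun hv j hj => ?_⟩ ?_
  · obtain ⟨h1, h2, h3, h4⟩ := hv j j.2
    simpa [h j] using h4
  · have := h ⟨j, hj⟩
    simp only at this
    rw [this]
    exact ⟨(σ ⟨j, hj⟩).2, hj, (σ ⟨j, hj⟩).2, hv ⟨j, hj⟩⟩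
  · rw [Finset.sup_le_iff]
    refine ⟨fun hl v _ => ?_, fun hl v hv => ?_⟩
    · rw [← jobLoad_eq h]
      exact hl v v.2
    · have := hl ⟨v, hv⟩ (Finset.mem_univ _)
      rwa [← jobLoad_eq h] at this

variable (I)

theorem exists_opt : ∃ σ, I.IsAssignment σ ∧ I.makespan σ = I.opt :=
  Nat.sInf_mem (s := {T | ∃ σ, I.IsAssignment σ ∧ I.makespan σ = T})
    ⟨_, fun j => (I.allowed_nonempty j).choose, fun j => (I.allowed_nonempty j).choose_spec, rfl⟩

theorem jobLoad_le_card {N : ℕ} {wt σ : ℕ → ℕ} (h : ∀ j < N, wt j ≤ 1) (v : ℕ) :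
    jobLoad N wt σ v ≤ N := by
  unfold jobLoad
  calc _ ≤ ∑ j ∈ Finset.range N, 1 := Finset.sum_le_sum fun j hj => by
        have := h j (Finset.mem_range.1 hj)
        split_ifs <;> omega
    _ = N := by simp

end BalancingInstance

/-! ### The complete program and its guarantee -/

/-- The program: read the numbers of machines and jobs, then run the main part. -/
def RAM.balancingProg : RAM.Prog :=
  .seq (.set 0 (.get 0 (.const 0))) <| .seq (.set 1 (.get 0 (.const 1))) <|
  .seq (.set 2 (.add (.var 1) (.const 1))) RAM.mainCmd.compile

/-- There is one program, with running time polynomial in the bit size of the input, that on every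
instance halts with an assignment `σ` of makespan at most `1.5` times the optimum in the first `n`
cells of array `1`. -/
theorem theorem1 :
    ∃ (P : RAM.Prog) (p : Polynomial ℕ), ∀ I : BalancingInstance,
      ∃ (s : RAM.State) (k : ℕ) (σ : Fin I.n → Fin I.m),
        RAM.Runs P (RAM.init I.encode) s k ∧
        k ≤ p.eval (RAM.bitSize I.encode) ∧
        (∀ j : Fin I.n, s.arr 1 j = σ j) ∧
        I.IsAssignment σ ∧
        (I.makespan σ : ℚ) ≤ 3 / 2 * (I.opt : ℚ) := by
  -- The `10` pays for the three assignments that read the sizes, at cost `3`, `3` and `4`.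
  refine ⟨RAM.balancingProg, 10 + RAM.mainCmd.time, fun I => ?_⟩
  set s0 := RAM.init I.encode with hs0
  have hsize := BalancingInstance.length_le_bitSize I.encode
  rw [I.length_encode] at hsize
  have hnm : I.n ≤ I.n * (I.m + 1) := Nat.le_mul_of_pos_right _ (by omega)
  have e0 : s0.arr 0 0 = I.m := by simp [hs0, RAM.init, I.encode_eq]
  have e1 : s0.arr 0 1 = I.n := by simp [hs0, RAM.init, I.encode_eq]
  set s := ((s0.setVar 0 (s0.arr 0 0)).setVar 1 (s0.arr 0 1)).setVar 2 (s0.arr 0 1 + 1) with hs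
  have v0 : s.var 0 = I.m := e0
  have v1 : s.var 1 = I.n := e1
  have v2 : s.var 2 = I.n + 1 := congrArg (· + 1) e1
  obtain ⟨k, hk, hk'⟩ := RAM.Cmd.runs (p := RAM.mainCmd) rfl (L := RAM.bitSize I.encode) (s := s)
    (fun b hb => by interval_cases b <;> omega)
  have hrun : RAM.Runs RAM.balancingProg s0 (RAM.mainCmd.exec s) (3 + (3 + (4 + k))) :=
    .seq (.set 0 (.get 0 (.const 0)) s0) <| .seq (.set 1 (.get 0 (.const 1)) _) <|
      .seq (.set 2 (.add (.var 1) (.const 1)) _) hk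
  have htime : 3 + (3 + (4 + k)) ≤ (10 + RAM.mainCmd.time).eval (RAM.bitSize I.encode) := by
    simp only [Polynomial.eval_add, Polynomial.eval_ofNat]
    omega
  have harr : ∀ i, s.arr 0 i = I.encode.getD i 0 := fun i => by simp [hs, hs0, RAM.init, RAM.State.setVar]
  -- Without machines there are no jobs either, and the makespan is `0`. Otherwise some machine
  -- attains the maximal load.
  rcases Nat.eq_zero_or_pos I.m with hm | hm
  · have hm' : IsEmpty (Fin I.m) := by rw [hm]; infer_instance
    have hn' : IsEmpty (Fin I.n) := ⟨fun j => hm'.false (I.allowed_nonempty j).choose⟩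
    refine ⟨_, _, fun j => (hn'.false j).elim, hrun, htime, fun j => (hn'.false j).elim,
      fun j => (hn'.false j).elim, ?_⟩
    have : I.makespan (fun j => (hn'.false j).elim) = 0 := by
      simp [BalancingInstance.makespan, Finset.univ_eq_empty]
    rw [this]
    positivity
  · obtain ⟨σ, hσ, hopt⟩ := I.exists_opt
    obtain ⟨v, -, hv⟩ := Finset.exists_mem_eq_sup (Finset.univ : Finset (Fin I.m))
      ⟨⟨0, hm⟩, Finset.mem_univ _⟩ (I.load σ)
    set τ : ℕ → ℕ := fun j => if h : j < I.n then σ ⟨j, h⟩ else 0 with hτ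
    have hτσ : ∀ j : Fin I.n, τ j = σ j := fun j => by simp [hτ]
    -- The load of the fullest machine in an optimal assignment exhibits the optimum as one of the
    -- candidates.
    have hT : I.toTwoSize.dl v + I.toTwoSize.hc τ v * I.toTwoSize.W +
        I.toTwoSize.lc τ v * I.toTwoSize.w = I.opt := by
      rw [← hopt]
      unfold BalancingInstance.makespan
      rw [hv, ← BalancingInstance.jobLoad_eq hτσ]
      have := TwoSize.jobLoad_jw (I := I.toTwoSize) τ v
      change jobLoad I.n _ _ _ = _ at this
      rw [this]
      ring
    have hsol : I.toTwoSize.Sol I.opt τ := (BalancingInstance.sol_iff hτσ _).2 ⟨hσ, hopt.le⟩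
    rw [← hT] at hsol
    have hcode : ∀ (j : Fin I.n) (u : Fin I.m), s.arr 0 (I.m + 4 + j * (I.m + 1) + u + 1) =
        if u ∈ I.allowed j then 1 else 0 := fun j u => by
      rw [harr, add_assoc, I.encode_getD_job j (by omega)]
      unfold BalancingInstance.jobCode
      rw [List.getD_cons_succ, List.getD_ofFn]
    obtain ⟨T, hTle, hTsol⟩ := RAM.mainCmd_spec (I := I.toTwoSize) (s := s) v0 v1 v2 rfl
      (by rw [harr, I.encode_eq]; rfl) (by rw [harr, I.encode_eq]; rfl)
      (fun u hu => by
        rw [harr, I.encode_getD_dl ⟨u, hu⟩]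
        exact (I.toTwoSize_dl ⟨u, hu⟩).symm)
      (fun j hj => by
        rw [harr]
        refine (I.encode_getD_job ⟨j, hj⟩ (r := 0) (by omega)).trans ?_
        exact (I.toTwoSize_hb ⟨j, hj⟩).symm)
      (fun j hj u hu => by
        have := hcode ⟨j, hj⟩ ⟨u, hu⟩
        change 0 < s.arr 0 (I.m + 4 + j * (I.m + 1) + u + 1) ↔ _
        simp only at this
        rw [this]
        split_ifs with hmem
        · exact ⟨fun _ => ⟨hj, hu, hmem⟩, fun _ => one_pos⟩
        · exact ⟨fun h => absurd h (lt_irrefl _), fun ⟨_, _, h⟩ => absurd h hmem⟩)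
      (fun j hj => by
        obtain ⟨u, hu⟩ := I.allowed_nonempty ⟨j, hj⟩
        exact ⟨u, u.2, hj, u.2, hu⟩) v.2
      (BalancingInstance.jobLoad_le_card (fun j hj => I.toTwoSize.hb_le j hj) v)
      (BalancingInstance.jobLoad_le_card (fun j _ => Nat.sub_le _ _) v) hsol
    replace hTle := hTle.trans_eq hT
    have hval : ∀ j : Fin I.n, (RAM.mainCmd.exec s).arr 1 j < I.m := fun j => (hTsol.1 j j.2).1
    obtain ⟨r1, r2⟩ := (BalancingInstance.sol_iff
      (σ := fun j => ⟨(RAM.mainCmd.exec s).arr 1 j, hval j⟩) (fun _ => rfl) _).1 hTsol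
    refine ⟨_, _, _, hrun, htime, fun _ => rfl, r1, ?_⟩
    -- The makespan is at most `T + T / 2`, and `T` is at most the optimum.
    have h2 : 2 * I.makespan (fun j => ⟨(RAM.mainCmd.exec s).arr 1 j, hval j⟩) ≤ 3 * I.opt := by
      omega
    have h3 : (2 * I.makespan (fun j => ⟨(RAM.mainCmd.exec s).arr 1 j, hval j⟩) : ℚ) ≤
        3 * I.opt := by exact_mod_cast h2
    linarith
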